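/- Let $p$ be an odd prime, let $L/K$ be a Galois extension of number fields with $\mathrm{Gal}(L/K)\simeq \mathbb{Z}/p^n\mathbb{Z}$ for some $n\ge 1$, and let $E$ be an elliptic curve over $K$. Let $v\nmid p$ be a non-archimedean prime of $K$ at which $E$ has good reduction; write $K_v$ for the completion, $k_v$ for its residue field and $\widetilde E$ for the reduction of $E$ at $v$, an elliptic curve over $k_v$. For a field $F\supseteq K$ put $H^1(F,E):=H^1(\mathrm{Gal}(\overline F/F),E(\overline F))$ (continuous cohomology, $E(\overline F)$ being discrete), and let $$\gamma_v: H^1(K_v,E)[p]\longrightarrow \bigoplus_{w\mid v} H^1(L_w,E)[p]$$ be the restriction map, where $w$ runs over the primes of $L$ above $v$ (formed with any choice of $K_v$-embeddings $\overline{K_v}\hookrightarrow\overline{L_w}$). Then: (i) if $v$ is totally ramified in $L$, then $\dim_{\mathbb{F}_p}(\ker\gamma_v)\le \dim_{\mathbb{F}_p}\bigl(\widetilde E(k_v)[p]\bigr)$; (ii) if $v$ is unramified and inert in $L$ (that is, $v\mathcal{O}_L$ is a prime ideal), then $\gamma_v$ is injective; (iii) if $v$ is ramified in $L$ and $\widetilde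 E(k_v)[p]=0$, then $\gamma_v$ is injective. -/

import Mathlib

open NumberField IsDedekindDomain

namespace SelmerLocal

/-! ### Continuous `H¹` of a topological group with coefficients in a discrete module -/

section ContinuousH1

/-- Continuous 1-cocycles (crossed homomorphisms) `G → A`, where `A` is discrete: a map to a
discrete space is continuous exactly when it is locally constant. -/
def contZ1 (G A : Type*) [Group G] [TopologicalSpace G] [AddCommGroup A]
    [DistribMulAction G A] : AddSubgroup (G → A) where
  carrier := {f | IsLocallyConstant f ∧ ∀ g h : G, f (g * h) = f g + g • f h}
  zero_mem' := ⟨IsLocallyConstant.const 0, fun g h => by simp⟩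
  add_mem' := by
    rintro f f' ⟨hf, hf'⟩ ⟨hg, hg'⟩
    refine ⟨hf.add hg, fun g h => ?_⟩
    simp only [Pi.add_apply, hf', hg', smul_add]
    abel
  neg_mem' := by
    rintro f ⟨hf, hf'⟩
    refine ⟨hf.neg, fun g h => ?_⟩
    simp only [Pi.neg_apply, hf', smul_neg]
    abel

/-- Those continuous 1-cocycles that are coboundaries `g ↦ g • a - a`. -/
def contB1 (G A : Type*) [Group G] [TopologicalSpace G] [AddCommGroup A]
    [DistribMulAction G A] : AddSubgroup (contZ1 G A) where
  carrier := {f | ∃ a : A, ∀ g : G, f.1 g = g • a - a}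
  zero_mem' := ⟨0, fun g => by simp⟩
  add_mem' := by
    rintro f f' ⟨a, ha⟩ ⟨b, hb⟩
    refine ⟨a + b, fun g => ?_⟩
    simp only [AddSubgroup.coe_add, Pi.add_apply, ha, hb, smul_add]
    abel
  neg_mem' := by
    rintro f ⟨a, ha⟩
    refine ⟨-a, fun g => ?_⟩
    simp only [NegMemClass.coe_neg, Pi.neg_apply, ha, smul_neg]
    abel

/-- `H¹(G, A)`: continuous 1-cocycles modulo coboundaries. -/
abbrev contH1 (G A : Type*) [Group G] [TopologicalSpace G] [AddCommGroup A]
    [DistribMulAction G A] : Type _ :=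
  contZ1 G A ⧸ contB1 G A

variable {G H A B : Type*} [Group G] [TopologicalSpace G] [AddCommGroup A] [DistribMulAction G A]
  [Group H] [TopologicalSpace H] [AddCommGroup B] [DistribMulAction H B]

/-- Pull-back of cocycles along a compatible pair `φ : H → G`, `f : A → B`. -/
def contZ1Map (φ : H →* G) (hφ : Continuous φ) (f : A →+ B)
    (hf : ∀ (h : H) (a : A), f (φ h • a) = h • f a) : contZ1 G A →+ contZ1 H B where
  toFun c := ⟨fun h => f (c.1 (φ h)),
    (c.2.1.comp_continuous hφ).comp f, fun g h => by
      simp only [map_mul, c.2.2, map_add, hf]⟩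
  map_zero' := by ext h; simp
  map_add' c d := by ext h; simp

/-- The map `H¹(G, A) → H¹(H, B)` induced by a compatible pair `φ : H → G`, `f : A → B`. -/
def contH1Map (φ : H →* G) (hφ : Continuous φ) (f : A →+ B)
    (hf : ∀ (h : H) (a : A), f (φ h • a) = h • f a) : contH1 G A →+ contH1 H B :=
  QuotientAddGroup.map _ _ (contZ1Map φ hφ f hf) (by
    rintro c ⟨a, ha⟩
    refine ⟨f a, fun h => ?_⟩
    change f (c.1 (φ h)) = _
    rw [ha, map_sub, hf])

end ContinuousH1

/-! ### Absolute Galois groups and restriction -/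

section AbsoluteGalois

variable {k k' : Type*} [Field k] [Field k'] [Algebra k k']

/-- The homomorphism `Gal(k̄'/k') → Gal(k̄/k)` attached to a `k`-embedding `j : k̄ → k̄'`: the image
of `σ` is the unique `τ` with `j ∘ τ = σ ∘ j`. -/
noncomputable def absGalRestrict (j : AlgebraicClosure k →ₐ[k] AlgebraicClosure k') :
    (AlgebraicClosure k' ≃ₐ[k'] AlgebraicClosure k') →*
      (AlgebraicClosure k ≃ₐ[k] AlgebraicClosure k) :=
  letI : Algebra (AlgebraicClosure k) (AlgebraicClosure k') := j.toRingHom.toAlgebra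
  haveI : IsScalarTower k (AlgebraicClosure k) (AlgebraicClosure k') :=
    IsScalarTower.of_algebraMap_eq fun x => (j.commutes x).symm
  (AlgEquiv.restrictNormalHom (AlgebraicClosure k)).comp (AlgEquiv.restrictScalarsHom k)

theorem absGalRestrict_commutes (j : AlgebraicClosure k →ₐ[k] AlgebraicClosure k')
    (σ : AlgebraicClosure k' ≃ₐ[k'] AlgebraicClosure k') (x : AlgebraicClosure k) :
    j (absGalRestrict j σ x) = σ (j x) := by
  let : Algebra (AlgebraicClosure k) (AlgebraicClosure k') := j.toRingHom.toAlgebra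
  have : IsScalarTower k (AlgebraicClosure k) (AlgebraicClosure k') :=
    IsScalarTower.of_algebraMap_eq fun x => (j.commutes x).symm
  exact AlgEquiv.restrictNormal_commutes (σ.restrictScalars k) (AlgebraicClosure k) x

theorem continuous_absGalRestrict (j : AlgebraicClosure k →ₐ[k] AlgebraicClosure k') :
    Continuous (absGalRestrict j) := by
  refine continuous_of_continuousAt_one _ ?_
  rw [ContinuousAt, map_one]
  intro U hU
  rw [krullTopology_mem_nhds_one_iff] at hU
  obtain ⟨E, hE, hEU⟩ := hU
  obtain ⟨s, hs⟩ := IntermediateField.essFiniteType_iff.1 (inferInstance : Algebra.EssFiniteType k E)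
  rw [Filter.mem_map, krullTopology_mem_nhds_one_iff]
  refine ⟨IntermediateField.adjoin k' (j '' (s : Set (AlgebraicClosure k))), ?_, ?_⟩
  · have : Finite (j '' (s : Set (AlgebraicClosure k))) := (s.finite_toSet.image j).to_subtype
    exact IntermediateField.finiteDimensional_adjoin
      fun x _ => Algebra.IsIntegral.isIntegral x
  · intro σ hσ
    apply hEU
    have key : IntermediateField.adjoin k (s : Set (AlgebraicClosure k)) ≤
        IntermediateField.fixedField (Subgroup.zpowers (absGalRestrict j σ)) := by
      rw [IntermediateField.adjoin_le_iff]
      intro x hx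
      have h1 : absGalRestrict j σ x = x := by
        apply j.injective
        refine (absGalRestrict_commutes j σ x).trans ?_
        exact (IntermediateField.mem_fixingSubgroup_iff _ _).1 hσ _
          (IntermediateField.subset_adjoin _ _ ⟨x, hx, rfl⟩)
      have h2 : Subgroup.zpowers (absGalRestrict j σ) ≤ MulAction.stabilizer _ x := by
        rw [Subgroup.zpowers_le]
        exact h1
      rintro ⟨τ, hτ⟩
      exact h2 hτ
    rw [hs] at key
    refine (IntermediateField.mem_fixingSubgroup_iff _ _).2 fun x hx => ?_
    exact key hx ⟨_, Subgroup.mem_zpowers _⟩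

end AbsoluteGalois

/-! ### Galois cohomology of an elliptic curve -/

section EllipticCurveCohomology

open scoped Classical in
/-- The group `E(k̄)` for `E` given by a Weierstrass equation over `F` and a field `k ⊇ F`. -/
abbrev geomPoints {F : Type*} [Field F] (E : WeierstrassCurve F) (k : Type*) [Field k]
    [Algebra F k] : Type _ :=
  (E.baseChange (AlgebraicClosure k)).toAffine.Point

open scoped Classical in
noncomputable instance geomPoints.instAddCommGroup {F : Type*} [Field F] (E : WeierstrassCurve F)
    (k : Type*) [Field k] [Algebra F k] : AddCommGroup (geomPoints E k) :=
  inferInstance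

open scoped Classical in
/-- `Gal(k̄/k)` acts on `E(k̄)` through the coordinates. -/
noncomputable instance geomPoints.instDistribMulAction {F : Type*} [Field F]
    (E : WeierstrassCurve F) (k : Type*) [Field k] [Algebra F k] :
    DistribMulAction (AlgebraicClosure k ≃ₐ[k] AlgebraicClosure k) (geomPoints E k) where
  smul σ P := WeierstrassCurve.Affine.Point.map (W' := E) (S := k) σ.toAlgHom P
  one_smul P := by cases P <;> rfl
  mul_smul σ τ P := by cases P <;> rfl
  smul_zero σ := map_zero (WeierstrassCurve.Affine.Point.map (W' := E) (S := k) σ.toAlgHom)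
  smul_add σ := map_add (WeierstrassCurve.Affine.Point.map (W' := E) (S := k) σ.toAlgHom)

/-- The Galois cohomology group `H¹(k, E) = H¹(Gal(k̄/k), E(k̄))`. -/
abbrev galH1 {F : Type*} [Field F] (E : WeierstrassCurve F) (k : Type*) [Field k]
    [Algebra F k] : Type _ :=
  contH1 (AlgebraicClosure k ≃ₐ[k] AlgebraicClosure k) (geomPoints E k)

open scoped Classical in
/-- The restriction map `H¹(k, E) → H¹(k', E)` for `F ⊆ k ⊆ k'`, computed with the embedding
`j : k̄ → k̄'` over `k`. -/
noncomputable def galH1Res {F : Type*} [Field F] (E : WeierstrassCurve F)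
    {k k' : Type*} [Field k] [Field k'] [Algebra F k] [Algebra F k'] [Algebra k k']
    [IsScalarTower F k k'] (j : AlgebraicClosure k →ₐ[k] AlgebraicClosure k') :
    galH1 E k →+ galH1 E k' :=
  haveI : IsScalarTower F k (AlgebraicClosure k') :=
    IsScalarTower.of_algebraMap_eq fun x => by
      rw [IsScalarTower.algebraMap_apply F k' (AlgebraicClosure k'),
        IsScalarTower.algebraMap_apply F k k', ← IsScalarTower.algebraMap_apply k k']
  contH1Map (absGalRestrict j) (continuous_absGalRestrict j)
    (WeierstrassCurve.Affine.Point.map (W' := E) (S := k) j) (by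
      rintro σ (_ | ⟨x, y, h⟩)
      · rfl
      · change WeierstrassCurve.Affine.Point.some (W' := (E.baseChange (AlgebraicClosure k')).toAffine)
          _ _ _ = WeierstrassCurve.Affine.Point.some _ _ _
        exact (WeierstrassCurve.Affine.Point.some.injEq ..).mpr
          ⟨absGalRestrict_commutes j σ x, absGalRestrict_commutes j σ y⟩)

end EllipticCurveCohomology

/-! ### Primes above `v` and local fields -/

section Local

variable {K : Type*} [Field K] [NumberField K]

/-- The primes `w` of `L` lying above the prime `v` of `K` (a finite set). -/
abbrev PrimesAbove (v : HeightOneSpectrum (𝓞 K)) (L : Type*) [Field L] [NumberField L]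
    [Algebra K L] : Type _ :=
  {w : HeightOneSpectrum (𝓞 L) // w.asIdeal.LiesOver v.asIdeal}

variable {L : Type*} [Field L] [NumberField L] [Algebra K L] {v : HeightOneSpectrum (𝓞 K)}

/-- The map `K_v → L_w` obtained from `K → L` by continuous extension to the completions. -/
noncomputable def completionMap (w : PrimesAbove v L) :
    v.adicCompletion K →+* w.1.adicCompletion L :=
  haveI := w.2
  ((HeightOneSpectrum.adicCompletion.equiv L w.1).symm.toRingHom.comp
    (UniformSpace.Completion.mapRingHom
      (algebraMap (WithVal (v.valuation K)) (WithVal (w.1.valuation L)))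
      (HeightOneSpectrum.uniformContinuous_algebraMap_liesOver K L v w.1).continuous)).comp
    (HeightOneSpectrum.adicCompletion.equiv K v).toRingHom

noncomputable instance completionAlgebra (w : PrimesAbove v L) :
    Algebra (v.adicCompletion K) (w.1.adicCompletion L) :=
  (completionMap w).toAlgebra

instance completionScalarTower (w : PrimesAbove v L) :
    IsScalarTower K (v.adicCompletion K) (w.1.adicCompletion L) := by
  refine IsScalarTower.of_algebraMap_eq fun x => ?_
  have := w.2
  apply HeightOneSpectrum.adicCompletion.ext
  exact (UniformSpace.Completion.mapRingHom_coe
    (HeightOneSpectrum.uniformContinuous_algebraMap_liesOver K L v w.1).continuous _).symm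

/-- The residue field `k_v` of `K` at `v`. -/
abbrev residueFieldAt (v : HeightOneSpectrum (𝓞 K)) : Type _ :=
  IsLocalRing.ResidueField (v.adicCompletionIntegers K)

/-- A minimal Weierstrass equation of `E` over `K_v`. -/
noncomputable abbrev minimalAt (E : WeierstrassCurve K) (v : HeightOneSpectrum (𝓞 K)) :
    WeierstrassCurve (v.adicCompletion K) :=
  (E.baseChange (v.adicCompletion K)).minimal (v.adicCompletionIntegers K)

/-- `E` has good reduction at `v`: its minimal equation over `K_v` has unit discriminant. -/
def HasGoodReductionAt (E : WeierstrassCurve K) (v : HeightOneSpectrum (𝓞 K)) : Prop :=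
  (minimalAt E v).HasGoodReduction (v.adicCompletionIntegers K)

/-- The reduction `Ẽ` of `E` at `v`, a curve over `k_v`. -/
noncomputable abbrev reductionAt (E : WeierstrassCurve K) (v : HeightOneSpectrum (𝓞 K)) :
    WeierstrassCurve (residueFieldAt v) :=
  (minimalAt E v).reduction (v.adicCompletionIntegers K)

open scoped Classical in
/-- The group `Ẽ(k_v)[p]`. -/
noncomputable abbrev reductionTorsion (E : WeierstrassCurve K) (v : HeightOneSpectrum (𝓞 K))
    (p : ℕ) : AddSubgroup (reductionAt E v).toAffine.Point :=
  AddSubgroup.torsionBy (reductionAt E v).toAffine.Point (p : ℤ)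

/-- `A[p]` as a vector space over `ℤ/p`. -/
noncomputable instance torsionZModModule (A : Type*) [AddCommGroup A] (p : ℕ) :
    Module (ZMod p) (AddSubgroup.torsionBy A (p : ℤ)) :=
  AddSubgroup.torsionBy.zmodModule

/-- The homomorphism `A[p] → B[p]` induced by `f : A → B`, as a `ℤ/p`-linear map. -/
noncomputable def torsionMap {A B : Type*} [AddCommGroup A] [AddCommGroup B] (f : A →+ B) (p : ℕ) :
    AddSubgroup.torsionBy A (p : ℤ) →ₗ[ZMod p] AddSubgroup.torsionBy B (p : ℤ) :=
  AddMonoidHom.toZModLinearMap p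
    ((f.comp (AddSubgroup.torsionBy A (p : ℤ)).subtype).codRestrict
      (AddSubgroup.torsionBy B (p : ℤ)) fun x => by
        have hx := AddSubgroup.torsionBy.nsmul_iff.1 x.2
        refine AddSubgroup.torsionBy.nsmul_iff.2 ?_
        change p • f x.1 = 0
        rw [← map_nsmul, hx, map_zero])

/-- A choice, for every prime `w` of `L` above `v`, of an embedding over `K_v` of the algebraic
closure of `K_v` into that of `L_w`. -/
abbrev ClosureEmbeddings (v : HeightOneSpectrum (𝓞 K)) (L : Type*) [Field L] [NumberField L]
    [Algebra K L] : Type _ :=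
  (w : PrimesAbove v L) →
    AlgebraicClosure (v.adicCompletion K) →ₐ[v.adicCompletion K]
      AlgebraicClosure (w.1.adicCompletion L)

/-- The restriction map `γ_v : H¹(K_v, E)[p] → ⨁_{w ∣ v} H¹(L_w, E)[p]`. As only finitely many `w`
lie above `v`, the direct sum is the product. -/
noncomputable def gammaMap (E : WeierstrassCurve K) (j : ClosureEmbeddings v L) (p : ℕ) :
    AddSubgroup.torsionBy (galH1 E (v.adicCompletion K)) (p : ℤ) →ₗ[ZMod p]
      ((w : PrimesAbove v L) →
        AddSubgroup.torsionBy (galH1 E (w.1.adicCompletion L)) (p : ℤ)) :=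
  LinearMap.pi fun w => torsionMap (A := galH1 E (v.adicCompletion K))
    (B := galH1 E (w.1.adicCompletion L)) (galH1Res E (j w)) p

/-- `v` is totally ramified in `L`: some prime of `L` above `v` has ramification index `[L : K]`. -/
def IsTotallyRamifiedIn (v : HeightOneSpectrum (𝓞 K)) (L : Type*) [Field L] [NumberField L]
    [Algebra K L] : Prop :=
  ∃ w : PrimesAbove v L, w.1.asIdeal.ramificationIdx (𝓞 K) = Module.finrank K L

/-- `v` is unramified and inert in `L`: the ideal `v 𝓞_L` is prime. -/
def IsInertIn (v : HeightOneSpectrum (𝓞 K)) (L : Type*) [Field L] [NumberField L]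
    [Algebra K L] : Prop :=
  (v.asIdeal.map (algebraMap (𝓞 K) (𝓞 L))).IsPrime

/-- `v` is ramified in `L`: some prime of `L` above `v` has ramification index different from 1. -/
def IsRamifiedIn (v : HeightOneSpectrum (𝓞 K)) (L : Type*) [Field L] [NumberField L]
    [Algebra K L] : Prop :=
  ∃ w : PrimesAbove v L, w.1.asIdeal.ramificationIdx (𝓞 K) ≠ 1

end Local

end SelmerLocal

open SelmerLocal

/-!
Let `w` be a prime of `L` above `v` and `G = Gal(L_w/K_v)`, a cyclic group whose order is a power
of `p`, hence prime to the residue characteristic. A class in `H¹(K_v, E)` that dies in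
`H¹(L_w, E)` is inflated from a crossed homomorphism `d : G → E(L_w)`; the relation between such
classes and crossed homomorphisms is `inflationGraph`. Since `G` is generated by one element `σ`,
`d` is determined by `d σ`, an element of trace zero, and `d` is a coboundary if and only if
`d σ = σ P - P` for some `P`. It is enough to work with one `w`, because an element of the kernel of
`γ_v` dies over all of them.

Good reduction provides a Weierstrass model with unit discriminant over the integers of `K_v`,
isomorphic to `E` by a change of variables (`variableChangeEquiv`). Points of this model over `L_w`
reduce to points over the residue field `k_w`, by a surjective homomorphism
(`reductionHom`, `reductionHom_surjective`). On its kernel `z = -x / y` is a coordinate for which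
addition is approximately additive: `z(P + Q) - z(P) = z(Q) * (1 + ε)` with `ε` in the maximal ideal
(`OnChart.add`). So multiplication by an integer prime to the residue characteristic is bijective on
the kernel, by Newton iteration (`exists_nsmul_eq_of_mem_kernel`), and the cohomology of `G` in the
kernel vanishes. Consequently only the reduction of `d σ` matters
(`exists_coboundary_of_reductionHom`).

* If `v` is totally ramified then `k_w = k_v`, so `G` acts trivially on the reduced points and the
  reduction of a coboundary is zero. The map sending a class to the reduction of `d σ` is therefore
  well defined on the kernel of `γ_v`, and it is injective (`exists_injective_of_totallyRamified`).
* If `v` is inert then `σ` can be taken to be the Frobenius element, and a point over `k_w` of trace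
  zero has the form `φ Q - Q`. This follows from Lang's theorem that `φ - 1` is surjective on the
  points over an algebraic closure (`frobenius_sub_one_surjective`), proved here by counting the
  roots of an explicit numerator of the abscissa of `φ(P) - P`.
* If there is no `p`-torsion over `k_v` then there is none over `k_w`, as Frobenius acts on it with
  `p`-power order and a single fixed point (`eq_zero_of_nsmul_eq_zero_residueField`). The group
  `E(L_w)` is then uniquely divisible by the order of `G`, and every crossed homomorphism is a
  coboundary (`exists_coboundary_of_torsion_eq_zero`).
-/

namespace SelmerLocal

/-! ### The formal group chart at the origin of a Weierstrass curve -/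

section Chart

open IsLocalRing

variable {A : Type*} [CommRing A] (W : WeierstrassCurve A)

/-- The Weierstrass equation near the origin, in the coordinates `z = -x / y` and `h = 1 / x`. -/
def ChartEq (z h : A) : Prop :=
  h = z ^ 2 + W.a₁ * z * h + W.a₂ * z ^ 2 * h + W.a₃ * z * h ^ 2 + W.a₄ * z ^ 2 * h ^ 2 +
    W.a₆ * z ^ 2 * h ^ 3

variable {W}

/-- On the chart at the origin the coordinate `h` is a function of `z` with divided differences in
the maximal ideal. The second formula characterises the divided difference `κ` also when
`z₁ = z₂`. -/
theorem ChartEq.exists_dividedDifference [IsLocalRing A] {z₁ h₁ z₂ h₂ : A}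
    (e₁ : ChartEq W z₁ h₁) (e₂ : ChartEq W z₂ h₂) (hz₁ : z₁ ∈ maximalIdeal A)
    (hh₁ : h₁ ∈ maximalIdeal A) (hz₂ : z₂ ∈ maximalIdeal A) :
    ∃ κ ∈ maximalIdeal A, h₁ - h₂ = κ * (z₁ - z₂) ∧
      κ * (1 - (W.a₁ * z₂ + W.a₂ * z₂ ^ 2 + W.a₃ * z₂ * (h₁ + h₂) + W.a₄ * z₂ ^ 2 * (h₁ + h₂) +
        W.a₆ * z₂ ^ 2 * (h₁ ^ 2 + h₁ * h₂ + h₂ ^ 2))) =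
      (z₁ + z₂) + W.a₁ * h₁ + W.a₂ * (z₁ + z₂) * h₁ + W.a₃ * h₁ ^ 2 + W.a₄ * (z₁ + z₂) * h₁ ^ 2 +
        W.a₆ * (z₁ + z₂) * h₁ ^ 3 := by
  set β := W.a₁ * z₂ + W.a₂ * z₂ ^ 2 + W.a₃ * z₂ * (h₁ + h₂) + W.a₄ * z₂ ^ 2 * (h₁ + h₂) +
        W.a₆ * z₂ ^ 2 * (h₁ ^ 2 + h₁ * h₂ + h₂ ^ 2) with hβ
  set α := (z₁ + z₂) + W.a₁ * h₁ + W.a₂ * (z₁ + z₂) * h₁ + W.a₃ * h₁ ^ 2 +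
    W.a₄ * (z₁ + z₂) * h₁ ^ 2 + W.a₆ * (z₁ + z₂) * h₁ ^ 3 with hα
  have hβm : β ∈ maximalIdeal A := by
    have : β = (W.a₁ + W.a₂ * z₂ + W.a₃ * (h₁ + h₂) + W.a₄ * z₂ * (h₁ + h₂) +
        W.a₆ * z₂ * (h₁ ^ 2 + h₁ * h₂ + h₂ ^ 2)) * z₂ := by rw [hβ]; ring
    rw [this]; exact Ideal.mul_mem_left _ _ hz₂
  have hαm : α ∈ maximalIdeal A := by
    have : α = (1 + W.a₂ * h₁ + W.a₄ * h₁ ^ 2 + W.a₆ * h₁ ^ 3) * (z₁ + z₂) +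
      (W.a₁ + W.a₃ * h₁) * h₁ := by rw [hα]; ring
    rw [this]
    exact Ideal.add_mem _ (Ideal.mul_mem_left _ _ (Ideal.add_mem _ hz₁ hz₂))
      (Ideal.mul_mem_left _ _ hh₁)
  obtain ⟨u, hu⟩ : IsUnit (1 - β) := by
    by_contra hn
    exact (Ideal.ne_top_iff_one _).1 (maximalIdeal.isMaximal A).ne_top
      (by simpa using Ideal.add_mem _ ((mem_maximalIdeal _).2 hn) hβm)
  refine ⟨α * ↑u⁻¹, Ideal.mul_mem_right _ _ hαm, ?_, ?_⟩
  · have key : (h₁ - h₂) * (1 - β) = α * (z₁ - z₂) := by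
      unfold ChartEq at e₁ e₂
      rw [hα, hβ]
      linear_combination e₁ - e₂
    rw [← hu] at key
    calc h₁ - h₂ = (h₁ - h₂) * u * ↑u⁻¹ := by rw [mul_assoc, u.mul_inv, mul_one]
      _ = _ := by rw [key]; ring
  · rw [← hu, mul_assoc, u.inv_mul, mul_one]

/-- The congruence behind the translation formula in the formal group. Let `w = l * z + m` be the
line through two points of the chart and `t = Z / c` the `z`-coordinate of its third intersection
with the curve. The negative of this third point has `z`-coordinate
`-t / (1 - a₁ * t - a₃ * (l * t + m))`, and the congruence says that it equals `z₁ + z₂` up to an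
element of `z₂ * 𝔪`. -/
theorem ChartEq.translation_mem [IsLocalRing A] {z₁ h₁ z₂ κ : A}
    (e₁ : ChartEq W z₁ h₁) (hz₁ : z₁ ∈ maximalIdeal A) (hκ : κ ∈ maximalIdeal A) {l m n c Z : A}
    (hl : l = h₁ + z₂ * κ) (hm : m = -(z₁ * z₂ * κ))
    (hn : n = W.a₁ * l + W.a₂ * m + W.a₃ * l ^ 2 + 2 * W.a₄ * l * m + 3 * W.a₆ * l ^ 2 * m)
    (hc : c = 1 + W.a₂ * l + W.a₄ * l ^ 2 + W.a₆ * l ^ 3)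
    (hZ : Z = -c * (z₁ + z₂) - n) :
    n + z₁ * (W.a₁ * Z + W.a₃ * (l * Z + c * m)) ∈ Ideal.span {z₂} * maximalIdeal A := by
  set I := Ideal.span {z₂} * maximalIdeal A
  -- Modulo `I` the line has slope `h₁` and passes through the origin.
  have h1 : z₂ * κ ∈ I := Ideal.mul_mem_mul (Ideal.mem_span_singleton_self _) hκ
  have h2 : z₂ * z₁ ∈ I := Ideal.mul_mem_mul (Ideal.mem_span_singleton_self _) hz₁
  rw [← Ideal.Quotient.eq_zero_iff_mem] at h1 h2 ⊢
  have e := congrArg (Ideal.Quotient.mk I) e₁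
  have hl' : Ideal.Quotient.mk I l = Ideal.Quotient.mk I h₁ := by rw [hl, map_add, h1, add_zero]
  have hm' : Ideal.Quotient.mk I m = 0 := by
    rw [hm, mul_assoc, map_neg, map_mul, h1, mul_zero, neg_zero]
  subst hZ hn hc
  simp only [map_mul, map_add, map_sub, map_neg, map_pow, map_one, map_ofNat] at *
  rw [hl', hm']
  linear_combination (Ideal.Quotient.mk I W.a₁ + Ideal.Quotient.mk I W.a₃ * Ideal.Quotient.mk I h₁)
    * e - (1 + Ideal.Quotient.mk I W.a₂ * Ideal.Quotient.mk I h₁ + Ideal.Quotient.mk I W.a₄ *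
      Ideal.Quotient.mk I h₁ ^ 2 + Ideal.Quotient.mk I W.a₆ * Ideal.Quotient.mk I h₁ ^ 3) *
      (Ideal.Quotient.mk I W.a₁ + Ideal.Quotient.mk I W.a₃ * Ideal.Quotient.mk I h₁) * h2

end Chart

/-! ### Chords and tangents near the origin -/

section ChartAddition

open WeierstrassCurve WeierstrassCurve.Affine

variable {F : Type*} [Field F] [DecidableEq F] {W : WeierstrassCurve F}

/-- The elementary symmetric functions of the three `x`-coordinates on a chord or tangent. -/
theorem addX_symmetric {x₁ x₂ y₁ y₂ : F} (h₁ : W.toAffine.Equation x₁ y₁)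
    (h₂ : W.toAffine.Equation x₂ y₂) (hxy : ¬(x₁ = x₂ ∧ y₁ = W.toAffine.negY x₂ y₂)) {ℓ x₃ : F}
    (hℓ : ℓ = W.toAffine.slope x₁ x₂ y₁ y₂) (hx₃ : x₃ = W.toAffine.addX x₁ x₂ ℓ) :
    x₁ + x₂ + x₃ = ℓ ^ 2 + W.a₁ * ℓ - W.a₂ ∧
    x₁ * x₂ + x₁ * x₃ + x₂ * x₃ =
      W.a₄ - 2 * ℓ * (y₁ - ℓ * x₁) - W.a₁ * (y₁ - ℓ * x₁) - W.a₃ * ℓ ∧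
    x₁ * x₂ * x₃ = (y₁ - ℓ * x₁) ^ 2 + W.a₃ * (y₁ - ℓ * x₁) - W.a₆ := by
  have key := addPolynomial_slope h₁ h₂ hxy
  rw [← hℓ, ← hx₃, addPolynomial_eq, neg_inj, Cubic.prod_X_sub_C_eq,
    Cubic.toPoly_injective] at key
  have hb := congrArg Cubic.b key
  have hc := congrArg Cubic.c key
  have hd := congrArg Cubic.d key
  simp only at hb hc hd
  exact ⟨by linear_combination hb, by linear_combination -hc, by linear_combination hd⟩

omit [DecidableEq F] in
/-- Points of the chart away from the origin have affine coordinates `(1 / h, -1 / (z * h))`. -/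
theorem ChartEq.equation {z h : F} (e : ChartEq W z h) (hz : z ≠ 0) (hh : h ≠ 0) :
    W.toAffine.Equation (1 / h) (-1 / (z * h)) := by
  rw [equation_iff]
  unfold ChartEq at e
  field_simp
  linear_combination e

/-- The slope of the affine line through two points of the chart, multiplied by the intercept
`-(z₁ * z₂ * κ)` of the same line in the coordinates `z` and `w = -1 / y`. -/
theorem slope_chart {z₁ h₁ z₂ h₂ κ : F} (e₁ : ChartEq W z₁ h₁) (e₂ : ChartEq W z₂ h₂)
    (hz₁ : z₁ ≠ 0) (hh₁ : h₁ ≠ 0) (hz₂ : z₂ ≠ 0) (hh₂ : h₂ ≠ 0) (hκ : h₁ - h₂ = κ * (z₁ - z₂))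
    (hκ' : κ * (1 - (W.a₁ * z₂ + W.a₂ * z₂ ^ 2 + W.a₃ * z₂ * (h₁ + h₂) +
        W.a₄ * z₂ ^ 2 * (h₁ + h₂) + W.a₆ * z₂ ^ 2 * (h₁ ^ 2 + h₁ * h₂ + h₂ ^ 2))) =
      (z₁ + z₂) + W.a₁ * h₁ + W.a₂ * (z₁ + z₂) * h₁ + W.a₃ * h₁ ^ 2 + W.a₄ * (z₁ + z₂) * h₁ ^ 2 +
        W.a₆ * (z₁ + z₂) * h₁ ^ 3)
    (hxy : ¬(1 / h₁ = 1 / h₂ ∧ -1 / (z₁ * h₁) = W.toAffine.negY (1 / h₂) (-1 / (z₂ * h₂)))) :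
    W.toAffine.slope (1 / h₁) (1 / h₂) (-1 / (z₁ * h₁)) (-1 / (z₂ * h₂)) * -(z₁ * z₂ * κ) =
      h₁ + z₂ * κ := by
  by_cases hx : 1 / h₁ = 1 / h₂
  · have hy : -1 / (z₁ * h₁) ≠ W.toAffine.negY (1 / h₂) (-1 / (z₂ * h₂)) := fun h => hxy ⟨hx, h⟩
    have hyy := Y_eq_of_Y_ne (e₁.equation hz₁ hh₁) (e₂.equation hz₂ hh₂) hx hy
    have hhh : h₁ = h₂ := by simpa using hx
    subst hhh
    have hzz : z₁ = z₂ := by field_simp at hyy; exact (neg_injective hyy).symm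
    subst hzz
    rw [slope_of_Y_ne rfl hy]
    have hden : -1 / (z₁ * h₁) - W.toAffine.negY (1 / h₁) (-1 / (z₁ * h₁)) ≠ 0 := sub_ne_zero.2 hy
    rw [div_mul_eq_mul_div, div_eq_iff hden, negY]
    unfold ChartEq at e₁
    field_simp
    linear_combination (3 * κ * z₁ + 2 * h₁) * e₁ - z₁ * h₁ * hκ'
  · have hℓ := slope_of_X_ne (W := W.toAffine) (y₁ := -1 / (z₁ * h₁)) (y₂ := -1 / (z₂ * h₂)) hx
    rw [eq_div_iff (sub_ne_zero.2 hx)] at hℓ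
    set ℓ := W.toAffine.slope (1 / h₁) (1 / h₂) (-1 / (z₁ * h₁)) (-1 / (z₂ * h₂))
    have hzz : z₁ - z₂ ≠ 0 := by
      intro h0
      rw [h0, mul_zero, sub_eq_zero] at hκ
      exact hx (by rw [hκ])
    apply mul_left_cancel₀ hzz
    field_simp at hℓ
    linear_combination hℓ + (z₁ * z₂ * ℓ + z₂) * hκ

end ChartAddition

section ThirdPoint

variable {F : Type*} [Field F] {W : WeierstrassCurve F}

/-- Vieta's formulas for the line `w = l * z + m` in the coordinates `z = -x / y`, `w = -1 / y`,
deduced from those for the same line `y = ℓ * x + ν` in affine coordinates. -/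
theorem line_vieta {x₁ x₂ x₃ l m ℓ ν : F} (hℓ : ℓ * m = l) (hν : ν * m = -1)
    (e₁ : x₁ + x₂ + x₃ = ℓ ^ 2 + W.a₁ * ℓ - W.a₂)
    (e₂ : x₁ * x₂ + x₁ * x₃ + x₂ * x₃ = W.a₄ - 2 * ℓ * ν - W.a₁ * ν - W.a₃ * ℓ)
    (e₃ : x₁ * x₂ * x₃ = ν ^ 2 + W.a₃ * ν - W.a₆) :
    (l * x₁ - 1) * (l * x₂ - 1) * (l * x₃ - 1) =
      -(1 + W.a₂ * l + W.a₄ * l ^ 2 + W.a₆ * l ^ 3) ∧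
    m * (x₁ * (l * x₂ - 1) * (l * x₃ - 1) + x₂ * (l * x₁ - 1) * (l * x₃ - 1) +
        x₃ * (l * x₁ - 1) * (l * x₂ - 1)) =
      -(W.a₁ * l + W.a₂ * m + W.a₃ * l ^ 2 + 2 * W.a₄ * l * m + 3 * W.a₆ * l ^ 2 * m) := by
  have hm : m ≠ 0 := by rintro rfl; simp at hν
  obtain rfl : ℓ = l / m := by rw [eq_div_iff hm, hℓ]
  obtain rfl : ν = -1 / m := by rw [eq_div_iff hm, hν]
  constructor
  · have : (l * x₁ - 1) * (l * x₂ - 1) * (l * x₃ - 1) = l ^ 3 * (x₁ * x₂ * x₃) -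
      l ^ 2 * (x₁ * x₂ + x₁ * x₃ + x₂ * x₃) + l * (x₁ + x₂ + x₃) - 1 := by ring
    rw [this, e₁, e₂, e₃]
    field_simp
    ring
  · have : x₁ * (l * x₂ - 1) * (l * x₃ - 1) + x₂ * (l * x₁ - 1) * (l * x₃ - 1) +
        x₃ * (l * x₁ - 1) * (l * x₂ - 1) = 3 * l ^ 2 * (x₁ * x₂ * x₃) -
      2 * l * (x₁ * x₂ + x₁ * x₃ + x₂ * x₃) + (x₁ + x₂ + x₃) := by ring
    rw [this, e₁, e₂, e₃]
    field_simp
    ring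

end ThirdPoint

/-! ### Integral points and the kernel of reduction -/

section Kernel

open IsLocalRing WeierstrassCurve WeierstrassCurve.Affine

variable {R F : Type*} [CommRing R] [Field F] (A : ValuationSubring F)
  [Algebra R A] [Algebra R F] [IsScalarTower R A F] (W : WeierstrassCurve R)

theorem exists_mem_maximalIdeal_inv {x : F} (hx : x ∉ A) :
    ∃ h ∈ maximalIdeal A, (h : F) = x⁻¹ ∧ h ≠ 0 := by
  have hx0 : x ≠ 0 := by rintro rfl; exact hx A.zero_mem
  have h1 : x⁻¹ ∈ A := (A.mem_or_inv_mem x).resolve_left hx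
  refine ⟨⟨x⁻¹, h1⟩, ?_, rfl, fun h => hx0 (by simpa using congrArg Subtype.val h)⟩
  rw [mem_maximalIdeal, mem_nonunits_iff]
  rintro ⟨u, hu⟩
  apply hx
  have h2 : ((u⁻¹ : Aˣ) : A) * (u : A) = 1 := u.inv_mul
  have h3 : ((u⁻¹ : Aˣ) : A).1 * x⁻¹ = 1 := by
    have := congrArg Subtype.val h2
    rw [hu] at this
    exact this
  have h4 : x = ((u⁻¹ : Aˣ) : A).1 := by field_simp at h3; exact h3.symm
  rw [h4]; exact ((u⁻¹ : Aˣ) : A).2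

theorem inv_notMem {h : A} (hh : h ∈ maximalIdeal A) (h0 : h ≠ 0) : (h : F)⁻¹ ∉ A := by
  intro hx
  rw [mem_maximalIdeal, mem_nonunits_iff] at hh
  apply hh
  refine IsUnit.of_mul_eq_one ⟨_, hx⟩ (Subtype.ext ?_)
  exact mul_inv_cancel₀ fun h => h0 (Subtype.ext h)

theorem isUnit_one_sub {b : A} (hb : b ∈ maximalIdeal A) : IsUnit (1 - b) := by
  by_contra hn
  exact (Ideal.ne_top_iff_one _).1 (maximalIdeal.isMaximal A).ne_top
    (by simpa using Ideal.add_mem _ ((mem_maximalIdeal _).2 hn) hb)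

@[simp] theorem baseChange_a₁_coe : (W⁄F).a₁ = ((W⁄A).a₁ : F) :=
  IsScalarTower.algebraMap_apply R A F _
@[simp] theorem baseChange_a₂_coe : (W⁄F).a₂ = ((W⁄A).a₂ : F) :=
  IsScalarTower.algebraMap_apply R A F _
@[simp] theorem baseChange_a₃_coe : (W⁄F).a₃ = ((W⁄A).a₃ : F) :=
  IsScalarTower.algebraMap_apply R A F _
@[simp] theorem baseChange_a₄_coe : (W⁄F).a₄ = ((W⁄A).a₄ : F) :=
  IsScalarTower.algebraMap_apply R A F _
@[simp] theorem baseChange_a₆_coe : (W⁄F).a₆ = ((W⁄A).a₆ : F) :=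
  IsScalarTower.algebraMap_apply R A F _

variable {W}

theorem chartEq_coe {z h : A} : ChartEq (W⁄F) (z : F) h ↔ ChartEq (W⁄A) z h := by
  unfold ChartEq
  rw [baseChange_a₁_coe A W, baseChange_a₂_coe A W, baseChange_a₃_coe A W, baseChange_a₄_coe A W,
    baseChange_a₆_coe A W]
  exact_mod_cast Iff.rfl

theorem y_mem_of_x_mem {x y : F} (e : (W⁄F).toAffine.Equation x y) (hx : x ∈ A) : y ∈ A := by
  by_contra hy
  obtain ⟨s, hs, hsy, hs0⟩ := exists_mem_maximalIdeal_inv A hy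
  apply hy
  rw [equation_iff, baseChange_a₁_coe A W, baseChange_a₂_coe A W, baseChange_a₃_coe A W,
    baseChange_a₄_coe A W, baseChange_a₆_coe A W] at e
  have hy0 : y ≠ 0 := by rintro rfl; exact hy A.zero_mem
  lift x to A using hx
  have : y = ((((x ^ 3 + (W⁄A).a₂ * x ^ 2 + (W⁄A).a₄ * x + (W⁄A).a₆) * s -
    (W⁄A).a₁ * x - (W⁄A).a₃ : A)) : F) := by
    push_cast
    rw [hsy]
    field_simp
    linear_combination e
  rw [this]
  exact Subtype.mem _

/-- A point whose `x`-coordinate is not integral lies on the chart at the origin. -/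
theorem exists_chart {x y : F} (e : (W⁄F).toAffine.Equation x y) (hx : x ∉ A) :
    ∃ z ∈ maximalIdeal A, ∃ h ∈ maximalIdeal A, ChartEq (W⁄A) z h ∧ z ≠ 0 ∧ h ≠ 0 ∧
      x = 1 / (h : F) ∧ y = -1 / ((z : F) * h) := by
  obtain ⟨h, hh, hhx, hh0⟩ := exists_mem_maximalIdeal_inv A hx
  have hx0 : x ≠ 0 := by rintro rfl; exact hx A.zero_mem
  rw [equation_iff] at e
  have e' := e
  rw [baseChange_a₁_coe A W, baseChange_a₂_coe A W, baseChange_a₃_coe A W,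
    baseChange_a₄_coe A W, baseChange_a₆_coe A W] at e'
  have hs : y / x ∉ A := by
    intro hs
    apply hx
    have : x = (((⟨y / x, hs⟩ : A) ^ 2 + (W⁄A).a₁ * ⟨y / x, hs⟩ + (W⁄A).a₃ * h * ⟨y / x, hs⟩ -
      (W⁄A).a₂ - (W⁄A).a₄ * h - (W⁄A).a₆ * h ^ 2 : A) : F) := by
      push_cast
      rw [hhx]
      field_simp
      linear_combination -e'
    rw [this]
    exact Subtype.mem _
  obtain ⟨z, hz, hzs, hz0⟩ := exists_mem_maximalIdeal_inv A hs
  have hy0 : y ≠ 0 := by rintro rfl; simp at hs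
  have hx1 : x = 1 / (h : F) := by rw [hhx]; simp
  have hz1 : (z : F) = x / y := by rw [hzs]; simp
  have hzF : (z : F) ≠ 0 := by simpa using hz0
  have hhF : (h : F) ≠ 0 := by simpa using hh0
  have hy1 : y = 1 / ((z : F) * h) := by rw [hz1, hhx]; field_simp
  refine ⟨-z, neg_mem hz, h, hh, ?_, neg_ne_zero.2 hz0, hh0, hx1, ?_⟩
  · rw [← chartEq_coe A]
    rw [hx1, hy1] at e
    unfold ChartEq
    push_cast
    field_simp at e
    linear_combination e
  · rw [hy1]; push_cast; field_simp

variable (W) in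
/-- `OnChart A W P z h` says that the point `P` of `W` reduces to the origin and has coordinates
`z = -x / y` and `h = 1 / x`, both read as `0` at the origin. -/
def OnChart (P : (W⁄F).toAffine.Point) (z h : A) : Prop :=
  z ∈ maximalIdeal A ∧ h ∈ maximalIdeal A ∧ ChartEq (W⁄A) z h ∧
    ((P = 0 ∧ z = 0 ∧ h = 0) ∨ (z ≠ 0 ∧ h ≠ 0 ∧
      ∃ hP : (W⁄F).toAffine.Nonsingular (1 / (h : F)) (-1 / ((z : F) * h)), P = .some _ _ hP))

end Kernel

/-! ### Addition on the kernel of reduction -/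

section KernelAddition

open IsLocalRing WeierstrassCurve WeierstrassCurve.Affine

variable {R F : Type*} [CommRing R] [Field F] [DecidableEq F] {A : ValuationSubring F}
  [Algebra R A] [Algebra R F] [IsScalarTower R A F] {W : WeierstrassCurve R}

omit [DecidableEq F] [IsScalarTower R A F] in
theorem OnChart.zero : OnChart A W 0 0 0 :=
  ⟨zero_mem _, zero_mem _, by simp [ChartEq], .inl ⟨rfl, rfl, rfl⟩⟩

/-- The translation formula on the kernel of reduction: adding `Q` to `P` changes the coordinate
`z` of `P` by the coordinate `z` of `Q`, up to a unit congruent to `1`. -/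
theorem OnChart.add {P Q : (W⁄F).toAffine.Point} {z₁ h₁ z₂ h₂ : A} (hP : OnChart A W P z₁ h₁)
    (hQ : OnChart A W Q z₂ h₂) :
    ∃ z h, OnChart A W (P + Q) z h ∧ ∃ ε ∈ maximalIdeal A, z - z₁ = z₂ * (1 + ε) := by
  obtain ⟨hz₁, hh₁, e₁, ⟨rfl, rfl, rfl⟩ | ⟨z₁0, h₁0, ns₁, rfl⟩⟩ := id hP
  · exact ⟨z₂, h₂, by rwa [zero_add], 0, zero_mem _, by ring⟩
  obtain ⟨hz₂, hh₂, e₂, ⟨rfl, rfl, rfl⟩ | ⟨z₂0, h₂0, ns₂, rfl⟩⟩ := id hQ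
  · exact ⟨z₁, h₁, by rwa [add_zero], 0, zero_mem _, by ring⟩
  obtain ⟨κ, hκm, hκ, hκ'⟩ := e₁.exists_dividedDifference e₂ hz₁ hh₁ hz₂
  have a₁c := baseChange_a₁_coe A W
  have a₂c := baseChange_a₂_coe A W
  have a₃c := baseChange_a₃_coe A W
  have a₄c := baseChange_a₄_coe A W
  have a₆c := baseChange_a₆_coe A W
  have E₁ := (chartEq_coe A).2 e₁
  have E₂ := (chartEq_coe A).2 e₂
  have Z₁0 : (z₁ : F) ≠ 0 := by simpa using z₁0
  have Z₂0 : (z₂ : F) ≠ 0 := by simpa using z₂0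
  have H₁0 : (h₁ : F) ≠ 0 := by simpa using h₁0
  have H₂0 : (h₂ : F) ≠ 0 := by simpa using h₂0
  by_cases hxy : 1 / (h₁ : F) = 1 / (h₂ : F) ∧
      -1 / ((z₁ : F) * h₁) = (W⁄F).toAffine.negY (1 / (h₂ : F)) (-1 / ((z₂ : F) * h₂))
  · obtain ⟨hx, hy⟩ := id hxy
    refine ⟨0, 0, ?_, -(W⁄A).a₁ * z₁ - (W⁄A).a₃ * h₁ * z₁, ?_, ?_⟩
    · rw [Point.add_of_Y_eq hx hy]
      exact OnChart.zero
    · exact Ideal.sub_mem _ (Ideal.mul_mem_left _ _ hz₁) (Ideal.mul_mem_left _ _ hz₁)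
    · have hh : h₁ = h₂ := by
        have : (h₁ : F) = h₂ := by simpa using hx
        exact_mod_cast this
      subst hh
      apply Subtype.val_injective
      rw [negY, a₁c, a₃c] at hy
      push_cast
      field_simp at hy
      linear_combination hy
  -- The chord or tangent through the two points, in both systems of coordinates.
  set l : A := h₁ + z₂ * κ with hl
  set m : A := -(z₁ * z₂ * κ) with hm
  obtain ⟨n, hn⟩ : ∃ n, n = (W⁄A).a₁ * l + (W⁄A).a₂ * m + (W⁄A).a₃ * l ^ 2 +
    2 * (W⁄A).a₄ * l * m + 3 * (W⁄A).a₆ * l ^ 2 * m := ⟨_, rfl⟩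
  obtain ⟨c, hc⟩ : ∃ c, c = 1 + (W⁄A).a₂ * l + (W⁄A).a₄ * l ^ 2 + (W⁄A).a₆ * l ^ 3 := ⟨_, rfl⟩
  obtain ⟨Z, hZ⟩ : ∃ Z, Z = -c * (z₁ + z₂) - n := ⟨_, rfl⟩
  obtain ⟨e, he, hE⟩ := Ideal.mem_span_singleton_mul.1
    (e₁.translation_mem hz₁ hκm hl hm hn hc hZ)
  have hlm : l ∈ maximalIdeal A := add_mem hh₁ (Ideal.mul_mem_left _ _ hκm)
  have hmm : m ∈ maximalIdeal A := neg_mem (Ideal.mul_mem_left _ _ hκm)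
  have hcm : c - 1 ∈ maximalIdeal A := by
    have : c - 1 = ((W⁄A).a₂ + (W⁄A).a₄ * l + (W⁄A).a₆ * l ^ 2) * l := by rw [hc]; ring
    rw [this]; exact Ideal.mul_mem_left _ _ hlm
  obtain ⟨cu, hcu⟩ : IsUnit c := by
    simpa using isUnit_one_sub A (neg_mem hcm)
  have hnm : n ∈ maximalIdeal A := by
    have : n = ((W⁄A).a₁ + (W⁄A).a₃ * l) * l + ((W⁄A).a₂ + 2 * (W⁄A).a₄ * l +
      3 * (W⁄A).a₆ * l ^ 2) * m := by rw [hn]; ring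
    rw [this]; exact add_mem (Ideal.mul_mem_left _ _ hlm) (Ideal.mul_mem_left _ _ hmm)
  have hZm : Z ∈ maximalIdeal A := by
    rw [hZ]; exact sub_mem (Ideal.mul_mem_left _ _ (add_mem hz₁ hz₂)) hnm
  obtain ⟨z₃, hz₃⟩ : ∃ z₃, c * z₃ = Z :=
    ⟨↑cu⁻¹ * Z, by rw [← hcu, ← mul_assoc, cu.mul_inv, one_mul]⟩
  have hz₃m : z₃ ∈ maximalIdeal A := by
    have : z₃ = ↑cu⁻¹ * Z := by rw [← hz₃, ← hcu, ← mul_assoc, cu.inv_mul, one_mul]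
    rw [this]; exact Ideal.mul_mem_left _ _ hZm
  obtain ⟨w₃, hw₃⟩ : ∃ w₃, w₃ = l * z₃ + m := ⟨_, rfl⟩
  have hw₃m : w₃ ∈ maximalIdeal A := by
    rw [hw₃]; exact add_mem (Ideal.mul_mem_left _ _ hz₃m) hmm
  have hb : (W⁄A).a₁ * z₃ + (W⁄A).a₃ * w₃ ∈ maximalIdeal A :=
    add_mem (Ideal.mul_mem_left _ _ hz₃m) (Ideal.mul_mem_left _ _ hw₃m)
  obtain ⟨u, hu⟩ := isUnit_one_sub A hb
  -- The third point of intersection.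
  have hκF : (h₁ : F) - h₂ = κ * (z₁ - z₂) := by exact_mod_cast congrArg Subtype.val hκ
  have hκF' := congrArg Subtype.val hκ'
  push_cast at hκF'
  have hslope := slope_chart E₁ E₂ Z₁0 H₁0 Z₂0 H₂0 hκF
    (by rw [a₁c, a₂c, a₃c, a₄c, a₆c]; exact hκF') hxy
  set x₁ : F := 1 / (h₁ : F) with hx₁
  set x₂ : F := 1 / (h₂ : F) with hx₂
  set y₁ : F := -1 / ((z₁ : F) * h₁) with hy₁
  set y₂ : F := -1 / ((z₂ : F) * h₂) with hy₂
  obtain ⟨ℓ, hℓ⟩ : ∃ ℓ, ℓ = (W⁄F).toAffine.slope x₁ x₂ y₁ y₂ := ⟨_, rfl⟩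
  obtain ⟨x₃, hx₃⟩ : ∃ x₃, x₃ = (W⁄F).toAffine.addX x₁ x₂ ℓ := ⟨_, rfl⟩
  rw [← hℓ] at hslope
  have hmF : (m : F) = -((z₁ : F) * z₂ * κ) := by rw [hm]; push_cast; ring
  have hlF : (l : F) = h₁ + z₂ * κ := by rw [hl]; push_cast; ring
  rw [← hmF, ← hlF] at hslope
  have hν : (y₁ - ℓ * x₁) * (m : F) = -1 := by
    have : (y₁ - ℓ * x₁) * (m : F) = y₁ * m - x₁ * (ℓ * m) := by ring
    rw [this, hslope, hx₁, hy₁, hmF, hlF]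
    field_simp
    ring
  obtain ⟨s₁, s₂, s₃⟩ := addX_symmetric ns₁.1 ns₂.1 hxy hℓ hx₃
  obtain ⟨v₁, v₂⟩ := line_vieta (W := W⁄F) hslope hν s₁ s₂ s₃
  rw [a₁c, a₂c, a₃c, a₄c, a₆c] at v₂
  rw [a₂c, a₄c, a₆c] at v₁
  have hcF : (c : F) = 1 + (W⁄A).a₂ * l + (W⁄A).a₄ * l ^ 2 + (W⁄A).a₆ * l ^ 3 := by
    rw [hc]; push_cast; ring
  have hnF : (n : F) = (W⁄A).a₁ * l + (W⁄A).a₂ * m + (W⁄A).a₃ * l ^ 2 +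
    2 * (W⁄A).a₄ * l * m + 3 * (W⁄A).a₆ * l ^ 2 * m := by
    have := congrArg A.subtype hn
    simp only [map_add, map_mul, map_pow, map_ofNat] at this
    exact this
  rw [← hcF] at v₁
  rw [← hnF] at v₂
  have hc0 : (c : F) ≠ 0 := by
    have : c ≠ 0 := hcu ▸ cu.ne_zero
    simpa using this
  have hm0 : (m : F) ≠ 0 := by intro h0; rw [h0] at hν; simp at hν
  have hD₁ : ((l : F) * x₁ - 1) * (z₁ * h₁) = -m := by
    rw [hx₁, hlF, hmF]; field_simp; ring
  have hD₂ : ((l : F) * x₂ - 1) * (z₂ * h₂) = -m := by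
    rw [hx₂, hlF, hmF]; field_simp; linear_combination hκF
  have hD₁0 : (l : F) * x₁ - 1 ≠ 0 := by
    intro h0; rw [h0, zero_mul] at hD₁; exact hm0 (neg_eq_zero.1 hD₁.symm)
  have hD₂0 : (l : F) * x₂ - 1 ≠ 0 := by
    intro h0; rw [h0, zero_mul] at hD₂; exact hm0 (neg_eq_zero.1 hD₂.symm)
  have hD₃0 : (l : F) * x₃ - 1 ≠ 0 := by
    intro h0; rw [h0, mul_zero] at v₁; exact hc0 (neg_eq_zero.1 v₁.symm)
  have hz₃F : (c : F) * z₃ = -c * (z₁ + z₂) - n := by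
    have := congrArg Subtype.val (hz₃.trans hZ)
    push_cast at this; exact this
  have hw₃F : (w₃ : F) = l * z₃ + m := by rw [hw₃]; push_cast; ring
  have hx₃w : (z₃ : F) * (l * x₃ - 1) = -m * x₃ := by
    have g₁ : ((l : F) * x₁ - 1) * z₁ = -m * x₁ := by
      rw [← hD₁, hx₁]; field_simp
    have g₂ : ((l : F) * x₂ - 1) * z₂ = -m * x₂ := by
      rw [← hD₂, hx₂]; field_simp
    apply mul_left_cancel₀ hD₁0
    apply mul_left_cancel₀ hD₂0
    linear_combination (z₁ + z₂ + z₃ : F) * v₁ - hz₃F + v₂ - (l * x₂ - 1 : F) * (l * x₃ - 1) * g₁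
      - (l * x₁ - 1 : F) * (l * x₃ - 1) * g₂
  have hw₃D : (w₃ : F) * (l * x₃ - 1) = -m := by
    rw [hw₃F]; linear_combination (l : F) * hx₃w
  have hw₃0 : (w₃ : F) ≠ 0 := by
    intro h0; rw [h0, zero_mul] at hw₃D; exact hm0 (neg_eq_zero.1 hw₃D.symm)
  have hx₃z : x₃ * w₃ = z₃ := by
    apply mul_right_cancel₀ hD₃0
    linear_combination x₃ * hw₃D - hx₃w
  -- The sum of the two points is the negative of the third point of intersection.
  have hsum := Point.add_some hxy (h₁ := ns₁) (h₂ := ns₂)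
  obtain ⟨y₃, hy₃⟩ : ∃ y₃, y₃ = (W⁄F).toAffine.addY x₁ x₂ y₁ ℓ := ⟨_, rfl⟩
  have hy₃w : y₃ * w₃ = (u : A) := by
    have hu' := congrArg Subtype.val hu
    push_cast at hu'
    rw [hu', hy₃, addY, negAddY, ← hx₃, negY, a₁c, a₃c]
    have : (ℓ * (x₃ - x₁) + y₁) * w₃ = -1 := by
      apply mul_right_cancel₀ hm0
      linear_combination hw₃D + (w₃ * x₃ : F) * hslope + (w₃ : F) * hν
    linear_combination -this - ((W⁄A).a₁ : F) * hx₃z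
  have hy₃A : y₃ ∉ A := by
    intro h0
    apply inv_notMem A hw₃m (by simpa using hw₃0)
    have : (w₃ : F)⁻¹ = y₃ * ((u⁻¹ : Aˣ) : A) := by
      have h1 : (((u : A) : F)) * ((u⁻¹ : Aˣ) : A) = 1 := by
        exact_mod_cast congrArg Subtype.val u.mul_inv
      rw [← hy₃w] at h1
      field_simp
      linear_combination -h1
    rw [this]
    exact A.mul_mem _ _ h0 (Subtype.mem _)
  obtain ⟨ns, hPQ⟩ : ∃ ns : (W⁄F).toAffine.Nonsingular x₃ y₃,
      Point.some x₁ y₁ ns₁ + Point.some x₂ y₂ ns₂ = Point.some x₃ y₃ ns := by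
    subst hx₃ hy₃ hℓ
    exact ⟨_, hsum⟩
  have hx₃A : x₃ ∉ A := fun h0 => hy₃A (y_mem_of_x_mem A ns.1 h0)
  obtain ⟨z, hz, h, hh, e', hz0, hh0, rfl, rfl⟩ := exists_chart A ns.1 hx₃A
  refine ⟨z, h, ⟨hz, hh, e', .inr ⟨hz0, hh0, ns, hPQ⟩⟩, ?_⟩
  have hzu : z * u = -z₃ := by
    apply Subtype.val_injective
    push_cast
    have hzF : (z : F) ≠ 0 := by simpa using hz0
    have hhF : (h : F) ≠ 0 := by simpa using hh0
    rw [← hy₃w, ← hx₃z]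
    field_simp
  refine ⟨↑cu⁻¹ * ↑u⁻¹ * (e + c * ((W⁄A).a₁ * z₃ + (W⁄A).a₃ * w₃)),
    Ideal.mul_mem_left _ _ (add_mem he (Ideal.mul_mem_left _ _ hb)), ?_⟩
  have hcc : c * ↑cu⁻¹ = 1 := by rw [← hcu, cu.mul_inv]
  have huu : (u : A) * ↑u⁻¹ = 1 := u.mul_inv
  have key : (z - z₁) * (c * u) = z₂ * (c * u + (e + c * ((W⁄A).a₁ * z₃ + (W⁄A).a₃ * w₃))) := by
    rw [hu] at hzu ⊢
    linear_combination c * hzu - (1 - z₁ * (W⁄A).a₁ - z₁ * (W⁄A).a₃ * l) * hz₃ +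
      z₁ * c * (W⁄A).a₃ * hw₃ - hE - hZ
  calc z - z₁ = (z - z₁) * (c * u) * (↑cu⁻¹ * ↑u⁻¹) := by
        linear_combination (-(z - z₁)) * (u * ↑u⁻¹ * hcc + huu)
    _ = _ := by
        rw [key]
        linear_combination z₂ * (u * ↑u⁻¹ * hcc + huu)

end KernelAddition

/-! ### Unique divisibility of the kernel of reduction -/

section KernelDivisible

open IsLocalRing WeierstrassCurve WeierstrassCurve.Affine

variable {R F : Type*} [CommRing R] [Field F] [DecidableEq F] {A : ValuationSubring F}
  [Algebra R A] [Algebra R F] [IsScalarTower R A F] {W : WeierstrassCurve R}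

omit [DecidableEq F] [IsScalarTower R A F] in
theorem OnChart.eq_zero {P : (W⁄F).toAffine.Point} {h : A} (hP : OnChart A W P 0 h) : P = 0 := by
  obtain ⟨-, -, -, ⟨h, -⟩ | ⟨h, -⟩⟩ := hP
  · exact h
  · exact absurd rfl h

omit [DecidableEq F] [IsScalarTower R A F] in
theorem OnChart.unique {P : (W⁄F).toAffine.Point} {z h z' h' : A} (hP : OnChart A W P z h)
    (hP' : OnChart A W P z' h') : z = z' := by
  obtain ⟨-, -, -, ⟨rfl, rfl, rfl⟩ | ⟨hz, hh, ns, rfl⟩⟩ := hP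
  · obtain ⟨-, -, -, ⟨-, rfl, rfl⟩ | ⟨hz, hh, ns, hs⟩⟩ := hP'
    · rfl
    · cases hs
  · obtain ⟨-, -, -, ⟨h0, -, -⟩ | ⟨hz', hh', ns', hs⟩⟩ := hP'
    · cases h0
    · obtain ⟨h1, h2⟩ := (Point.some.injEq ..).mp hs
      have hF : (h : F) = h' := by simpa using h1
      have h0F : (h' : F) ≠ 0 := by simpa using hh'
      have hzF : (z : F) ≠ 0 := by simpa using hz
      have hzF' : (z' : F) ≠ 0 := by simpa using hz'
      rw [hF] at h2
      field_simp at h2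
      exact Subtype.ext (neg_injective h2).symm

omit [DecidableEq F] in
theorem exists_onChart_of_notMem {x y : F} (ns : (W⁄F).toAffine.Nonsingular x y) (hx : x ∉ A) :
    ∃ z h, OnChart A W (Point.some x y ns) z h := by
  obtain ⟨z, hz, h, hh, e, hz0, hh0, rfl, rfl⟩ := exists_chart A ns.1 hx
  exact ⟨z, h, hz, hh, e, .inr ⟨hz0, hh0, ns, rfl⟩⟩

omit [DecidableEq F] [IsScalarTower R A F] in
theorem OnChart.x_notMem {x y : F} {ns : (W⁄F).toAffine.Nonsingular x y} {z h : A}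
    (hP : OnChart A W (Point.some x y ns) z h) : x ∉ A := by
  obtain ⟨-, hh, -, ⟨h0, -, -⟩ | ⟨hz, hh0, ns', hs⟩⟩ := hP
  · cases h0
  · obtain ⟨h1, -⟩ := (Point.some.injEq ..).mp hs
    rw [h1, one_div]
    exact inv_notMem A hh hh0

omit [DecidableEq F] in
theorem OnChart.exists_neg {P : (W⁄F).toAffine.Point} {z h : A} (hP : OnChart A W P z h) :
    ∃ z' h', OnChart A W (-P) z' h' := by
  cases P with
  | zero => exact ⟨z, h, hP⟩
  | some x y ns =>
    rw [Point.neg_some]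
    exact exists_onChart_of_notMem _ hP.x_notMem

variable (A W) in
/-- The kernel of reduction: the points of `W` that reduce to the origin. -/
def kernelOfReduction : AddSubgroup (W⁄F).toAffine.Point where
  carrier := {P | ∃ z h, OnChart A W P z h}
  zero_mem' := ⟨0, 0, OnChart.zero⟩
  add_mem' := by
    rintro P Q ⟨z₁, h₁, hP⟩ ⟨z₂, h₂, hQ⟩
    obtain ⟨z, h, hPQ, -⟩ := hP.add hQ
    exact ⟨z, h, hPQ⟩
  neg_mem' := by
    rintro P ⟨z, h, hP⟩
    exact hP.exists_neg

theorem some_mem_kernelOfReduction {x y : F} {ns : (W⁄F).toAffine.Nonsingular x y} :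
    Point.some x y ns ∈ kernelOfReduction A W ↔ x ∉ A :=
  ⟨fun ⟨_, _, h⟩ => h.x_notMem, fun h => exists_onChart_of_notMem ns h⟩

/-- The coordinate `z` measures the distance of two points in the kernel of reduction. -/
theorem OnChart.z_sub {P Q D : (W⁄F).toAffine.Point} {z₁ h₁ z₂ h₂ z h : A}
    (hP : OnChart A W P z₁ h₁) (hQ : OnChart A W Q z₂ h₂) (hD : OnChart A W D z h)
    (hPQ : P = Q + D) : ∃ ε ∈ maximalIdeal A, z₁ - z₂ = z * (1 + ε) := by
  obtain ⟨z', h', hP', ε, hε, he⟩ := hQ.add hD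
  rw [← hPQ] at hP'
  rw [hP'.unique hP] at he
  exact ⟨ε, hε, he⟩

theorem OnChart.nsmul {P : (W⁄F).toAffine.Point} {z h : A} (hP : OnChart A W P z h) (n : ℕ) :
    ∃ z' h', OnChart A W (n • P) z' h' ∧ ∃ ε ∈ maximalIdeal A, z' = z * (n + ε) := by
  induction n with
  | zero => exact ⟨0, 0, by rw [zero_nsmul]; exact OnChart.zero, 0, zero_mem _, by simp⟩
  | succ n ih =>
    obtain ⟨z', h', hn, ε, hε, rfl⟩ := ih
    obtain ⟨z'', h'', hs, ε', hε', he⟩ := hn.add hP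
    refine ⟨z'', h'', by rwa [succ_nsmul], ε + ε', add_mem hε hε', ?_⟩
    push_cast
    linear_combination he

/-- Every solution of the equation of the chart in the maximal ideal comes from a point. -/
theorem exists_onChart [W.IsElliptic] {z h : A} (hz : z ∈ maximalIdeal A)
    (hh : h ∈ maximalIdeal A) (e : ChartEq (W⁄A) z h) :
    ∃ P : (W⁄F).toAffine.Point, OnChart A W P z h := by
  by_cases hz0 : z = 0
  · subst hz0
    have : h = 0 := by simpa [ChartEq] using e
    subst this
    exact ⟨0, OnChart.zero⟩
  · have hh0 : h ≠ 0 := by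
      rintro rfl
      apply hz0
      have : (0 : A) = z ^ 2 := by simpa [ChartEq] using e
      exact pow_eq_zero_iff two_ne_zero |>.1 this.symm
    have eF := ((chartEq_coe A).2 e).equation (W := W⁄F) (by simpa using hz0) (by simpa using hh0)
    have : (W⁄F).IsElliptic := inferInstanceAs (W.map (algebraMap R F)).IsElliptic
    exact ⟨.some _ _ ((equation_iff_nonsingular (W := W⁄F)).1 eF), hz, hh, e,
      .inr ⟨hz0, hh0, _, rfl⟩⟩

omit [DecidableEq F] in
theorem mem_of_mul_one_add_mem {z ε : A} {I : Ideal A} (hε : ε ∈ maximalIdeal A)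
    (h : z * (1 + ε) ∈ I) : z ∈ I := by
  have hu : IsUnit (1 + ε) := by simpa using isUnit_one_sub A (neg_mem hε)
  exact (Ideal.mul_unit_mem_iff_mem I hu).1 h

/-- Multiplication by an integer prime to the residue characteristic has no kernel on the kernel of
reduction. -/
theorem eq_zero_of_nsmul_eq_zero_of_mem_kernel {n : ℕ} (hn : IsUnit (n : A))
    {P : (W⁄F).toAffine.Point} (hP : P ∈ kernelOfReduction A W) (h0 : n • P = 0) : P = 0 := by
  obtain ⟨z, h, hP⟩ := hP
  obtain ⟨z', h', hn', ε, hε, rfl⟩ := hP.nsmul n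
  rw [h0] at hn'
  have h1 := hn'.unique OnChart.zero
  have hu : IsUnit ((n : A) + ε) := by
    by_contra hc
    have := sub_mem ((mem_maximalIdeal _).2 hc) hε
    rw [add_sub_cancel_right] at this
    exact (mem_maximalIdeal _).1 this hn
  obtain rfl : z = 0 := by
    rcases mul_eq_zero.1 h1 with h1 | h1
    · exact h1
    · exact absurd (h1 ▸ hu) not_isUnit_zero
  exact hP.eq_zero

/-- If the valuation ring is complete, the kernel of reduction is divisible by integers prime to
the residue characteristic. -/
theorem exists_nsmul_eq_of_mem_kernel [IsAdicComplete (maximalIdeal A) A] [W.IsElliptic] {n u : ℕ}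
    (hu : 1 - (n : A) * u ∈ maximalIdeal A) {P : (W⁄F).toAffine.Point}
    (hP : P ∈ kernelOfReduction A W) : ∃ Q ∈ kernelOfReduction A W, n • Q = P := by
  set I := maximalIdeal A
  -- Newton iteration `b ↦ b + u (P - n b)`; the error `P - n b` is multiplied by `1 - n u`.
  let b : ℕ → (W⁄F).toAffine.Point := fun N => Nat.rec 0 (fun _ b => b + u • (P - n • b)) N
  have hb : ∀ N, b (N + 1) = b N + u • (P - n • b N) := fun N => rfl
  have hbm : ∀ N, b N ∈ kernelOfReduction A W := by
    intro N
    induction N with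
    | zero => exact zero_mem _
    | succ N ih =>
      rw [hb]
      exact add_mem ih (nsmul_mem (sub_mem hP (nsmul_mem ih _)) _)
  have hrm : ∀ N, P - n • b N ∈ kernelOfReduction A W := fun N => sub_mem hP (nsmul_mem (hbm N) _)
  choose zs hs hbc using hbm
  choose rs gs hrc using hrm
  have hr : ∀ N, rs N ∈ I ^ (N + 1) := by
    intro N
    induction N with
    | zero => rw [zero_add, pow_one]; exact (hrc 0).1
    | succ N ih =>
      obtain ⟨z', h', hn', ε, hε, rfl⟩ := (hrc N).nsmul (n * u)
      obtain ⟨ε', hε', he⟩ := (hrc N).z_sub (hrc (N + 1)) hn' (by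
        rw [hb, smul_add, ← smul_assoc, smul_eq_mul]; abel)
      have : rs (N + 1) = rs N * ((1 - n * u) - ε - (n * u + ε) * ε') := by
        push_cast at he
        linear_combination -he
      rw [this, pow_succ]
      exact Ideal.mul_mem_mul ih (sub_mem (sub_mem hu hε) (Ideal.mul_mem_left _ _ hε'))
  have hz : ∀ N, zs (N + 1) - zs N ∈ I ^ (N + 1) := by
    intro N
    obtain ⟨z', h', hn', ε, hε, rfl⟩ := (hrc N).nsmul u
    obtain ⟨ε', hε', he⟩ := (hbc (N + 1)).z_sub (hbc N) hn' (hb N)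
    rw [he, mul_assoc]
    exact Ideal.mul_mem_right _ _ (hr N)
  have hz' : ∀ N k, zs (N + k) - zs N ∈ I ^ N := by
    intro N k
    induction k with
    | zero => simp
    | succ k ih =>
      have h1 := Ideal.pow_le_pow_right (show N ≤ N + k + 1 by omega) (hz (N + k))
      have := add_mem h1 ih
      rwa [sub_add_sub_cancel] at this
  have hh' : ∀ N k, hs (N + k) - hs N ∈ I ^ N := by
    intro N k
    obtain ⟨κ, -, hκ, -⟩ := (hbc (N + k)).2.2.1.exists_dividedDifference (hbc N).2.2.1
      (hbc (N + k)).1 (hbc (N + k)).2.1 (hbc N).1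
    rw [hκ]
    exact Ideal.mul_mem_left _ _ (hz' N k)
  have lim : ∀ f : ℕ → A, (∀ N k, f (N + k) - f N ∈ I ^ N) → ∃ L, ∀ N, f N - L ∈ I ^ N := by
    intro f hf
    obtain ⟨L, hL⟩ := IsPrecomplete.prec (I := I) (M := A) inferInstance (f := f) (by
      intro m k hmk
      obtain ⟨j, rfl⟩ := Nat.exists_eq_add_of_le hmk
      rw [SModEq.sub_mem, smul_eq_mul, Ideal.mul_top, ← neg_mem_iff, neg_sub]
      exact hf m j)
    refine ⟨L, fun N => ?_⟩
    have := hL N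
    rwa [SModEq.sub_mem, smul_eq_mul, Ideal.mul_top] at this
  have haus : ∀ x : A, (∀ N, x ∈ I ^ N) → x = 0 := by
    intro x hx
    refine IsHausdorff.haus (I := I) (M := A) inferInstance x fun N => ?_
    rw [SModEq.sub_mem, smul_eq_mul, Ideal.mul_top, sub_zero]
    exact hx N
  -- The coordinates of the iterates converge, and their limits are those of a point `Q`.
  obtain ⟨z, hzL⟩ := lim zs hz'
  obtain ⟨h, hhL⟩ := lim hs hh'
  have e : ChartEq (W⁄A) z h := by
    refine sub_eq_zero.1 (haus _ fun N => ?_)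
    have e1 := congrArg (Ideal.Quotient.mk (I ^ N)) (hbc N).2.2.1
    have e2 := (Ideal.Quotient.eq (I := I ^ N)).2 (hzL N)
    have e3 := (Ideal.Quotient.eq (I := I ^ N)).2 (hhL N)
    rw [← Ideal.Quotient.eq_zero_iff_mem]
    simp only [map_mul, map_add, map_sub, map_pow] at e1 ⊢
    rw [e2, e3] at e1
    exact sub_eq_zero.2 e1
  have hzI : z ∈ I := by
    have := sub_mem (hbc 1).1 (show zs 1 - z ∈ I from pow_one I ▸ hzL 1)
    rwa [sub_sub_cancel] at this
  have hhI : h ∈ I := by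
    have := sub_mem (hbc 1).2.1 (show hs 1 - h ∈ I from pow_one I ▸ hhL 1)
    rwa [sub_sub_cancel] at this
  obtain ⟨Q, hQ⟩ := exists_onChart hzI hhI e
  refine ⟨Q, ⟨z, h, hQ⟩, ?_⟩
  have hQm : Q ∈ kernelOfReduction A W := ⟨z, h, hQ⟩
  obtain ⟨d, g, hd⟩ : n • Q - P ∈ kernelOfReduction A W := sub_mem (nsmul_mem hQm _) hP
  -- `n Q - P` is the sum of `n (Q - b N)` and `-(P - n b N)`, and both are as small as desired.
  have hd0 : d = 0 := by
    refine haus d fun N => ?_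
    obtain ⟨t, k, ht⟩ : Q - b N ∈ kernelOfReduction A W := sub_mem hQm ⟨_, _, hbc N⟩
    obtain ⟨ε, hε, he⟩ := hQ.z_sub (hbc N) ht (by abel)
    have htN : t ∈ I ^ N := by
      refine mem_of_mul_one_add_mem hε (he ▸ ?_)
      rw [← neg_mem_iff, neg_sub]
      exact hzL N
    obtain ⟨z', h', hn', ε', hε', rfl⟩ := ht.nsmul n
    obtain ⟨ε'', hε'', he''⟩ := hn'.z_sub (hrc N) hd (by rw [smul_sub]; abel)
    refine mem_of_mul_one_add_mem hε'' (he'' ▸ ?_)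
    exact sub_mem (Ideal.mul_mem_right _ _ htN) (Ideal.pow_le_pow_right (Nat.le_succ N) (hr N))
  subst hd0
  exact sub_eq_zero.1 hd.eq_zero

end KernelDivisible

/-! ### The reduction homomorphism -/

section Reduction

open IsLocalRing WeierstrassCurve WeierstrassCurve.Affine

/-- A formula for the slope of a chord or tangent that is valid near the diagonal. -/
theorem slope_mul_sub_negY {F : Type*} [Field F] [DecidableEq F] {W : WeierstrassCurve F}
    {x₁ x₂ y₁ y₂ : F} (h₁ : W.toAffine.Equation x₁ y₁)
    (h₂ : W.toAffine.Equation x₂ y₂) (hxy : ¬(x₁ = x₂ ∧ y₁ = W.toAffine.negY x₂ y₂)) :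
    W.toAffine.slope x₁ x₂ y₁ y₂ * (y₁ - W.toAffine.negY x₂ y₂) =
      x₁ ^ 2 + x₁ * x₂ + x₂ ^ 2 + W.a₂ * (x₁ + x₂) + W.a₄ - W.a₁ * y₁ := by
  by_cases hx : x₁ = x₂
  · have hy : y₁ ≠ W.toAffine.negY x₂ y₂ := fun h => hxy ⟨hx, h⟩
    obtain rfl := Y_eq_of_Y_ne h₁ h₂ hx hy
    subst hx
    rw [slope_of_Y_ne rfl hy, div_mul_cancel₀ _ (sub_ne_zero.2 hy)]
    ring
  · rw [slope_of_X_ne hx, div_mul_eq_mul_div, div_eq_iff (sub_ne_zero.2 hx)]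
    rw [equation_iff] at h₁ h₂
    rw [negY]
    linear_combination h₁ - h₂

variable {R F : Type*} [CommRing R] [Field F] {A : ValuationSubring F}
  [Algebra R A] [Algebra R F] [IsScalarTower R A F] {W : WeierstrassCurve R}

local notation "κ" => ResidueField A

variable (A W) in
omit [Algebra R F] [IsScalarTower R A F] in
theorem residue_a₁ : (W⁄κ).a₁ = residue A (W⁄A).a₁ := rfl
variable (A W) in
omit [Algebra R F] [IsScalarTower R A F] in
theorem residue_a₂ : (W⁄κ).a₂ = residue A (W⁄A).a₂ := rfl
variable (A W) in
omit [Algebra R F] [IsScalarTower R A F] in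
theorem residue_a₃ : (W⁄κ).a₃ = residue A (W⁄A).a₃ := rfl
variable (A W) in
omit [Algebra R F] [IsScalarTower R A F] in
theorem residue_a₄ : (W⁄κ).a₄ = residue A (W⁄A).a₄ := rfl
variable (A W) in
omit [Algebra R F] [IsScalarTower R A F] in
theorem residue_a₆ : (W⁄κ).a₆ = residue A (W⁄A).a₆ := rfl

theorem equation_coe_iff {x y : A} :
    (W⁄F).toAffine.Equation (x : F) y ↔ (W⁄A).toAffine.Equation x y := by
  simp only [equation_iff, baseChange_a₁_coe A W, baseChange_a₂_coe A W, baseChange_a₃_coe A W,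
    baseChange_a₄_coe A W, baseChange_a₆_coe A W]
  exact_mod_cast Iff.rfl

theorem equation_residue {x y : A} (h : (W⁄F).toAffine.Equation (x : F) y) :
    (W⁄κ).toAffine.Equation (residue A x) (residue A y) :=
  (equation_coe_iff.1 h).map (residue A)

theorem nonsingular_residue [W.IsElliptic] {x y : A} (h : (W⁄F).toAffine.Nonsingular (x : F) y) :
    (W⁄κ).toAffine.Nonsingular (residue A x) (residue A y) :=
  have : (W⁄κ).IsElliptic := inferInstanceAs (W.map (algebraMap R κ)).IsElliptic
  (equation_iff_nonsingular (W := W⁄κ)).1 (equation_residue h.1)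

open scoped Classical in
variable (A W) in
/-- Reduction of points modulo the maximal ideal of a valuation ring: integral points are reduced
coordinatewise and all other points are sent to the origin. -/
noncomputable def reductionFun [W.IsElliptic] : (W⁄F).toAffine.Point → (W⁄κ).toAffine.Point
  | .zero => 0
  | .some x y h => if hx : x ∈ A then
      .some (residue A ⟨x, hx⟩) (residue A ⟨y, y_mem_of_x_mem A h.1 hx⟩) (nonsingular_residue h)
    else 0

variable [W.IsElliptic]

theorem reductionFun_zero : reductionFun A W 0 = 0 := rfl

theorem reductionFun_coe {x y : A} (h : (W⁄F).toAffine.Nonsingular (x : F) y) :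
    reductionFun A W (.some _ _ h) = .some _ _ (nonsingular_residue h) := by
  rw [reductionFun, dif_pos x.2]

theorem reductionFun_of_eq {x y : F} (h : (W⁄F).toAffine.Nonsingular x y) {X Y : A} (hX : x = X)
    (hY : y = Y) {x' y' : κ} (h' : (W⁄κ).toAffine.Nonsingular x' y') (hx' : residue A X = x')
    (hy' : residue A Y = y') : reductionFun A W (.some _ _ h) = .some _ _ h' := by
  subst hX hY hx' hy'
  exact reductionFun_coe h

theorem reductionFun_of_notMem {x y : F} (h : (W⁄F).toAffine.Nonsingular x y) (hx : x ∉ A) :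
    reductionFun A W (.some _ _ h) = 0 := by
  rw [reductionFun, dif_neg hx]

theorem reductionFun_eq_zero_iff [DecidableEq F] {P : (W⁄F).toAffine.Point} :
    reductionFun A W P = 0 ↔ P ∈ kernelOfReduction A W := by
  cases P with
  | zero => exact iff_of_true rfl (zero_mem _)
  | some x y h =>
    rw [some_mem_kernelOfReduction]
    by_cases hx : x ∈ A
    · lift x to A using hx
      lift y to A using y_mem_of_x_mem A h.1 (Subtype.mem _)
      rw [reductionFun_coe]
      exact iff_of_false (Point.some_ne_zero _) (not_not_intro (Subtype.mem _))
    · exact iff_of_true (reductionFun_of_notMem h hx) hx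

omit [W.IsElliptic] in
theorem addX_notMem {x₁ x₂ : A} {ℓ : F} (hℓ : ℓ ∉ A) : (W⁄F).toAffine.addX x₁ x₂ ℓ ∉ A := by
  intro hx
  apply hℓ
  obtain ⟨s, hs, hsℓ, hs0⟩ := exists_mem_maximalIdeal_inv A hℓ
  have hℓ0 : ℓ ≠ 0 := by rintro rfl; exact hℓ A.zero_mem
  have : ℓ = (((⟨_, hx⟩ + (W⁄A).a₂ + x₁ + x₂) * s - (W⁄A).a₁ : A) : F) := by
    push_cast
    rw [addX, hsℓ, baseChange_a₁_coe A W, baseChange_a₂_coe A W]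
    field_simp
    ring
  rw [this]
  exact Subtype.mem _

variable [DecidableEq F]

open scoped Classical in
/-- Reduction is additive on integral points. The slope of the line through them is a quotient of
integral elements with unit denominator unless the reduced points are opposite, in which case the
slope, and so the abscissa of the sum, is not integral. -/
theorem reductionFun_add_of_integral {x₁ y₁ x₂ y₂ : A}
    (h₁ : (W⁄F).toAffine.Nonsingular (x₁ : F) y₁)
    (h₂ : (W⁄F).toAffine.Nonsingular (x₂ : F) y₂) :
    reductionFun A W (.some _ _ h₁ + .some _ _ h₂) =
      reductionFun A W (.some _ _ h₁) + reductionFun A W (.some _ _ h₂) := by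
  have a₁c := baseChange_a₁_coe A W
  have a₂c := baseChange_a₂_coe A W
  have a₃c := baseChange_a₃_coe A W
  have a₄c := baseChange_a₄_coe A W
  rw [reductionFun_coe, reductionFun_coe]
  have hnegF : ∀ x y : A, (W⁄F).toAffine.negY (x : F) y = (((W⁄A).toAffine.negY x y : A) : F) := by
    intro x y; rw [negY, negY, a₁c, a₃c]; push_cast; rfl
  have hnegκ : ∀ x y : A, (W⁄κ).toAffine.negY (residue A x) (residue A y) =
      residue A ((W⁄A).toAffine.negY x y) := by
    intro x y; rw [negY, negY, residue_a₁, residue_a₃]; simp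
  by_cases hs : residue A x₁ = residue A x₂ ∧
      residue A y₁ = (W⁄κ).toAffine.negY (residue A x₂) (residue A y₂)
  · rw [Point.add_of_Y_eq hs.1 hs.2]
    by_cases hxy : (x₁ : F) = x₂ ∧ (y₁ : F) = (W⁄F).toAffine.negY x₂ y₂
    · rw [Point.add_of_Y_eq hxy.1 hxy.2]; rfl
    · rw [Point.add_some hxy]
      refine reductionFun_of_notMem _ (addX_notMem fun hℓ => ?_)
      -- An integral slope would make the reduced point singular.
      obtain ⟨L, hL⟩ : ∃ L : A, (L : F) = (W⁄F).toAffine.slope x₁ x₂ y₁ y₂ := ⟨⟨_, hℓ⟩, rfl⟩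
      have hm := slope_mul_sub_negY h₁.1 h₂.1 hxy
      rw [← hL, hnegF, a₁c, a₂c, a₄c] at hm
      have hmA : L * (y₁ - (W⁄A).toAffine.negY x₂ y₂) = x₁ ^ 2 + x₁ * x₂ + x₂ ^ 2 +
          (W⁄A).a₂ * (x₁ + x₂) + (W⁄A).a₄ - (W⁄A).a₁ * y₁ := by exact_mod_cast hm
      have hmκ := congrArg (residue A) hmA
      have hyy : residue A y₁ = residue A y₂ := by
        by_cases hx : (x₁ : F) = x₂
        · have : (y₁ : F) = y₂ := Y_eq_of_Y_ne h₁.1 h₂.1 hx fun h => hxy ⟨hx, h⟩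
          rw [Subtype.ext this]
        · rw [slope_of_X_ne hx, eq_div_iff (sub_ne_zero.2 hx)] at hL
          have hLA : L * (x₁ - x₂) = y₁ - y₂ := by exact_mod_cast hL
          have := congrArg (residue A) hLA
          rw [map_mul, map_sub, hs.1, sub_self, mul_zero, map_sub] at this
          exact (sub_eq_zero.1 this.symm)
      rw [map_mul, map_sub, ← hnegκ, ← hs.2, sub_self, mul_zero] at hmκ
      simp only [map_sub, map_add, map_mul, map_pow, ← hs.1] at hmκ
      have hns := ((nonsingular_iff (W := (W⁄κ).toAffine) _ _).1 (nonsingular_residue h₁)).2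
      rcases hns with hns | hns
      · apply hns
        rw [residue_a₁, residue_a₂, residue_a₄]
        linear_combination hmκ
      · apply hns
        have := hs.2
        rw [← hs.1, ← hyy] at this
        exact this
  · rw [Point.add_some hs]
    have hxy : ¬((x₁ : F) = x₂ ∧ (y₁ : F) = (W⁄F).toAffine.negY x₂ y₂) := by
      rintro ⟨hx, hy⟩
      rw [hnegF] at hy
      have hx' := Subtype.ext hx
      have hy' := Subtype.ext hy
      exact hs ⟨by rw [hx'], by rw [hnegκ, ← hy']⟩
    rw [Point.add_some hxy]
    obtain ⟨d, n, hd, hdF, hdκ⟩ : ∃ d n : A, IsUnit d ∧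
        (W⁄F).toAffine.slope x₁ x₂ y₁ y₂ * d = n ∧
        (W⁄κ).toAffine.slope (residue A x₁) (residue A x₂) (residue A y₁) (residue A y₂) *
          residue A d = residue A n := by
      by_cases hx : residue A x₁ = residue A x₂
      · refine ⟨y₁ - (W⁄A).toAffine.negY x₂ y₂, x₁ ^ 2 + x₁ * x₂ + x₂ ^ 2 +
          (W⁄A).a₂ * (x₁ + x₂) + (W⁄A).a₄ - (W⁄A).a₁ * y₁, ?_, ?_, ?_⟩
        · rw [← residue_ne_zero_iff_isUnit, map_sub, ← hnegκ]
          exact sub_ne_zero.2 fun h => hs ⟨hx, h⟩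
        · have := slope_mul_sub_negY h₁.1 h₂.1 hxy
          rw [hnegF, a₁c, a₂c, a₄c] at this
          push_cast
          exact this
        · have := slope_mul_sub_negY (nonsingular_residue h₁).1 (nonsingular_residue h₂).1 hs
          rw [hnegκ, residue_a₁, residue_a₂, residue_a₄] at this
          simpa only [map_sub, map_add, map_mul, map_pow] using this
      · have hxF : (x₁ : F) ≠ x₂ := fun h => hx (by rw [Subtype.ext h])
        refine ⟨x₁ - x₂, y₁ - y₂, ?_, ?_, ?_⟩
        · rw [← residue_ne_zero_iff_isUnit, map_sub]
          exact sub_ne_zero.2 hx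
        · rw [slope_of_X_ne hxF]
          push_cast
          exact div_mul_cancel₀ _ (sub_ne_zero.2 hxF)
        · rw [slope_of_X_ne hx, map_sub, map_sub]
          exact div_mul_cancel₀ _ (sub_ne_zero.2 hx)
    obtain ⟨u, rfl⟩ := hd
    obtain ⟨L, hL⟩ : ∃ L, L = n * ↑u⁻¹ := ⟨_, rfl⟩
    have hLu : L * u = n := by rw [hL, mul_assoc, u.inv_mul, mul_one]
    have huF : ((u : A) : F) ≠ 0 := by simp
    have huκ : residue A u ≠ 0 := (residue_ne_zero_iff_isUnit _).2 u.isUnit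
    have hLF : (W⁄F).toAffine.slope x₁ x₂ y₁ y₂ = (L : F) := by
      apply mul_right_cancel₀ huF
      rw [hdF, ← hLu]; push_cast; rfl
    have hLκ : (W⁄κ).toAffine.slope (residue A x₁) (residue A x₂) (residue A y₁) (residue A y₂) =
        residue A L := by
      apply mul_right_cancel₀ huκ
      rw [hdκ, ← hLu, map_mul]
    have hXF : (W⁄F).toAffine.addX x₁ x₂ (L : F) = (((W⁄A).toAffine.addX x₁ x₂ L : A) : F) := by
      rw [addX, addX, a₁c, a₂c]; push_cast; rfl
    have hXκ : (W⁄κ).toAffine.addX (residue A x₁) (residue A x₂) (residue A L) =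
        residue A ((W⁄A).toAffine.addX x₁ x₂ L) := by
      rw [addX, addX, residue_a₁, residue_a₂]; simp
    refine reductionFun_of_eq _ (X := (W⁄A).toAffine.addX x₁ x₂ L)
      (Y := (W⁄A).toAffine.addY x₁ x₂ y₁ L) ?_ ?_ _ ?_ ?_
    · rw [hLF, hXF]
    · rw [hLF, addY, addY, negAddY, negAddY, hXF, ← hnegF]; push_cast; rfl
    · rw [hLκ, hXκ]
    · rw [hLκ, addY, addY, negAddY, negAddY, hXκ, ← hnegκ]; simp

omit [W.IsElliptic] in
theorem exists_eq_some_of_notMem_kernel {P : (W⁄F).toAffine.Point}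
    (hP : P ∉ kernelOfReduction A W) : ∃ (x y : A) (h : (W⁄F).toAffine.Nonsingular (x : F) y),
      P = .some _ _ h := by
  cases P with
  | zero => exact absurd (zero_mem _) hP
  | some x y h =>
    rw [some_mem_kernelOfReduction, not_not] at hP
    lift x to A using hP
    lift y to A using y_mem_of_x_mem A h.1 (Subtype.mem _)
    exact ⟨x, y, h, rfl⟩

open scoped Classical in
theorem reductionFun_add (P Q : (W⁄F).toAffine.Point) :
    reductionFun A W (P + Q) = reductionFun A W P + reductionFun A W Q := by
  have integral {P Q : (W⁄F).toAffine.Point} (hP : P ∉ kernelOfReduction A W)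
      (hQ : Q ∉ kernelOfReduction A W) :
      reductionFun A W (P + Q) = reductionFun A W P + reductionFun A W Q := by
    obtain ⟨x₁, y₁, h₁, rfl⟩ := exists_eq_some_of_notMem_kernel hP
    obtain ⟨x₂, y₂, h₂, rfl⟩ := exists_eq_some_of_notMem_kernel hQ
    exact reductionFun_add_of_integral h₁ h₂
  -- If `P` reduces to the origin and `Q` does not, apply the integral case to `(P + Q) + (-Q) = P`.
  have mixed {P Q : (W⁄F).toAffine.Point} (hP : P ∈ kernelOfReduction A W)
      (hQ : Q ∉ kernelOfReduction A W) : reductionFun A W (P + Q) = reductionFun A W Q := by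
    have hQ' : -Q ∉ kernelOfReduction A W := fun h => hQ (by simpa using neg_mem h)
    have hS : P + Q ∉ kernelOfReduction A W := fun h => hQ (by simpa using sub_mem h hP)
    have h1 := integral hS hQ'
    have h2 := integral hQ hQ'
    rw [add_neg_cancel_right, reductionFun_eq_zero_iff.2 hP] at h1
    rw [add_neg_cancel, reductionFun_zero] at h2
    exact add_right_cancel (h1.symm.trans h2)
  by_cases hP : P ∈ kernelOfReduction A W
  · rw [reductionFun_eq_zero_iff.2 hP, zero_add]
    by_cases hQ : Q ∈ kernelOfReduction A W
    · rw [reductionFun_eq_zero_iff.2 hQ, reductionFun_eq_zero_iff.2 (add_mem hP hQ)]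
    · exact mixed hP hQ
  · by_cases hQ : Q ∈ kernelOfReduction A W
    · rw [reductionFun_eq_zero_iff.2 hQ, add_zero, add_comm, mixed hQ hP]
    · exact integral hP hQ

open scoped Classical in
variable (A W) in
/-- The reduction homomorphism of an elliptic curve with good reduction. -/
noncomputable def reductionHom : (W⁄F).toAffine.Point →+ (W⁄κ).toAffine.Point where
  toFun := reductionFun A W
  map_zero' := rfl
  map_add' := reductionFun_add

end Reduction

/-! ### Lifting points from the residue field -/

section Lifting

open IsLocalRing WeierstrassCurve WeierstrassCurve.Affine Polynomial

/-- Newton approximation for a monic polynomial over a complete local ring. -/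
theorem exists_root_of_residue_root {A : Type*} [CommRing A] [IsLocalRing A]
    [IsAdicComplete (maximalIdeal A) A] {f : A[X]} (hf : f.Monic) {a₀ : A}
    (h₀ : residue A (f.eval a₀) = 0) (h₁ : residue A (f.derivative.eval a₀) ≠ 0) :
    ∃ a, f.eval a = 0 ∧ residue A a = residue A a₀ := by
  obtain ⟨a, ha, haa⟩ := HenselianRing.is_henselian (I := maximalIdeal A) f hf a₀
    ((residue_eq_zero_iff _).1 h₀) ((residue_ne_zero_iff_isUnit _).1 h₁ |>.map _)
  exact ⟨a, ha, by rwa [← sub_eq_zero, ← map_sub, residue_eq_zero_iff]⟩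

variable {R F : Type*} [CommRing R] [Field F] {A : ValuationSubring F}
  [Algebra R A] [Algebra R F] [IsScalarTower R A F] {W : WeierstrassCurve R} [W.IsElliptic]
  [DecidableEq F]

/-- Over a complete ring every point of the reduction lifts: fix a lift of one coordinate and solve
for the other by Newton approximation, according to which partial derivative does not vanish. -/
theorem reductionHom_surjective [IsAdicComplete (maximalIdeal A) A] :
    Function.Surjective (reductionHom A W (F := F)) := by
  have : (W⁄F).IsElliptic := inferInstanceAs (W.map (algebraMap R F)).IsElliptic
  suffices H : ∀ (x y : ResidueField A) (h : (W⁄(ResidueField A)).toAffine.Nonsingular x y),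
      ∃ X Y : A, residue A X = x ∧ residue A Y = y ∧ (W⁄A).toAffine.Equation X Y by
    rintro (_ | ⟨x, y, h⟩)
    · exact ⟨0, map_zero _⟩
    · obtain ⟨X, Y, hX, hY, e⟩ := H x y h
      have ns : (W⁄F).toAffine.Nonsingular (X : F) Y :=
        (equation_iff_nonsingular (W := W⁄F)).1 (equation_coe_iff.2 e)
      exact ⟨.some _ _ ns, reductionFun_of_eq ns rfl rfl h hX hY⟩
  intro x y h
  obtain ⟨x₀, rfl⟩ := residue_surjective x
  obtain ⟨y₀, rfl⟩ := residue_surjective y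
  obtain ⟨e, ns⟩ := (nonsingular_iff (W := (W⁄(ResidueField A)).toAffine) _ _).1 h
  rw [equation_iff, residue_a₁, residue_a₂, residue_a₃, residue_a₄, residue_a₆] at e
  rw [residue_a₁, residue_a₂, residue_a₃, residue_a₄] at ns
  simp only [equation_iff]
  generalize (W⁄A).a₁ = b₁ at *
  generalize (W⁄A).a₂ = b₂ at *
  generalize (W⁄A).a₃ = b₃ at *
  generalize (W⁄A).a₄ = b₄ at *
  generalize (W⁄A).a₆ = b₆ at *
  rcases ns with ns | ns
  · obtain ⟨c, hc⟩ : ∃ c, c = b₄ - b₁ * y₀ := ⟨_, rfl⟩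
    obtain ⟨d, hd⟩ : ∃ d, d = b₆ - y₀ ^ 2 - b₃ * y₀ := ⟨_, rfl⟩
    have hc' := congrArg (residue A) hc
    have hd' := congrArg (residue A) hd
    simp only [map_sub, map_mul, map_pow] at hc' hd'
    obtain ⟨X₁, hX₁, hX₁'⟩ := exists_root_of_residue_root (a₀ := x₀)
      (f := X ^ 3 + C b₂ * X ^ 2 + C c * X + C d) (by monicity!)
      (by
        simp only [eval_add, eval_mul, eval_C, eval_pow, eval_X, map_add, map_mul, map_pow]
        linear_combination -e + residue A x₀ * hc' + hd')
      (by
        simp only [derivative_X_pow, derivative_C_mul, derivative_C, derivative_X,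
          eval_add, eval_mul, eval_C, eval_pow, eval_X, eval_one, eval_zero, eval_natCast, map_add,
          map_mul, map_pow, map_one, map_zero, map_natCast]
        push_cast
        exact fun h => ns (by linear_combination hc' - h))
    refine ⟨X₁, y₀, hX₁', rfl, ?_⟩
    simp only [eval_add, eval_mul, eval_C, eval_pow, eval_X] at hX₁
    linear_combination -hX₁ + X₁ * hc + hd
  · obtain ⟨c, hc⟩ : ∃ c, c = b₁ * x₀ + b₃ := ⟨_, rfl⟩
    obtain ⟨d, hd⟩ : ∃ d, d = x₀ ^ 3 + b₂ * x₀ ^ 2 + b₄ * x₀ + b₆ := ⟨_, rfl⟩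
    have hc' := congrArg (residue A) hc
    have hd' := congrArg (residue A) hd
    simp only [map_add, map_mul, map_pow] at hc' hd'
    obtain ⟨Y₁, hY₁, hY₁'⟩ := exists_root_of_residue_root (a₀ := y₀)
      (f := X ^ 2 + C c * X - C d) (by monicity!)
      (by
        simp only [eval_add, eval_sub, eval_mul, eval_C, eval_pow, eval_X, map_add, map_sub,
          map_mul, map_pow]
        linear_combination e + residue A y₀ * hc' - hd')
      (by
        simp only [derivative_X_pow, derivative_C_mul, derivative_C,
          derivative_X, eval_add, eval_sub, eval_mul, eval_C, eval_pow, eval_X, eval_one, eval_zero,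
          eval_natCast, map_add, map_sub, map_mul, map_pow, map_one, map_zero, map_natCast]
        push_cast
        exact fun h => ns (by linear_combination h - hc'))
    refine ⟨x₀, Y₁, rfl, hY₁', ?_⟩
    simp only [eval_add, eval_sub, eval_mul, eval_C, eval_pow, eval_X] at hY₁
    linear_combination hY₁ - Y₁ * hc + hd

end Lifting

/-! ### Functoriality of the reduction map -/

section ReductionFunctoriality

open WeierstrassCurve WeierstrassCurve.Affine IsLocalRing

variable {R F : Type*} [CommRing R] [Field F] {A : ValuationSubring F}
  [Algebra R A] [Algebra R F] [IsScalarTower R A F] {W : WeierstrassCurve R} [W.IsElliptic]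
  [DecidableEq F]

theorem mem_kernelOfReduction_iff_reductionHom {P : (W⁄F).toAffine.Point} :
    P ∈ kernelOfReduction A W ↔ reductionHom A W P = 0 :=
  reductionFun_eq_zero_iff.symm

open scoped Classical in
/-- An automorphism `f` of `F` that preserves `A` acts on the reduction of a point through the map
`g` that it induces on the residue field. -/
theorem reductionHom_map {S S' : Type*} [CommRing S] [Algebra R S] [Algebra S F]
    [IsScalarTower R S F] [CommRing S'] [Algebra R S'] [Algebra S' (ResidueField A)]
    [IsScalarTower R S' (ResidueField A)] (f : F →ₐ[S] F)
    (g : ResidueField A →ₐ[S'] ResidueField A) (hA : ∀ x : F, f x ∈ A ↔ x ∈ A)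
    (hg : ∀ x : A, residue A ⟨f x, (hA x).2 x.2⟩ = g (residue A x)) (P : (W⁄F).toAffine.Point) :
    reductionHom A W (Point.map (W' := W) (S := S) f P) =
      Point.map (W' := W) (S := S') g (reductionHom A W P) := by
  by_cases hP : P ∈ kernelOfReduction A W
  · rw [mem_kernelOfReduction_iff_reductionHom.1 hP, map_zero,
      ← mem_kernelOfReduction_iff_reductionHom]
    cases P with
    | zero => exact zero_mem _
    | some x y h =>
      rw [some_mem_kernelOfReduction] at hP
      exact some_mem_kernelOfReduction.2 fun hx => hP ((hA x).1 hx)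
  · obtain ⟨x, y, h, rfl⟩ := exists_eq_some_of_notMem_kernel hP
    have h1 : reductionHom A W (.some _ _ h) = .some _ _ (nonsingular_residue h) :=
      reductionFun_coe h
    rw [h1]
    exact reductionFun_of_eq (A := A) (X := ⟨f x, (hA x).2 x.2⟩) (Y := ⟨f y, (hA y).2 y.2⟩)
      ((WeierstrassCurve.Affine.baseChange_nonsingular W f.injective _ _).mpr h) rfl rfl
      ((WeierstrassCurve.Affine.baseChange_nonsingular W g.injective _ _).mpr
        (nonsingular_residue h)) (hg x) (hg y)

end ReductionFunctoriality

/-! ### Lang's theorem for elliptic curves over finite fields -/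

section Lang

open WeierstrassCurve WeierstrassCurve.Affine Polynomial

variable {k : Type*} [Field k] [Fintype k] (W : WeierstrassCurve k)

/-- The cubic polynomial on the right-hand side of a Weierstrass equation. -/
noncomputable def rhsPoly : k[X] := X ^ 3 + C W.a₂ * X ^ 2 + C W.a₄ * X + C W.a₆

/-- The polynomial `-(a₁ X + a₃)`: the sum of the two ordinates over a given abscissa. -/
noncomputable def tracePoly : k[X] := -(C W.a₁ * X + C W.a₃)

omit [Fintype k] in
theorem equation_baseChange_iff {K : Type*} [Field K] [Algebra k K] {x y : K} :
    (W⁄K).toAffine.Equation x y ↔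
      y ^ 2 = aeval x (tracePoly W) * y + aeval x (rhsPoly W) := by
  rw [equation_iff]
  simp only [rhsPoly, tracePoly, map_add, map_mul, map_neg, map_pow, aeval_X, aeval_C]
  change y ^ 2 + algebraMap k K W.a₁ * x * y + algebraMap k K W.a₃ * y = x ^ 3 +
    algebraMap k K W.a₂ * x ^ 2 + algebraMap k K W.a₄ * x + algebraMap k K W.a₆ ↔ _
  constructor <;> intro h <;> linear_combination h

omit [Fintype k] in
theorem natDegree_rhsPoly : (rhsPoly W).natDegree = 3 := by
  rw [rhsPoly, ← one_mul (X ^ 3), ← C_1]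
  exact natDegree_cubic one_ne_zero

omit [Fintype k] in
theorem natDegree_tracePoly_le : (tracePoly W).natDegree ≤ 1 := by
  rw [tracePoly, natDegree_neg]
  exact natDegree_linear_le

/-- The `q`-power Frobenius on ordinates, written as a linear polynomial in `y`. The degree bounds
come from the norm of the coordinate ring over the polynomial ring. -/
theorem exists_frobenius_ordinate : ∃ U V : k[X],
    2 * U.natDegree ≤ 3 * Fintype.card k ∧ (V ≠ 0 → 2 * V.natDegree + 3 ≤ 3 * Fintype.card k) ∧
    ∀ (K : Type _) [Field K] [Algebra k K] (x y : K), (W⁄K).toAffine.Equation x y →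
      y ^ Fintype.card k = aeval x U + aeval x V * y := by
  obtain ⟨U, V, h⟩ := CoordinateRing.exists_smul_basis_eq
    (CoordinateRing.mk W.toAffine X ^ Fintype.card k)
  refine ⟨U, V, ?_⟩
  have hdeg : (Algebra.norm k[X] (U • 1 + V • CoordinateRing.mk W.toAffine X)).degree =
      ((3 * Fintype.card k : ℕ) : WithBot ℕ) := by
    have h1 := CoordinateRing.degree_norm_smul_basis (W' := W.toAffine) 0 1
    rw [h, map_pow, degree_pow]
    rw [zero_smul, zero_add, one_smul] at h1
    rw [h1]
    simp [mul_comm]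
  rw [CoordinateRing.degree_norm_smul_basis] at hdeg
  refine ⟨?_, ?_, ?_⟩
  · by_cases hU : U = 0
    · simp [hU]
    · have := le_max_left (2 • U.degree) (2 • V.degree + 3)
      rw [hdeg, degree_eq_natDegree hU] at this
      rw [nsmul_eq_mul] at this
      exact_mod_cast this
  · intro hV
    have := le_max_right (2 • U.degree) (2 • V.degree + 3)
    rw [hdeg, degree_eq_natDegree hV] at this
    rw [nsmul_eq_mul] at this
    exact_mod_cast this
  · intro K _ _ x y e
    rw [← sub_eq_zero, CoordinateRing.smul, CoordinateRing.smul, mul_one, ← map_mul, ← map_add,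
      ← map_pow, ← map_sub, AdjoinRoot.mk_eq_zero] at h
    obtain ⟨g, hg⟩ := h
    have := congrArg (eval₂RingHom (aeval (R := k) x).toRingHom y) hg
    rw [map_mul] at this
    have h0 : eval₂RingHom (aeval (R := k) x).toRingHom y W.toAffine.polynomial = 0 := by
      rw [equation_baseChange_iff] at e
      simp only [rhsPoly, tracePoly, map_neg] at e
      simp only [WeierstrassCurve.Affine.polynomial, coe_eval₂RingHom, eval₂_add, eval₂_sub,
        eval₂_mul, eval₂_pow, eval₂_X, eval₂_C]
      change y ^ 2 + aeval x _ * y - aeval x _ = 0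
      linear_combination e
    rw [h0, zero_mul] at this
    simp only [coe_eval₂RingHom, eval₂_add, eval₂_sub, eval₂_mul, eval₂_pow, eval₂_X,
      eval₂_C] at this
    change aeval x U + aeval x V * y - y ^ Fintype.card k = 0 at this
    linear_combination -this

end Lang

section Lang

open WeierstrassCurve WeierstrassCurve.Affine Polynomial

variable {k : Type*} [Field k] [Fintype k] (W : WeierstrassCurve k)
  (K : Type*) [Field K] [Algebra k K] [IsAlgClosed K]

omit [Fintype k] in
variable {K} in
theorem exists_ordinate (x : K) : ∃ y, (W⁄K).toAffine.Equation x y := by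
  obtain ⟨y, hy⟩ := IsAlgClosed.exists_root
    (C 1 * X ^ 2 + C (-aeval x (tracePoly W)) * X + C (-aeval x (rhsPoly W)) : K[X])
    (by rw [degree_quadratic one_ne_zero]; decide)
  refine ⟨y, (equation_baseChange_iff W).2 ?_⟩
  simp only [IsRoot, eval_add, eval_mul, eval_C, eval_pow, eval_X] at hy
  linear_combination hy

theorem aeval_pow_card {K : Type*} [Field K] [Algebra k K] (f : k[X]) (x : K) :
    aeval (x ^ Fintype.card k) f = aeval x f ^ Fintype.card k := by
  rw [← map_pow, ← FiniteField.expand_card, expand_aeval]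

/-- The abscissa of `φ(P) - P` is `N(x) / (x ^ q - x) ^ 2` with `N` of degree `2 q + 1`. -/
theorem exists_lang_numerator : ∃ N : k[X], N.natDegree = 2 * Fintype.card k + 1 ∧
    ∀ x y : K, (W⁄K).toAffine.Equation x y → aeval x N =
      (y ^ Fintype.card k - (W⁄K).toAffine.negY x y) ^ 2 +
        (W⁄K).a₁ * (y ^ Fintype.card k - (W⁄K).toAffine.negY x y) * (x ^ Fintype.card k - x) -
        ((W⁄K).a₂ + x + x ^ Fintype.card k) * (x ^ Fintype.card k - x) ^ 2 := by
  obtain ⟨U, V, hU, hV, hUV⟩ := exists_frobenius_ordinate W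
  have hUV := hUV K
  have hq : 2 ≤ Fintype.card k := Fintype.one_lt_card
  have hf := natDegree_rhsPoly W
  have ht := natDegree_tracePoly_le W
  have hE := fun x y : K => equation_baseChange_iff W (x := x) (y := y)
  have hneg : ∀ x y : K, (W⁄K).toAffine.negY x y = aeval x (tracePoly W) - y := by
    intro x y
    simp only [negY, tracePoly, map_neg, map_add, map_mul, aeval_X, aeval_C]
    change -y - algebraMap k K W.a₁ * x - algebraMap k K W.a₃ = _
    ring
  have hpow : ∀ f : k[X], ∀ x : K, aeval (x ^ Fintype.card k) f = aeval x f ^ Fintype.card k :=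
    fun f x => aeval_pow_card f x
  have hfq : rhsPoly W ^ Fintype.card k = X ^ (3 * Fintype.card k) +
      C W.a₂ * X ^ (2 * Fintype.card k) + C W.a₄ * X ^ Fintype.card k + C W.a₆ := by
    rw [← FiniteField.expand_card, rhsPoly]
    simp [pow_mul']
  have hfdef : rhsPoly W = X ^ 3 + C W.a₂ * X ^ 2 + C W.a₄ * X + C W.a₆ := rfl
  set q := Fintype.card k
  set f := rhsPoly W
  set t := tracePoly W
  -- The two ordinates over `x` are conjugate, so the trace of `Y ^ q` is the trace of `U + V Y`.
  have htr : ∀ x : K, 2 * aeval x U + aeval x V * aeval x t = aeval x t ^ q := by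
    intro x
    obtain ⟨y, hy⟩ := exists_ordinate W x
    have hy' : (W⁄K).toAffine.Equation x (aeval x t - y) := by
      rw [← hneg]; exact (equation_neg (W' := (W⁄K).toAffine) x y).2 hy
    have h1 := hUV x y hy
    have h2 := hUV x _ hy'
    obtain ⟨P, _⟩ := CharP.exists K
    have hadd : y ^ q + (aeval x t - y) ^ q = (aeval x t) ^ q := by
      have := map_add (FiniteField.frobeniusAlgHom k K) y (aeval x t - y)
      rw [FiniteField.coe_frobeniusAlgHom] at this
      simpa using this.symm
    rw [← hadd, h1, h2]
    ring
  refine ⟨f ^ q + f - U * t + 2 * V * f + t * t ^ q - (C W.a₂ + X + X ^ q) * (X ^ q - X) ^ 2,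
    ?_, ?_⟩
  · have : f ^ q + f - U * t + 2 * V * f + t * t ^ q - (C W.a₂ + X + X ^ q) * (X ^ q - X) ^ 2 =
      X ^ (2 * q + 1) + (C W.a₂ * X ^ (2 * q) + C W.a₄ * X ^ q + C W.a₆ +
        (C W.a₂ * X ^ 2 + C W.a₄ * X + C W.a₆) - U * t + 2 * V * f + t * t ^ q -
        C W.a₂ * (X ^ q - X) ^ 2 + X ^ (q + 2)) := by
      rw [hfq]
      nth_rw 1 [hfdef]
      ring
    rw [this]
    rw [natDegree_add_eq_left_of_natDegree_lt, natDegree_X_pow]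
    rw [natDegree_X_pow, Nat.lt_succ_iff]
    have hUt : (U * t).natDegree ≤ 2 * q := natDegree_mul_le.trans (by omega)
    have hVf : (2 * V * f).natDegree ≤ 2 * q := by
      by_cases hV0 : V = 0
      · simp [hV0]
      · have := hV hV0
        have h2 : (2 * V).natDegree ≤ V.natDegree := by
          rw [two_mul]; exact natDegree_add_le_of_degree_le le_rfl le_rfl
        exact natDegree_mul_le.trans (by omega)
    have htt : (t * t ^ q).natDegree ≤ 2 * q := by
      refine natDegree_mul_le.trans ((add_le_add le_rfl natDegree_pow_le).trans ?_)
      calc t.natDegree + q * t.natDegree ≤ 1 + q * 1 := by gcongr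
        _ ≤ _ := by omega
    have hXX : (X ^ q - X : k[X]).natDegree ≤ q :=
      (natDegree_sub_le _ _).trans (by simp; omega)
    have hB : (C W.a₂ * (X ^ q - X) ^ 2).natDegree ≤ 2 * q :=
      (natDegree_C_mul_le _ _).trans (natDegree_pow_le.trans (by omega))
    have hX : ∀ (c : k) (m : ℕ), m ≤ 2 * q → (C c * X ^ m).natDegree ≤ 2 * q :=
      fun c m hm => (natDegree_C_mul_X_pow_le c m).trans hm
    have hC : ∀ c : k, (C c).natDegree ≤ 2 * q := fun c => by simp
    have hX1 := hX W.a₄ 1 (by omega)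
    rw [pow_one] at hX1
    have hXq : (X ^ (q + 2) : k[X]).natDegree ≤ 2 * q := by rw [natDegree_X_pow]; omega
    have add {a b : k[X]} (ha : a.natDegree ≤ 2 * q) (hb : b.natDegree ≤ 2 * q) :
      (a + b).natDegree ≤ 2 * q := natDegree_add_le_of_degree_le ha hb
    have sub {a b : k[X]} (ha : a.natDegree ≤ 2 * q) (hb : b.natDegree ≤ 2 * q) :
      (a - b).natDegree ≤ 2 * q := (natDegree_sub_le a b).trans (max_le ha hb)
    exact add (sub (add (add (sub (add (add (add (hX _ _ le_rfl) (hX _ _ (by omega))) (hC _))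
      (add (add (hX _ _ (by omega)) hX1) (hC _))) hUt) hVf) htt) hB) hXq
  · intro x y e
    have e1 := hE x y |>.1 e
    have e2 : (y ^ q) ^ 2 = aeval x t ^ q * y ^ q + aeval x f ^ q := by
      have := congrArg (FiniteField.frobeniusAlgHom k K) e1
      rw [map_add, map_mul, map_pow] at this
      simpa only [FiniteField.coe_frobeniusAlgHom] using this
    have e3 := hUV x y e
    have e4 := htr x
    have ht1 : (W⁄K).a₁ * (x ^ q - x) = aeval x t - aeval x t ^ q := by
      rw [← hpow]
      simp only [t, tracePoly, map_neg, map_add, map_mul, aeval_X, aeval_C]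
      change algebraMap k K W.a₁ * _ = _
      ring
    have ha2 : (W⁄K).a₂ = algebraMap k K W.a₂ := rfl
    rw [hneg, ha2]
    simp only [map_add, map_sub, map_mul, map_pow, aeval_X, aeval_C, map_ofNat]
    generalize aeval x t = T at *
    generalize aeval x t ^ q = T' at *
    generalize aeval x f ^ q = F' at *
    generalize aeval x f = F at *
    generalize y ^ q = Y at *
    generalize aeval x U = u at *
    generalize aeval x V = w at *
    generalize x ^ q = x' at *
    linear_combination -e2 - e1 - (2 * y - T) * e3 - 2 * w * e1 - y * e4 - (Y - (T - y)) * ht1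

end Lang

section Lang

open WeierstrassCurve WeierstrassCurve.Affine Polynomial

/-- A subgroup with finite complement in an infinite group is the whole group. -/
theorem _root_.AddSubgroup.eq_top_of_finite_compl {G : Type*} [AddGroup G] [Infinite G]
    {H : AddSubgroup G} (h : (H : Set G)ᶜ.Finite) : H = ⊤ := by
  by_contra hH
  obtain ⟨g, hg⟩ : ∃ g, g ∉ H := by
    by_contra! hc
    exact hH (eq_top_iff.2 fun x _ => hc x)
  have hHfin : (H : Set G).Finite := by
    refine Set.Finite.of_finite_image (f := fun x => g + x) (h.subset ?_)
      (add_right_injective g).injOn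
    rintro _ ⟨x, hx, rfl⟩ hgx
    exact hg ((H.add_mem_cancel_right hx).1 hgx)
  refine Set.infinite_univ (α := G) ?_
  rw [← Set.union_compl_self (H : Set G)]
  exact hHfin.union h

variable {k : Type*} [Field k] [Fintype k] (W : WeierstrassCurve k) [W.IsElliptic]
  (K : Type*) [Field K] [Algebra k K] [IsAlgClosed K]

/-- For all but finitely many `a`, the polynomial `N - a (X ^ q - X) ^ 2` has a root which is not
rational over `k`: it has `2 q + 1` roots, so otherwise one of the `q` elements of `k` would be a
triple root, and it could be so for only one value of `a`. -/
theorem finite_setOf_forall_root_rational {N : k[X]} (hN : N.natDegree = 2 * Fintype.card k + 1) :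
    {a : K | ∀ c : K, aeval c N = a * (c ^ Fintype.card k - c) ^ 2 →
      c ∈ Set.range (algebraMap k K)}.Finite := by
  classical
  set q := Fintype.card k with hqdef
  have hq : 2 ≤ q := Fintype.one_lt_card
  let B : K[X] := (X ^ q - X) ^ 2
  have hBdeg : B.natDegree = 2 * q := by
    rw [natDegree_pow, FiniteField.X_pow_card_sub_X_natDegree_eq K hq]
  let Na : K → K[X] := fun a => N.map (algebraMap k K) - C a * B
  have hNdeg : ∀ a, (Na a).natDegree = 2 * q + 1 := by
    intro a
    have h1 : (N.map (algebraMap k K)).natDegree = 2 * q + 1 := by rw [natDegree_map, hN]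
    rw [natDegree_sub_eq_left_of_natDegree_lt, h1]
    rw [h1]
    exact (natDegree_C_mul_le _ _).trans_lt (by omega)
  have hN0 : ∀ a, Na a ≠ 0 := fun a h => by
    have := hNdeg a
    rw [h] at this
    simp at this
  have hroot : ∀ a c, c ∈ (Na a).roots ↔ aeval c N = a * (c ^ q - c) ^ 2 := by
    intro a c
    rw [mem_roots (hN0 a), IsRoot, ← sub_eq_zero (a := aeval c N)]
    simp [Na, B, aeval_def, eval_map]
  have htriple : ∀ a : K, (∀ c : K, aeval c N = a * (c ^ q - c) ^ 2 →
      c ∈ Set.range (algebraMap k K)) → ∃ c : k, (X - C (algebraMap k K c)) ^ 3 ∣ Na a := by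
    intro a ha
    by_contra! hc
    have hcount : ∀ c : k, (Na a).roots.count (algebraMap k K c) ≤ 2 := by
      intro c
      rw [count_roots]
      by_contra! h
      exact hc c ((le_rootMultiplicity_iff (hN0 a)).1 h)
    have hcard : (Na a).roots.card = 2 * q + 1 := by
      rw [← (IsAlgClosed.splits (Na a)).natDegree_eq_card_roots, hNdeg]
    have hsub : ∀ c ∈ (Na a).roots,
        c ∈ Finset.univ.map ⟨algebraMap k K, (algebraMap k K).injective⟩ := by
      intro c hc'
      obtain ⟨d, hd⟩ := ha c ((hroot a c).1 hc')
      simp [← hd]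
    have := Multiset.sum_count_eq_card hsub
    rw [Finset.sum_map] at this
    have h2 : ∑ c : k, (Na a).roots.count (algebraMap k K c) ≤ ∑ c : k, 2 :=
      Finset.sum_le_sum fun c _ => hcount c
    simp only [Finset.sum_const, Finset.card_univ, smul_eq_mul, ← hqdef] at h2
    simp only [Function.Embedding.coeFn_mk] at this
    omega
  choose! c hc using htriple
  -- Two values of `a` with the same triple root would make it a triple root of `(X ^ q - X) ^ 2`.
  refine Set.Finite.of_injOn (f := c) (t := Set.univ) (fun _ _ => Set.mem_univ _) ?_ Set.finite_univ
  intro a ha b hb hab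
  by_contra hne
  have h1 : (X - C (algebraMap k K (c a))) ^ 3 ∣ C (b - a) * B := by
    have := dvd_sub (hc a ha) (hab ▸ hc b hb)
    convert this using 1
    simp only [Na, C_sub]; ring
  have h2 : (X - C (algebraMap k K (c a))) ^ 3 ∣ B :=
    (IsUnit.dvd_mul_left (isUnit_C.2 (sub_ne_zero.2 (Ne.symm hne)).isUnit)).1 h1
  have hsep : (X ^ q - X : K[X]).Separable := by
    obtain ⟨P, hP⟩ := CharP.exists k
    have : CharP K P := charP_of_injective_algebraMap (algebraMap k K).injective P
    obtain ⟨n, hp, hn⟩ := FiniteField.card k P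
    exact galois_poly_separable P q (by rw [hqdef, hn]; exact dvd_pow_self _ n.ne_zero)
  have h3 : rootMultiplicity (algebraMap k K (c a)) (X ^ q - X) ≤ 1 :=
    rootMultiplicity_le_one_of_separable hsep _
  have hne0 : (X ^ q - X : K[X]) ≠ 0 := FiniteField.X_pow_card_sub_X_ne_zero K hq
  have h4 : 3 ≤ rootMultiplicity (algebraMap k K (c a)) B :=
    (le_rootMultiplicity_iff (pow_ne_zero 2 hne0)).2 h2
  have h5 : rootMultiplicity (algebraMap k K (c a)) B =
      2 * rootMultiplicity (algebraMap k K (c a)) (X ^ q - X) := by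
    rw [← count_roots, ← count_roots, roots_pow, Multiset.count_nsmul]
  omega

omit [IsAlgClosed K] in
/-- The elements fixed by Frobenius are the rational ones. -/
theorem mem_range_algebraMap_of_pow_card {c : K} (h : c ^ Fintype.card k = c) :
    c ∈ Set.range (algebraMap k K) := by
  classical
  set q := Fintype.card k
  have hroots : (X ^ q - X : K[X]).roots = (Finset.univ.val : Multiset k).map (algebraMap k K) := by
    rw [← FiniteField.roots_X_pow_card_sub_X k]
    have h0 := roots_map_of_injective_of_card_eq_natDegree (p := (X ^ q - X : k[X]))
      (algebraMap k K).injective (by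
        rw [FiniteField.roots_X_pow_card_sub_X,
          FiniteField.X_pow_card_sub_X_natDegree_eq k Fintype.one_lt_card]; rfl)
    rw [h0]; simp
  have : c ∈ (X ^ q - X : K[X]).roots := by
    rw [mem_roots (FiniteField.X_pow_card_sub_X_ne_zero K Fintype.one_lt_card)]
    simpa [sub_eq_zero] using h
  rw [hroots] at this
  simpa using this

variable [DecidableEq K]

/-- Lang's theorem for an elliptic curve over a finite field. For all but finitely many abscissae
`a` there is a point `P = (c, d)` with `c` not rational and with `φ(P) - P` of abscissa `a`, so the
image of `φ - 1` has finite complement in an infinite group. -/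
theorem frobenius_sub_one_surjective (Q : (W⁄K).toAffine.Point) :
    ∃ P : (W⁄K).toAffine.Point,
      Point.map (W' := W) (S := k) (FiniteField.frobeniusAlgHom k K) P - P = Q := by
  have hell : (W⁄K).IsElliptic := inferInstanceAs (W.map (algebraMap k K)).IsElliptic
  have hns : ∀ {x y : K}, (W⁄K).toAffine.Equation x y → (W⁄K).toAffine.Nonsingular x y :=
    fun h => (equation_iff_nonsingular (W := W⁄K)).1 h
  obtain ⟨N, hN, hNxy⟩ := exists_lang_numerator W K
  set φ := Point.map (W' := W) (S := k) (FiniteField.frobeniusAlgHom k K)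
  let H : AddSubgroup (W⁄K).toAffine.Point := (φ - AddMonoidHom.id _).range
  suffices h : H = ⊤ by
    have : Q ∈ H := h ▸ AddSubgroup.mem_top Q
    obtain ⟨P, hP⟩ := this
    exact ⟨P, hP⟩
  have hinf : Infinite (W⁄K).toAffine.Point := by
    have : Infinite K := IsAlgClosed.instInfinite
    choose y hy using exists_ordinate W (K := K)
    refine Infinite.of_injective (fun x : K => Point.some x (y x) (hns (hy x))) fun x x' h => ?_
    exact ((Point.some.injEq ..).mp h).1
  apply AddSubgroup.eq_top_of_finite_compl
  set S := {a : K | ∀ c : K, aeval c N = a * (c ^ Fintype.card k - c) ^ 2 →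
      c ∈ Set.range (algebraMap k K)}
  have hS : S.Finite := finite_setOf_forall_root_rational K hN
  have hgood : ∀ (x y : K) (h : (W⁄K).toAffine.Nonsingular x y), x ∉ S →
      Point.some x y h ∈ H := by
    intro x y h hx
    simp only [S, Set.mem_ofPred_eq, not_forall] at hx
    obtain ⟨c, hc, hck⟩ := hx
    have hcq : c ^ Fintype.card k ≠ c := fun h => hck (mem_range_algebraMap_of_pow_card K h)
    obtain ⟨d, hd⟩ := exists_ordinate W c
    let P : (W⁄K).toAffine.Point := .some c d (hns hd)
    have hmem : φ P - P ∈ H := ⟨P, rfl⟩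
    have key : ∃ y' h', φ P - P = .some x y' h' := by
      have ns' : (W⁄K).toAffine.Nonsingular (c ^ Fintype.card k) (d ^ Fintype.card k) :=
        (WeierstrassCurve.Affine.baseChange_nonsingular W
          (FiniteField.frobeniusAlgHom k K).injective c d).mpr (hns hd)
      have h0 : φ P - P = .some _ _ ns' + .some _ _ ((nonsingular_neg c d).2 (hns hd)) := rfl
      rw [h0, Point.add_of_X_ne hcq]
      have hX : (W⁄K).toAffine.addX (c ^ Fintype.card k) c ((W⁄K).toAffine.slope
          (c ^ Fintype.card k) c (d ^ Fintype.card k) ((W⁄K).toAffine.negY c d)) = x := by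
        rw [slope_of_X_ne hcq, addX]
        have h1 := hNxy c d hd
        rw [hc] at h1
        have hne := sub_ne_zero.2 hcq
        field_simp
        linear_combination -h1
      have hex : ∀ x₀, x₀ = x → ∀ (y₀ : K) (h₀ : (W⁄K).toAffine.Nonsingular x₀ y₀),
          ∃ y' h', Point.some x₀ y₀ h₀ = Point.some x y' h' := by
        rintro _ rfl y₀ h₀
        exact ⟨y₀, h₀, rfl⟩
      exact hex _ hX _ _
    obtain ⟨y', h', he⟩ := key
    rw [he] at hmem
    rcases Point.X_eq_iff (h₁ := h) (h₂ := h').1 rfl with h2 | h2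
    · rwa [h2]
    · rw [h2]; exact neg_mem hmem
  refine Set.Finite.subset (s := {P | P = 0} ∪ ⋃ a ∈ S, {P | ∃ y h, P = Point.some a y h}) ?_ ?_
  · refine (Set.finite_singleton _).union (hS.biUnion fun a _ => ?_)
    by_cases hex : ∃ y, (W⁄K).toAffine.Equation a y
    · obtain ⟨y, hy⟩ := hex
      refine Set.Finite.subset (s := {.some a y (hns hy), -.some a y (hns hy)}) (by simp) ?_
      rintro P ⟨y', h', rfl⟩
      exact Point.X_eq_iff.1 rfl
    · refine Set.finite_empty.subset ?_
      rintro P ⟨y', h', rfl⟩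
      exact hex ⟨y', h'.1⟩
  · rintro (_ | ⟨x, y, h⟩) hP
    · exact .inl rfl
    · refine .inr (Set.mem_biUnion (x := x) ?_ ⟨y, h, rfl⟩)
      by_contra hx
      exact hP (hgood x y h hx)

end Lang

/-! ### The isomorphism on points attached to a change of variables -/

section ChangeOfVariables

open WeierstrassCurve WeierstrassCurve.Affine

variable {F : Type*} [Field F] {W₁ W₂ : WeierstrassCurve F} {C : VariableChange F}

theorem equation_variableChange (h : W₁ = C • W₂) (x y : F) :
    W₂.toAffine.Equation (C.u ^ 2 * x + C.r) (C.u ^ 3 * y + C.u ^ 2 * C.s * x + C.t) ↔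
      W₁.toAffine.Equation x y := by
  have hu : (C.u : F) ≠ 0 := C.u.ne_zero
  subst h
  rw [equation_iff', equation_iff']
  simp only [variableChange_a₁, variableChange_a₂, variableChange_a₃, variableChange_a₄,
    variableChange_a₆, Units.val_inv_eq_inv_val]
  refine ⟨fun hh => mul_left_cancel₀ (pow_ne_zero 6 hu) (Eq.trans ?_ (hh.trans (mul_zero _).symm)),
    fun hh => Eq.trans ?_ ((congrArg ((C.u : F) ^ 6 * ·) hh).trans (mul_zero _))⟩
  all_goals
    field_simp
    ring

theorem negY_variableChange (h : W₁ = C • W₂) (x y : F) :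
    W₂.toAffine.negY (C.u ^ 2 * x + C.r) (C.u ^ 3 * y + C.u ^ 2 * C.s * x + C.t) =
      C.u ^ 3 * W₁.toAffine.negY x y + C.u ^ 2 * C.s * x + C.t := by
  have hu : (C.u : F) ≠ 0 := C.u.ne_zero
  subst h
  simp only [negY, variableChange_a₁, variableChange_a₃, Units.val_inv_eq_inv_val]
  field_simp
  ring

theorem slope_variableChange [DecidableEq F] (h : W₁ = C • W₂) {x₁ x₂ y₁ y₂ : F}
    (h₁ : W₁.toAffine.Equation x₁ y₁) (h₂ : W₁.toAffine.Equation x₂ y₂)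
    (hxy : ¬(x₁ = x₂ ∧ y₁ = W₁.toAffine.negY x₂ y₂)) :
    W₂.toAffine.slope (C.u ^ 2 * x₁ + C.r) (C.u ^ 2 * x₂ + C.r)
      (C.u ^ 3 * y₁ + C.u ^ 2 * C.s * x₁ + C.t) (C.u ^ 3 * y₂ + C.u ^ 2 * C.s * x₂ + C.t) =
      C.u * W₁.toAffine.slope x₁ x₂ y₁ y₂ + C.s := by
  have hu : (C.u : F) ≠ 0 := C.u.ne_zero
  by_cases hx : x₁ = x₂
  · subst hx
    have hy : y₁ ≠ W₁.toAffine.negY x₁ y₂ := fun hy => hxy ⟨rfl, hy⟩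
    obtain rfl : y₁ = y₂ := (Y_eq_of_X_eq h₁ h₂ rfl).resolve_right hy
    have hy' : C.u ^ 3 * y₁ + C.u ^ 2 * C.s * x₁ + C.t ≠ W₂.toAffine.negY (C.u ^ 2 * x₁ + C.r)
        (C.u ^ 3 * y₁ + C.u ^ 2 * C.s * x₁ + C.t) := by
      rw [negY_variableChange h]
      intro hh
      refine hy (mul_left_cancel₀ (pow_ne_zero 3 hu) ?_)
      linear_combination hh
    have hd : y₁ - W₁.toAffine.negY x₁ y₁ ≠ 0 := sub_ne_zero.mpr hy
    rw [slope_of_Y_ne rfl hy', slope_of_Y_ne rfl hy, negY_variableChange h]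
    have hd' : (C.u : F) ^ 3 * y₁ + C.u ^ 2 * C.s * x₁ + C.t -
        (C.u ^ 3 * W₁.toAffine.negY x₁ y₁ + C.u ^ 2 * C.s * x₁ + C.t) =
        C.u ^ 3 * (y₁ - W₁.toAffine.negY x₁ y₁) := by ring
    rw [hd', div_eq_iff (mul_ne_zero (pow_ne_zero 3 hu) hd), add_mul,
      show ∀ a b c d : F, a * (b / d) * (c * d) = a * c * b * (d / d) by intros; ring,
      div_self hd]
    subst h
    simp only [negY, variableChange_a₁, variableChange_a₂, variableChange_a₃, variableChange_a₄,
      Units.val_inv_eq_inv_val]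
    field_simp
    ring
  · have hx' : (C.u : F) ^ 2 * x₁ + C.r ≠ C.u ^ 2 * x₂ + C.r := fun hh =>
      hx (mul_left_cancel₀ (pow_ne_zero 2 hu) (add_right_cancel hh))
    have hd : x₁ - x₂ ≠ 0 := sub_ne_zero.mpr hx
    rw [slope_of_X_ne hx', slope_of_X_ne hx, div_eq_iff (sub_ne_zero.mpr hx')]
    field_simp
    ring

variable [W₂.IsElliptic]

/-- The map `(x, y) ↦ (u²x + r, u³y + u²sx + t)` on points attached to the change of variables
`(u, r, s, t)`. -/
def variableChangeFun (h : W₁ = C • W₂) : W₁.toAffine.Point → W₂.toAffine.Point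
  | .zero => 0
  | .some x y hxy => .some (C.u ^ 2 * x + C.r) (C.u ^ 3 * y + C.u ^ 2 * C.s * x + C.t)
      (equation_iff_nonsingular.mp ((equation_variableChange h x y).mpr hxy.1))

theorem variableChangeFun_some (h : W₁ = C • W₂) {x y : F} (hxy : W₁.toAffine.Nonsingular x y) :
    variableChangeFun h (.some x y hxy) =
      .some (C.u ^ 2 * x + C.r) (C.u ^ 3 * y + C.u ^ 2 * C.s * x + C.t)
      (equation_iff_nonsingular.mp ((equation_variableChange h x y).mpr hxy.1)) := rfl

theorem variableChangeFun_add [DecidableEq F] (h : W₁ = C • W₂) (P Q : W₁.toAffine.Point) :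
    variableChangeFun h (P + Q) = variableChangeFun h P + variableChangeFun h Q := by
  have hu : (C.u : F) ≠ 0 := C.u.ne_zero
  cases P with
  | zero => exact (congrArg _ (zero_add Q)).trans (zero_add _).symm
  | some x₁ y₁ h₁ =>
  cases Q with
  | zero => exact (congrArg _ (add_zero _)).trans (add_zero _).symm
  | some x₂ y₂ h₂ =>
  by_cases hxy : x₁ = x₂ ∧ y₁ = W₁.toAffine.negY x₂ y₂
  · rw [Point.add_of_Y_eq hxy.1 hxy.2, variableChangeFun_some, variableChangeFun_some,
      Point.add_of_Y_eq (by rw [hxy.1]) (by rw [negY_variableChange h, hxy.1, hxy.2])]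
    rfl
  · have hxy' : ¬((C.u : F) ^ 2 * x₁ + C.r = C.u ^ 2 * x₂ + C.r ∧
        (C.u : F) ^ 3 * y₁ + C.u ^ 2 * C.s * x₁ + C.t = W₂.toAffine.negY (C.u ^ 2 * x₂ + C.r)
          (C.u ^ 3 * y₂ + C.u ^ 2 * C.s * x₂ + C.t)) := by
      rintro ⟨hx, hy⟩
      have hx' : x₁ = x₂ := mul_left_cancel₀ (pow_ne_zero 2 hu) (add_right_cancel hx)
      subst hx'
      rw [negY_variableChange h] at hy
      refine hxy ⟨rfl, mul_left_cancel₀ (pow_ne_zero 3 hu) ?_⟩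
      linear_combination hy
    rw [Point.add_some hxy, variableChangeFun_some, variableChangeFun_some,
      variableChangeFun_some, Point.add_some hxy', Point.some.injEq,
      slope_variableChange h h₁.1 h₂.1 hxy]
    generalize W₁.toAffine.slope x₁ x₂ y₁ y₂ = l
    subst h
    constructor
    · simp only [addX, variableChange_a₁, variableChange_a₂, Units.val_inv_eq_inv_val]
      field_simp
      ring
    · simp only [addY, negAddY, addX, negY, variableChange_a₁, variableChange_a₂, variableChange_a₃,
        Units.val_inv_eq_inv_val]
      field_simp
      ring

theorem variableChangeFun_bijective (h : W₁ = C • W₂) :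
    Function.Bijective (variableChangeFun h) := by
  have hu : (C.u : F) ≠ 0 := C.u.ne_zero
  have hell : W₁.IsElliptic := by rw [h]; infer_instance
  constructor
  · rintro (_ | ⟨x₁, y₁, h₁⟩) (_ | ⟨x₂, y₂, h₂⟩) hPQ
    · rfl
    · simp [variableChangeFun] at hPQ
    · simp [variableChangeFun] at hPQ
    · rw [variableChangeFun_some, variableChangeFun_some, Point.some.injEq] at hPQ
      have hx : x₁ = x₂ := mul_left_cancel₀ (pow_ne_zero 2 hu) (add_right_cancel hPQ.1)
      subst hx
      have hy : y₁ = y₂ :=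
        mul_left_cancel₀ (pow_ne_zero 3 hu) (add_right_cancel (add_right_cancel hPQ.2))
      subst hy
      rfl
  · rintro (_ | ⟨x, y, hxy⟩)
    · exact ⟨0, rfl⟩
    · have hx : (C.u : F) ^ 2 * ((x - C.r) / C.u ^ 2) + C.r = x := by field_simp; ring
      have hy : (C.u : F) ^ 3 * ((y - C.s * (x - C.r) - C.t) / C.u ^ 3) +
          C.u ^ 2 * C.s * ((x - C.r) / C.u ^ 2) + C.t = y := by field_simp; ring
      refine ⟨.some ((x - C.r) / C.u ^ 2) ((y - C.s * (x - C.r) - C.t) / C.u ^ 3)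
        (equation_iff_nonsingular.mp ((equation_variableChange h _ _).mp ?_)), ?_⟩
      · rw [hx, hy]; exact hxy.1
      · rw [variableChangeFun_some, Point.some.injEq]
        exact ⟨hx, hy⟩

/-- The group isomorphism on points attached to a change of variables. -/
noncomputable def variableChangeEquiv [DecidableEq F] (h : W₁ = C • W₂) :
    W₁.toAffine.Point ≃+ W₂.toAffine.Point :=
  AddEquiv.ofBijective (AddMonoidHom.mk' (variableChangeFun h) (variableChangeFun_add h))
    (variableChangeFun_bijective h)

omit [W₂.IsElliptic] in
/-- Changes of variables over a base `S` commute with the action of `S`-algebra maps. -/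
theorem variableChangeEquiv_map {R₁ R₂ S : Type*} [CommRing R₁] [CommRing R₂] [CommRing S]
    [Algebra R₁ S] [Algebra R₂ S] [Algebra R₁ F] [Algebra R₂ F] [Algebra S F]
    [IsScalarTower R₁ S F] [IsScalarTower R₂ S F] [DecidableEq F] {V₁ : WeierstrassCurve R₁}
    {V₂ : WeierstrassCurve R₂} [(V₂⁄F).IsElliptic] {C : VariableChange S}
    (h : (V₁⁄F) = C.map (algebraMap S F) • (V₂⁄F)) (f : F →ₐ[S] F) (P : (V₁⁄F).toAffine.Point) :
    variableChangeEquiv h (Point.map (W' := V₁) (S := S) f P) =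
      Point.map (W' := V₂) (S := S) f (variableChangeEquiv h P) := by
  cases P with
  | zero => rfl
  | some x y hxy =>
    refine (Point.some.injEq ..).mpr ⟨?_, ?_⟩
    · change algebraMap S F C.u ^ 2 * f x + algebraMap S F C.r =
        f (algebraMap S F C.u ^ 2 * x + algebraMap S F C.r)
      simp
    · change algebraMap S F C.u ^ 3 * f y + algebraMap S F C.u ^ 2 * algebraMap S F C.s * f x +
        algebraMap S F C.t = f (algebraMap S F C.u ^ 3 * y +
        algebraMap S F C.u ^ 2 * algebraMap S F C.s * x + algebraMap S F C.t)
      simp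

theorem baseChange_eq_map_smul {R₁ R₂ S F : Type*} [CommRing R₁] [CommRing R₂] [CommRing S]
    [CommRing F] [Algebra R₁ S] [Algebra R₂ S] [Algebra R₁ F] [Algebra R₂ F] [Algebra S F]
    [IsScalarTower R₁ S F] [IsScalarTower R₂ S F] {V₁ : WeierstrassCurve R₁}
    {V₂ : WeierstrassCurve R₂} {C : VariableChange S} (h : (V₁⁄S) = C • (V₂⁄S)) :
    (V₁⁄F) = C.map (algebraMap S F) • (V₂⁄F) := by
  have h1 : (V₁.map (algebraMap R₁ S)).map (algebraMap S F) =
      (C • V₂.map (algebraMap R₂ S)).map (algebraMap S F) :=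
    congrArg (fun V => WeierstrassCurve.map V (algebraMap S F)) h
  rw [← map_variableChange, WeierstrassCurve.map_map, WeierstrassCurve.map_map,
    ← IsScalarTower.algebraMap_eq, ← IsScalarTower.algebraMap_eq] at h1
  exact h1

end ChangeOfVariables

/-! ### Coboundaries of cyclic groups -/

section Cyclic

variable {M : Type*} [AddCommGroup M]

/-- The telescoping sum `∑_{i < n} f ^ i (f x - x) = f ^ n x - x`. -/
theorem sum_iterate_map_sub (f : M →+ M) (x : M) (n : ℕ) :
    ∑ i ∈ Finset.range n, f^[i] (f x - x) = f^[n] x - x := by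
  induction n with
  | zero => simp
  | succ n ih =>
    rw [Finset.sum_range_succ, ih, iterate_map_sub, ← Function.iterate_succ_apply]
    abel

theorem iterate_map_mem {f : M →+ M} {S : AddSubgroup M} (hf : ∀ x ∈ S, f x ∈ S) {x : M}
    (hx : x ∈ S) (i : ℕ) : f^[i] x ∈ S := by
  induction i generalizing x with
  | zero => exact hx
  | succ i ih => exact ih (hf x hx)

/-- An element of trace zero in a uniquely divisible module is a coboundary. -/
theorem exists_map_sub_eq_of_trace_eq_zero {f : M →+ M} {S : AddSubgroup M}
    (hf : ∀ x ∈ S, f x ∈ S) {n : ℕ} (hdiv : ∀ x ∈ S, ∃ y ∈ S, n • y = x)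
    (htf : ∀ x ∈ S, n • x = 0 → x = 0) {x : M} (hx : x ∈ S)
    (htr : ∑ i ∈ Finset.range n, f^[i] x = 0) : ∃ m ∈ S, f m - m = x := by
  -- `n x = ∑ (x - f ^ i x) = f y - y` for `y = - ∑_{i < n} ∑_{l < i} f ^ l x`.
  let y : M := -∑ i ∈ Finset.range n, ∑ l ∈ Finset.range i, f^[l] x
  have hy : y ∈ S := neg_mem (sum_mem fun i _ => sum_mem fun l _ => iterate_map_mem hf hx l)
  have hfy : f y - y = n • x := by
    have h1 : ∀ i, f (∑ l ∈ Finset.range i, f^[l] x) - ∑ l ∈ Finset.range i, f^[l] x =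
        f^[i] x - x := by
      intro i
      rw [map_sum, ← Finset.sum_sub_distrib, ← sum_iterate_map_sub]
      refine Finset.sum_congr rfl fun l _ => ?_
      rw [iterate_map_sub, ← Function.iterate_succ_apply' (f := f), Function.iterate_succ_apply]
    have h2 : f y - y = -∑ i ∈ Finset.range n, (f^[i] x - x) := by
      simp only [y, map_neg, ← h1, Finset.sum_sub_distrib, map_sum]
      abel
    rw [h2, Finset.sum_sub_distrib, htr]
    simp
  obtain ⟨m, hm, hnm⟩ := hdiv y hy
  refine ⟨m, hm, ?_⟩
  rw [← sub_eq_zero]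
  refine htf _ (sub_mem (sub_mem (hf m hm) hm) hx) ?_
  rw [nsmul_sub, nsmul_sub, ← map_nsmul, hnm, hfy, sub_self]

end Cyclic

section Lang

open WeierstrassCurve WeierstrassCurve.Affine

variable {k k' : Type*} [Field k] [Fintype k] [Field k'] [Fintype k'] [Algebra k k']
  (W : WeierstrassCurve k)

theorem iterate_frobeniusAlgHom {K : Type*} [Field K] [Algebra k K] (n : ℕ) (x : K) :
    (FiniteField.frobeniusAlgHom k K)^[n] x = x ^ Fintype.card k ^ n := by
  rw [FiniteField.coe_frobeniusAlgHom, pow_iterate]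

variable [DecidableEq k']

theorem point_map_iterate {R S K : Type*} [CommRing R] [CommRing S] [Field K] [Algebra R S]
    [Algebra R K] [Algebra S K] [IsScalarTower R S K] (V : WeierstrassCurve R) [DecidableEq K]
    (f : K →ₐ[S] K) (n : ℕ) {x y : K} (h : (V⁄K).toAffine.Nonsingular x y) :
    ∃ h', (Point.map (W' := V) (S := S) f)^[n] (.some x y h) = .some (f^[n] x) (f^[n] y) h' := by
  induction n with
  | zero => exact ⟨h, rfl⟩
  | succ n ih =>
    obtain ⟨h', e⟩ := ih
    simp only [Function.iterate_succ_apply']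
    rw [e]
    exact ⟨(WeierstrassCurve.Affine.baseChange_nonsingular V f.injective _ _).mpr h', rfl⟩

/-- Points with coordinates in `k'` that are fixed by a power of Frobenius descend. -/
theorem exists_of_map_frobenius_iterate_eq {R K : Type*} [CommRing R] (V : WeierstrassCurve R)
    [Field K] [Algebra R k] [Algebra R k'] [Algebra R K] [Algebra k K] [Algebra k' K]
    [IsScalarTower k k' K] [IsScalarTower R k K] [IsScalarTower R k k'] [DecidableEq K] {n : ℕ}
    (hn : Fintype.card k' = Fintype.card k ^ n) {P : (V⁄K).toAffine.Point}
    (hP : (Point.map (W' := V) (S := k) (FiniteField.frobeniusAlgHom k K))^[n] P = P) :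
    ∃ P' : (V⁄k').toAffine.Point,
      Point.map (W' := V) (S := k) (IsScalarTower.toAlgHom k k' K) P' = P := by
  cases P with
  | zero => exact ⟨0, rfl⟩
  | some x y h =>
    obtain ⟨h', e⟩ := point_map_iterate V (FiniteField.frobeniusAlgHom k K) n h
    rw [e] at hP
    obtain ⟨hx, hy⟩ := (Point.some.injEq ..).mp hP
    rw [iterate_frobeniusAlgHom, ← hn] at hx hy
    obtain ⟨x', rfl⟩ := mem_range_algebraMap_of_pow_card K hx
    obtain ⟨y', rfl⟩ := mem_range_algebraMap_of_pow_card K hy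
    exact ⟨.some x' y' ((WeierstrassCurve.Affine.baseChange_nonsingular V
      (IsScalarTower.toAlgHom k k' K).injective x' y').mp h), rfl⟩

/-- A point over a finite extension whose trace vanishes is a Frobenius coboundary. -/
theorem exists_frobenius_sub_eq_of_trace_eq_zero [W.IsElliptic] {n : ℕ}
    (hn : Fintype.card k' = Fintype.card k ^ n) {Q : (W⁄k').toAffine.Point}
    (hQ : ∑ i ∈ Finset.range n,
      (Point.map (W' := W) (S := k) (FiniteField.frobeniusAlgHom k k'))^[i] Q = 0) :
    ∃ P : (W⁄k').toAffine.Point,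
      Point.map (W' := W) (S := k) (FiniteField.frobeniusAlgHom k k') P - P = Q := by
  classical
  let K := AlgebraicClosure k'
  set ι := Point.map (W' := W) (S := k) (IsScalarTower.toAlgHom k k' K)
  set φ' := Point.map (W' := W) (S := k) (FiniteField.frobeniusAlgHom k k')
  set φ := Point.map (W' := W) (S := k) (FiniteField.frobeniusAlgHom k K)
  have hι : Function.Injective ι := Point.map_injective _
  have hφ : ∀ P, φ (ι P) = ι (φ' P) := by
    intro P
    simp only [φ, ι, φ', Point.map_map]
    congr 2
    ext x
    simp
  have hφi : ∀ i P, φ^[i] (ι P) = ι (φ'^[i] P) := fun i P =>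
    ((show Function.Semiconj ι φ' φ from fun P => (hφ P).symm).iterate_right i P).symm
  obtain ⟨P, hP⟩ := frobenius_sub_one_surjective W K (ι Q)
  have hPn : φ^[n] P = P := by
    rw [← sub_eq_zero, ← sum_iterate_map_sub, hP]
    simp only [hφi, ← map_sum, hQ, map_zero]
  obtain ⟨P', rfl⟩ := exists_of_map_frobenius_iterate_eq (k' := k') W hn hPn
  exact ⟨P', hι (by rw [map_sub, ← hφ]; exact hP)⟩

/-- A point over a finite extension whose trace vanishes is a Frobenius coboundary, for a curve
defined over a ring that maps to the fields. -/
theorem exists_frobenius_sub_eq_of_trace_eq_zero_baseChange {R : Type*} [CommRing R]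
    (V : WeierstrassCurve R) [V.IsElliptic] [Algebra R k] [Algebra R k'] [IsScalarTower R k k']
    {n : ℕ} (hn : Fintype.card k' = Fintype.card k ^ n) {Q : (V⁄k').toAffine.Point}
    (hQ : ∑ i ∈ Finset.range n,
      (Point.map (W' := V) (S := k) (FiniteField.frobeniusAlgHom k k'))^[i] Q = 0) :
    ∃ P : (V⁄k').toAffine.Point,
      Point.map (W' := V) (S := k) (FiniteField.frobeniusAlgHom k k') P - P = Q := by
  have : (V⁄k).IsElliptic := inferInstanceAs (V.map (algebraMap R k)).IsElliptic
  have : (V⁄k').IsElliptic := inferInstanceAs (V.map (algebraMap R k')).IsElliptic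
  have h : ((V⁄k)⁄k') = (1 : VariableChange k).map (algebraMap k k') • (V⁄k') := by
    rw [show (1 : VariableChange k).map (algebraMap k k') = 1 from
      (VariableChange.mapHom (algebraMap k k')).map_one, one_smul]
    exact (WeierstrassCurve.map_map V _ _).trans
      (congrArg V.map (IsScalarTower.algebraMap_eq R k k').symm)
  let e := variableChangeEquiv h
  set φ := Point.map (W' := (V⁄k)) (S := k) (FiniteField.frobeniusAlgHom k k')
  set φ' := Point.map (W' := V) (S := k) (FiniteField.frobeniusAlgHom k k')
  have he : ∀ P, e (φ P) = φ' (e P) := variableChangeEquiv_map h _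
  obtain ⟨Q', rfl⟩ := e.surjective Q
  have hei : ∀ i, φ'^[i] (e Q') = e (φ^[i] Q') := fun i =>
    ((show Function.Semiconj e φ φ' from he).iterate_right i Q').symm
  simp only [hei, ← map_sum] at hQ
  obtain ⟨P, hP⟩ := exists_frobenius_sub_eq_of_trace_eq_zero (V⁄k) hn
    ((map_eq_zero_iff e e.injective).mp hQ)
  exact ⟨e P, by rw [← he, ← map_sub, hP]⟩

end Lang

/-! ### Classes that die in a finite Galois extension -/

section Descent

open WeierstrassCurve WeierstrassCurve.Affine

variable {k k' : Type*} [Field k] [Field k'] [Algebra k k']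

local notation "Ω₁" => AlgebraicClosure k
local notation "Ω₂" => AlgebraicClosure k'

theorem closureEmbedding_bijective [Algebra.IsAlgebraic k k'] (j : Ω₁ →ₐ[k] Ω₂) :
    Function.Bijective j := by
  let : Algebra Ω₁ Ω₂ := j.toRingHom.toAlgebra
  have : IsScalarTower k Ω₁ Ω₂ := IsScalarTower.of_algebraMap_eq fun x => (j.commutes x).symm
  have h1 : Algebra.IsAlgebraic k Ω₂ := Algebra.IsAlgebraic.trans k k' Ω₂
  have : Algebra.IsAlgebraic Ω₁ Ω₂ := Algebra.IsAlgebraic.tower_top (K := k) Ω₁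
  exact IsAlgClosed.algebraMap_bijective_of_isIntegral

/-- An extension `k'` of `k` sits inside `k̄` compatibly with a given `k̄ → k̄'`, and if it is normal
then automorphisms of `k̄` restrict to it. -/
theorem exists_embedding_and_restriction [Normal k k'] (j : Ω₁ →ₐ[k] Ω₂) :
    ∃ (ι : k' →ₐ[k] Ω₁) (r : (Ω₁ ≃ₐ[k] Ω₁) →* (k' ≃ₐ[k] k')),
      (∀ x, j (ι x) = algebraMap k' Ω₂ x) ∧ Function.Surjective r ∧
        ∀ (g : Ω₁ ≃ₐ[k] Ω₁) (x : k'), ι (r g x) = g (ι x) := by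
  let e : Ω₁ ≃ₐ[k] Ω₂ := AlgEquiv.ofBijective j (closureEmbedding_bijective j)
  let ι : k' →ₐ[k] Ω₁ := (e.symm : Ω₂ →ₐ[k] Ω₁).comp (IsScalarTower.toAlgHom k k' Ω₂)
  let : Algebra k' Ω₁ := ι.toRingHom.toAlgebra
  have : IsScalarTower k k' Ω₁ := IsScalarTower.of_algebraMap_eq fun x => (ι.commutes x).symm
  refine ⟨ι, AlgEquiv.restrictNormalHom k', fun x => ?_,
    AlgEquiv.restrictNormalHom_surjective Ω₁, fun g x => AlgEquiv.restrictNormal_commutes g k' x⟩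
  exact e.apply_symm_apply _

/-- The field cut out by the kernel of the restriction `r` to `k'` is `k'` itself. -/
theorem mem_range_of_forall_fixed {ι : k' →ₐ[k] Ω₁}
    {r : (Ω₁ ≃ₐ[k] Ω₁) →* (k' ≃ₐ[k] k')} [CharZero k]
    (hr : ∀ (g : Ω₁ ≃ₐ[k] Ω₁) (x : k'), ι (r g x) = g (ι x)) {x : Ω₁}
    (hx : ∀ g : Ω₁ ≃ₐ[k] Ω₁, r g = 1 → g x = x) : x ∈ Set.range ι := by
  have : IsGalois k Ω₁ := ⟨⟩
  have h : x ∈ IntermediateField.fixedField ι.fieldRange.fixingSubgroup := by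
    rw [IntermediateField.mem_fixedField_iff]
    intro g hg
    refine hx g (AlgEquiv.ext fun y => ι.injective ?_)
    refine (hr g y).trans ?_
    exact (IntermediateField.mem_fixingSubgroup_iff _ _).1 hg _ ⟨y, rfl⟩
  rw [InfiniteGalois.fixedField_fixingSubgroup] at h
  exact h

variable {F : Type*} [Field F] {E : WeierstrassCurve F} [Algebra F k] [Algebra F k']
  [IsScalarTower F k k']

instance isScalarTower_algebraicClosure : IsScalarTower F k Ω₂ :=
  IsScalarTower.of_algebraMap_eq fun x => by
    rw [IsScalarTower.algebraMap_apply F k' Ω₂, IsScalarTower.algebraMap_apply F k k',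
      ← IsScalarTower.algebraMap_apply k k']

open scoped Classical in
theorem geomPoints_smul_def (g : Ω₁ ≃ₐ[k] Ω₁) (P : geomPoints E k) :
    g • P = Point.map (W' := E) (S := k) g.toAlgHom P := rfl

open scoped Classical in
theorem geomPoints_smul_map {ι : k' →ₐ[k] Ω₁}
    {r : (Ω₁ ≃ₐ[k] Ω₁) →* (k' ≃ₐ[k] k')}
    (hr : ∀ (g : Ω₁ ≃ₐ[k] Ω₁) (x : k'), ι (r g x) = g (ι x)) (g : Ω₁ ≃ₐ[k] Ω₁)
    (b : (E⁄k').toAffine.Point) : (g • (Point.map (W' := E) (S := k) ι b : geomPoints E k)) =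
      Point.map (W' := E) (S := k) ι (Point.map (W' := E) (S := k) (r g).toAlgHom b) := by
  rw [geomPoints_smul_def, Point.map_map, Point.map_map]
  congr 2
  ext x
  exact (hr g x).symm

open scoped Classical in
/-- Points fixed by the automorphisms that restrict trivially to `k'` are defined over `k'`. -/
theorem exists_map_eq_of_forall_fixed {ι : k' →ₐ[k] Ω₁}
    {r : (Ω₁ ≃ₐ[k] Ω₁) →* (k' ≃ₐ[k] k')} [CharZero k]
    (hr : ∀ (g : Ω₁ ≃ₐ[k] Ω₁) (x : k'), ι (r g x) = g (ι x))
    {a : geomPoints E k} (ha : ∀ g : Ω₁ ≃ₐ[k] Ω₁, r g = 1 → g • a = a) :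
    ∃ b : (E⁄k').toAffine.Point, Point.map (W' := E) (S := k) ι b = a := by
  cases a with
  | zero => exact ⟨0, rfl⟩
  | some x y h =>
    have h1 : ∀ g : Ω₁ ≃ₐ[k] Ω₁, r g = 1 → g x = x ∧ g y = y := fun g hg =>
      (Point.some.injEq ..).mp (ha g hg)
    obtain ⟨x', rfl⟩ := mem_range_of_forall_fixed hr fun g hg => (h1 g hg).1
    obtain ⟨y', rfl⟩ := mem_range_of_forall_fixed hr fun g hg => (h1 g hg).2
    exact ⟨.some x' y' ((WeierstrassCurve.Affine.baseChange_nonsingular E ι.injective x' y').mp h),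
      rfl⟩

open scoped Classical in
/-- A cocycle whose class dies over `k'` is a coboundary on the elements that fix `k'`. -/
theorem exists_coboundary_of_galH1Res_eq_zero {ι : k' →ₐ[k] Ω₁}
    {r : (Ω₁ ≃ₐ[k] Ω₁) →* (k' ≃ₐ[k] k')} [Algebra.IsAlgebraic k k'] {j : Ω₁ →ₐ[k] Ω₂}
    (hι : ∀ x, j (ι x) = algebraMap k' Ω₂ x) (hr : ∀ (g : Ω₁ ≃ₐ[k] Ω₁) (x : k'), ι (r g x) = g (ι x))
    {c : contZ1 (Ω₁ ≃ₐ[k] Ω₁) (geomPoints E k)}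
    (hc : galH1Res E j (c : galH1 E k) = 0) :
    ∃ a : geomPoints E k, ∀ g : Ω₁ ≃ₐ[k] Ω₁, r g = 1 → c.1 g = g • a - a := by
  have hbij := closureEmbedding_bijective j
  let e : Ω₁ ≃ₐ[k] Ω₂ := AlgEquiv.ofBijective j hbij
  let J := Point.map (W' := E) (S := k) (F := Ω₁) (K := Ω₂) j
  have hJ : Function.Injective J := Point.map_injective _
  obtain ⟨a', ha'⟩ := (QuotientAddGroup.eq_zero_iff _).1 hc
  have ha'' : ∀ σ, J (c.1 (absGalRestrict j σ)) = σ • a' - a' := ha'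
  obtain ⟨a, ha⟩ : ∃ a, J a = a' := by
    refine ⟨Point.map (W' := E) (S := k) (F := Ω₂) (K := Ω₁) (e.symm : Ω₂ →ₐ[k] Ω₁) a', ?_⟩
    rw [Point.map_map]
    cases a' with
    | zero => rfl
    | some x y h =>
      exact (Point.some.injEq ..).mpr ⟨e.apply_symm_apply x, e.apply_symm_apply y⟩
  refine ⟨a, fun g hg => hJ ?_⟩
  have hfix : ∀ x, g (ι x) = ι x := fun x => by rw [← hr, hg]; rfl
  have hsymm : ∀ x, e.symm (algebraMap k' Ω₂ x) = ι x := fun x => by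
    rw [AlgEquiv.symm_apply_eq]; exact (hι x).symm
  -- As `g` fixes `k'`, it is the restriction of an element `τ` of the Galois group of `Ω₂`.
  let τ : Ω₂ ≃ₐ[k'] Ω₂ := AlgEquiv.ofRingEquiv (f := ((e.symm.trans g).trans e).toRingEquiv)
    fun x => by
      change e (g (e.symm (algebraMap k' Ω₂ x))) = _
      rw [hsymm, hfix]
      exact hι x
  have hτ : absGalRestrict j τ = g := by
    refine AlgEquiv.ext fun x => hbij.1 ?_
    rw [absGalRestrict_commutes]
    change e (g (e.symm (e x))) = _
    rw [AlgEquiv.symm_apply_apply]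
    rfl
  rw [← hτ, ha'', hτ, map_sub, ha]
  congr 1
  rw [← ha]
  cases a with
  | zero => rfl
  | some x y h =>
    refine (Point.some.injEq ..).mpr ⟨?_, ?_⟩
    · rw [← hτ]; exact (absGalRestrict_commutes j τ _).symm
    · rw [← hτ]; exact (absGalRestrict_commutes j τ _).symm

open scoped Classical in
/-- A cocycle that is a coboundary on the elements fixing `k'` is, up to a coboundary, inflated from
`Gal(k'/k)`. -/
theorem exists_inflation {ι : k' →ₐ[k] Ω₁}
    {r : (Ω₁ ≃ₐ[k] Ω₁) →* (k' ≃ₐ[k] k')} [CharZero k] (hsurj : Function.Surjective r)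
    (hr : ∀ (g : Ω₁ ≃ₐ[k] Ω₁) (x : k'), ι (r g x) = g (ι x))
    {c : contZ1 (Ω₁ ≃ₐ[k] Ω₁) (geomPoints E k)}
    {a : geomPoints E k} (ha : ∀ g : Ω₁ ≃ₐ[k] Ω₁, r g = 1 → c.1 g = g • a - a) :
    ∃ d : (k' ≃ₐ[k] k') → (E⁄k').toAffine.Point,
      (∀ s t, d (s * t) = d s + Point.map (W' := E) (S := k) s.toAlgHom (d t)) ∧
      ∀ g : Ω₁ ≃ₐ[k] Ω₁, c.1 g = g • a - a + Point.map (W' := E) (S := k) ι (d (r g)) := by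
  let c' : (Ω₁ ≃ₐ[k] Ω₁) → geomPoints E k := fun g => c.1 g - (g • a - a)
  have hc' : ∀ g h, c' (g * h) = c' g + g • c' h := by
    intro g h
    simp only [c', c.2.2, mul_smul, smul_sub]
    abel
  have hker : ∀ g, r g = 1 → c' g = 0 := fun g hg => by simp only [c', ha g hg, sub_self]
  have hright : ∀ g h, r h = 1 → c' (g * h) = c' g := fun g h hh => by
    rw [hc', hker h hh, smul_zero, add_zero]
  -- Normality of the kernel of `r` makes the values of `c'` invariant under it.
  have hfix : ∀ g h, r h = 1 → h • c' g = c' g := by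
    intro g h hh
    have h1 : c' (h * g) = h • c' g := by rw [hc', hker h hh, zero_add]
    have h2 : h * g = g * (g⁻¹ * h * g) := by group
    rw [← h1, h2, hright]
    rw [map_mul, map_mul, hh, mul_one, ← map_mul, inv_mul_cancel, map_one]
  have hinj : Function.Injective (Point.map (W' := E) (S := k) ι) := Point.map_injective _
  choose D hD using fun g => exists_map_eq_of_forall_fixed hr (hfix g)
  choose s hs using hsurj
  have hDs : ∀ g, D (s (r g)) = D g := by
    intro g
    apply hinj
    rw [hD, hD]
    have : s (r g) = g * (g⁻¹ * s (r g)) := by group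
    rw [this, hright]
    rw [map_mul, map_inv, hs, inv_mul_cancel]
  refine ⟨fun t => D (s t), fun t u => hinj ?_, fun g => ?_⟩
  · have h1 := hDs (s t * s u)
    rw [map_mul, hs, hs] at h1
    beta_reduce
    rw [h1, hD, hc', map_add, hD, ← hD (s u), geomPoints_smul_map hr, hs]
  · beta_reduce
    rw [hDs, hD]
    simp only [c']
    abel

open scoped Classical in
/-- Inflation is injective on cohomology classes. -/
theorem exists_coboundary_of_inflation {ι : k' →ₐ[k] Ω₁}
    {r : (Ω₁ ≃ₐ[k] Ω₁) →* (k' ≃ₐ[k] k')} [CharZero k] (hsurj : Function.Surjective r)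
    (hr : ∀ (g : Ω₁ ≃ₐ[k] Ω₁) (x : k'), ι (r g x) = g (ι x))
    {d : (k' ≃ₐ[k] k') → (E⁄k').toAffine.Point} (hd : d 1 = 0)
    {a : geomPoints E k}
    (ha : ∀ g : Ω₁ ≃ₐ[k] Ω₁, Point.map (W' := E) (S := k) ι (d (r g)) = g • a - a) :
    ∃ b : (E⁄k').toAffine.Point, ∀ s, d s = Point.map (W' := E) (S := k) s.toAlgHom b - b := by
  obtain ⟨b, rfl⟩ := exists_map_eq_of_forall_fixed (E := E) hr (a := a) fun g hg => by
    rw [← sub_eq_zero, ← ha, hg, hd, map_zero]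
  refine ⟨b, fun s => ?_⟩
  obtain ⟨g, rfl⟩ := hsurj s
  refine Point.map_injective (W' := E) (S := k) ι ?_
  rw [ha, geomPoints_smul_map hr, map_sub]

end Descent

/-! ### Inflation -/

section Inflation

open WeierstrassCurve WeierstrassCurve.Affine

variable {k k' : Type*} [Field k] [Field k'] [Algebra k k']

local notation "Ω₁" => AlgebraicClosure k
local notation "Ω₂" => AlgebraicClosure k'

open scoped Classical in
/-- The action of `Gal(k'/k)` on `E(k')` through the coordinates. -/
noncomputable def galoisPointHom {R : Type*} [CommRing R] (E : WeierstrassCurve R) (k k' : Type*)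
    [Field k] [Field k'] [Algebra k k'] [Algebra R k] [Algebra R k'] [IsScalarTower R k k'] :
    (k' ≃ₐ[k] k') →* AddMonoid.End (E⁄k').toAffine.Point where
  toFun s := Point.map (W' := E) (S := k) s.toAlgHom
  map_one' := by ext P; cases P <;> rfl
  map_mul' s t := by ext P; cases P <;> rfl

/-- Crossed homomorphisms for the action `ρ` of `G` on `M`. -/
def IsCrossedHom {G M : Type*} [Group G] [AddCommGroup M] (ρ : G →* AddMonoid.End M) (d : G → M) :
    Prop :=
  ∀ s t, d (s * t) = d s + ρ s (d t)

theorem IsCrossedHom.map_one {G M : Type*} [Group G] [AddCommGroup M] {ρ : G →* AddMonoid.End M}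
    {d : G → M} (hd : IsCrossedHom ρ d) : d 1 = 0 := by
  have h := hd 1 1
  rw [_root_.map_one, mul_one] at h
  exact left_eq_add.mp h

variable {F : Type*} [Field F] (E : WeierstrassCurve F) [Algebra F k] [Algebra F k']
  [IsScalarTower F k k']

open scoped Classical in
/-- The pairs `(ξ, d)` such that the class `ξ ∈ H¹(k, E)` is inflated from the crossed homomorphism
`d : Gal(k'/k) → E(k')`. -/
def inflationGraph (ι : k' →ₐ[k] Ω₁) (r : (Ω₁ ≃ₐ[k] Ω₁) →* (k' ≃ₐ[k] k')) :
    AddSubgroup (galH1 E k × ((k' ≃ₐ[k] k') → (E⁄k').toAffine.Point)) where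
  carrier := {x | IsCrossedHom (galoisPointHom E k k') x.2 ∧
    ∃ (c : contZ1 (Ω₁ ≃ₐ[k] Ω₁) (geomPoints E k)) (a : geomPoints E k), (c : galH1 E k) = x.1 ∧
      ∀ g, c.1 g = g • a - a + Point.map (W' := E) (S := k) ι (x.2 (r g))}
  zero_mem' := ⟨fun s t => by simp, 0, 0, rfl, fun g => by simp⟩
  add_mem' := by
    rintro x y ⟨hx, c, a, hc, ha⟩ ⟨hy, c', a', hc', ha'⟩
    refine ⟨fun s t => ?_, c + c', a + a', by rw [Prod.fst_add, ← hc, ← hc']; rfl, fun g => ?_⟩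
    · simp only [Prod.snd_add, Pi.add_apply, hx s t, hy s t, map_add]
      abel
    · simp only [AddSubgroup.coe_add, Prod.snd_add, Pi.add_apply, ha, ha', smul_add, map_add]
      abel
  neg_mem' := by
    rintro x ⟨hx, c, a, hc, ha⟩
    refine ⟨fun s t => ?_, -c, -a, by rw [Prod.fst_neg, ← hc]; rfl, fun g => ?_⟩
    · simp only [Prod.snd_neg, Pi.neg_apply, hx s t, map_neg]
      abel
    · simp only [NegMemClass.coe_neg, Prod.snd_neg, Pi.neg_apply, ha, smul_neg, map_neg]
      abel

variable {E}

open scoped Classical in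
/-- Classes that die over `k'` are inflated. -/
theorem exists_mem_inflationGraph [CharZero k] [Algebra.IsAlgebraic k k'] {ι : k' →ₐ[k] Ω₁}
    {r : (Ω₁ ≃ₐ[k] Ω₁) →* (k' ≃ₐ[k] k')} {j : Ω₁ →ₐ[k] Ω₂} (hsurj : Function.Surjective r)
    (hι : ∀ x, j (ι x) = algebraMap k' Ω₂ x)
    (hr : ∀ (g : Ω₁ ≃ₐ[k] Ω₁) (x : k'), ι (r g x) = g (ι x)) {ξ : galH1 E k}
    (hξ : galH1Res E j ξ = 0) : ∃ d, (ξ, d) ∈ inflationGraph E ι r := by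
  obtain ⟨c, rfl⟩ := QuotientAddGroup.mk_surjective ξ
  obtain ⟨a, ha⟩ := exists_coboundary_of_galH1Res_eq_zero hι hr hξ
  obtain ⟨d, hd, hcd⟩ := exists_inflation hsurj hr ha
  exact ⟨d, hd, c, a, rfl, hcd⟩

open scoped Classical in
theorem eq_zero_of_mem_inflationGraph {ι : k' →ₐ[k] Ω₁}
    {r : (Ω₁ ≃ₐ[k] Ω₁) →* (k' ≃ₐ[k] k')}
    (hr : ∀ (g : Ω₁ ≃ₐ[k] Ω₁) (x : k'), ι (r g x) = g (ι x)) {ξ : galH1 E k}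
    {d : (k' ≃ₐ[k] k') → (E⁄k').toAffine.Point} (hd : (ξ, d) ∈ inflationGraph E ι r)
    (hb : ∃ b, ∀ s, d s = galoisPointHom E k k' s b - b) : ξ = 0 := by
  obtain ⟨-, c, a, rfl, ha⟩ := hd
  obtain ⟨b, hb⟩ := hb
  refine (QuotientAddGroup.eq_zero_iff c).2 ⟨a + Point.map (W' := E) (S := k) ι b, fun g => ?_⟩
  rw [ha]
  dsimp only
  rw [hb, map_sub, smul_add, geomPoints_smul_map hr]
  change _ + (Point.map (W' := E) (S := k) ι (Point.map (W' := E) (S := k) (r g).toAlgHom b) - _)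
    = _
  abel

open scoped Classical in
theorem exists_coboundary_of_zero_mem_inflationGraph [CharZero k] {ι : k' →ₐ[k] Ω₁}
    {r : (Ω₁ ≃ₐ[k] Ω₁) →* (k' ≃ₐ[k] k')} (hsurj : Function.Surjective r)
    (hr : ∀ (g : Ω₁ ≃ₐ[k] Ω₁) (x : k'), ι (r g x) = g (ι x))
    {d : (k' ≃ₐ[k] k') → (E⁄k').toAffine.Point} (hd : (0, d) ∈ inflationGraph E ι r) :
    ∃ b, ∀ s, d s = galoisPointHom E k k' s b - b := by
  obtain ⟨hd, c, a, hc, ha⟩ := hd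
  obtain ⟨a', ha'⟩ := (QuotientAddGroup.eq_zero_iff c).1 hc
  refine exists_coboundary_of_inflation hsurj hr hd.map_one (a := a' - a) fun g => ?_
  have h1 := ha g
  rw [ha'] at h1
  rw [smul_sub, sub_sub_sub_comm, h1, add_sub_cancel_left]

end Inflation

/-! ### Cohomology of finite cyclic groups -/

section CyclicCohomology

variable {G M : Type*} [Group G] [AddCommGroup M] {ρ : G →* AddMonoid.End M} {d : G → M}

theorem IsCrossedHom.map_pow (hd : IsCrossedHom ρ d) (σ : G) (n : ℕ) :
    d (σ ^ n) = ∑ i ∈ Finset.range n, (ρ σ)^[i] (d σ) := by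
  induction n with
  | zero => simpa using hd.map_one
  | succ n ih =>
    rw [pow_succ', hd, ih, Finset.sum_range_succ', map_sum, add_comm]
    simp only [Function.iterate_succ_apply', Function.iterate_zero_apply]

theorem IsCrossedHom.sum_iterate_eq_zero (hd : IsCrossedHom ρ d) {σ : G} {n : ℕ}
    (hn : σ ^ n = 1) : ∑ i ∈ Finset.range n, (ρ σ)^[i] (d σ) = 0 := by
  rw [← hd.map_pow, hn, hd.map_one]

/-- A crossed homomorphism of a finite cyclic group is determined by its value at a generator. -/
theorem IsCrossedHom.eq_coboundary [Finite G] (hd : IsCrossedHom ρ d) {σ : G}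
    (hσ : ∀ s, s ∈ Subgroup.zpowers σ) {b : M} (hb : d σ = ρ σ b - b) (s : G) :
    d s = ρ s b - b := by
  obtain ⟨n, rfl⟩ : ∃ n : ℕ, σ ^ n = s := mem_powers_iff_mem_zpowers.2 (hσ s)
  induction n with
  | zero => simpa using hd.map_one
  | succ n ih =>
    rw [pow_succ', hd, ih, hb, map_mul, map_sub]
    change _ = ρ σ (ρ (σ ^ n) b) - b
    abel

/-- Crossed homomorphisms of a finite cyclic group of order `n` with values at a generator in a
stable, uniquely `n`-divisible subgroup are coboundaries. -/
theorem IsCrossedHom.exists_coboundary [Finite G] (hd : IsCrossedHom ρ d) {σ : G}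
    (hσ : ∀ s, s ∈ Subgroup.zpowers σ) {S : AddSubgroup M} (hS : ∀ x ∈ S, ρ σ x ∈ S)
    (hdiv : ∀ x ∈ S, ∃ y ∈ S, Nat.card G • y = x) (htf : ∀ x ∈ S, Nat.card G • x = 0 → x = 0)
    (hdσ : d σ ∈ S) : ∃ b, ∀ s, d s = ρ s b - b := by
  obtain ⟨b, -, hb⟩ := exists_map_sub_eq_of_trace_eq_zero hS hdiv htf hdσ
    (hd.sum_iterate_eq_zero (pow_card_eq_one' (x := σ)))
  exact ⟨b, hd.eq_coboundary hσ hb.symm⟩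

end CyclicCohomology

/-! ### The ring of integers of an adic completion -/

section AdicCompletion

open IsLocalRing IsDedekindDomain.HeightOneSpectrum Filter Topology
open scoped WithZero

variable {A K : Type*} [CommRing A] [IsDedekindDomain A] [Field K] [Algebra A K]
  [IsFractionRing A K]
  (v : HeightOneSpectrum A)

theorem mem_maximalIdeal_adicCompletionIntegers {x : v.adicCompletionIntegers K} :
    x ∈ maximalIdeal (v.adicCompletionIntegers K) ↔ Valued.v (x : v.adicCompletion K) < 1 := by
  rw [mem_maximalIdeal, mem_nonunits_iff, adicCompletionIntegers.isUnit_iff_valued_eq_one]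
  exact ⟨fun h => lt_of_le_of_ne x.2 h, fun h => h.ne⟩

theorem isOpen_setOf_valued_lt_one : IsOpen {y : v.adicCompletion K | Valued.v y < 1} := by
  simpa only [Valuation.restrict_lt_one_iff] using Valued.isOpen_ball (v.adicCompletion K) 1

/-- Having valuation less than `1` is a topological condition, so it is preserved by continuous
homomorphisms. -/
theorem valued_lt_one_iff_tendsto {x : v.adicCompletion K} :
    Valued.v x < 1 ↔ Tendsto (fun n : ℕ => x ^ n) atTop (𝓝 0) := by
  refine ⟨Valued.tendsto_zero_pow_of_v_lt_one, fun h => ?_⟩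
  have hU : {y : v.adicCompletion K | Valued.v y < 1} ∈ 𝓝 (0 : v.adicCompletion K) :=
    (isOpen_setOf_valued_lt_one v).mem_nhds (by simp)
  obtain ⟨n, hn⟩ := (h.eventually hU).exists
  by_contra! hx
  have : (1 : ℤᵐ⁰) ≤ Valued.v (x ^ n) := by rw [map_pow]; exact one_le_pow₀ hx
  exact absurd hn (not_lt.2 this)

/-- Every element of the completed ring of integers is congruent to a global integer. -/
theorem exists_sub_mem_maximalIdeal (x : v.adicCompletionIntegers K) :
    ∃ a : A, x - algebraMap A (v.adicCompletionIntegers K) a ∈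
      maximalIdeal (v.adicCompletionIntegers K) := by
  have hU : IsOpen {y : v.adicCompletion K | Valued.v ((x : v.adicCompletion K) - y) < 1} :=
    (isOpen_setOf_valued_lt_one v).preimage (continuous_const.sub continuous_id)
  obtain ⟨k, hk⟩ := (denseRange_algebraMap K v).exists_mem_open hU ⟨x.1, by simp⟩
  have hk' : Valued.v ((x : v.adicCompletion K) - algebraMap K (v.adicCompletion K) k) < 1 := hk
  have hk1 : v.valuation K k ≤ 1 := by
    rw [← valuedAdicCompletion_eq_valuation' v k]
    have h2 : ((k : K) : v.adicCompletion K) =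
        x.1 - (x.1 - algebraMap K (v.adicCompletion K) k) := by
      rw [sub_sub_cancel]; rfl
    rw [h2]
    exact (Valuation.map_sub _ _ _).trans (max_le x.2 hk'.le)
  obtain ⟨a, ha⟩ := v.exists_valuation_sub_lt_of_integer hk1 1
  refine ⟨a, ?_⟩
  rw [mem_maximalIdeal_adicCompletionIntegers]
  have h3 : ((x - algebraMap A (v.adicCompletionIntegers K) a : v.adicCompletionIntegers K) :
      v.adicCompletion K) = (x.1 - algebraMap K (v.adicCompletion K) k) -
        algebraMap K (v.adicCompletion K) (algebraMap A K a - k) := by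
    rw [map_sub]
    change x.1 - algebraMap K (v.adicCompletion K) (algebraMap A K a) = _
    ring
  rw [h3]
  refine (Valuation.map_sub _ _ _).trans_lt (max_lt hk' ?_)
  have := valuedAdicCompletion_eq_valuation' v (algebraMap A K a - k)
  exact this.trans_lt ha

theorem residue_algebraMap_eq_zero_iff (a : A) :
    residue (v.adicCompletionIntegers K) (algebraMap A (v.adicCompletionIntegers K) a) = 0 ↔
      a ∈ v.asIdeal := by
  rw [residue_eq_zero_iff, mem_maximalIdeal_adicCompletionIntegers,
    ← v.valuation_lt_one_iff_mem (K := K), ← valuedAdicCompletion_eq_valuation (K := K) v a]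
  rfl

theorem residue_algebraMap_surjective :
    Function.Surjective ((residue (v.adicCompletionIntegers K)).comp
      (algebraMap A (v.adicCompletionIntegers K))) := by
  intro y
  obtain ⟨x, rfl⟩ := residue_surjective y
  obtain ⟨a, ha⟩ := exists_sub_mem_maximalIdeal v x
  refine ⟨a, ?_⟩
  rw [← residue_eq_zero_iff, map_sub, sub_eq_zero] at ha
  exact ha.symm

variable (K) in
/-- The residue field of the completion is the residue field of the Dedekind domain. -/
noncomputable def residueFieldEquiv :
    (A ⧸ v.asIdeal) ≃+* ResidueField (v.adicCompletionIntegers K) :=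
  (Ideal.quotEquivOfEq (by
    ext a
    rw [RingHom.mem_ker]
    exact (residue_algebraMap_eq_zero_iff (K := K) v a).symm)).trans
    (RingHom.quotientKerEquivOfSurjective (residue_algebraMap_surjective (K := K) v))

theorem isUnit_natCast_of_notMem {n : ℕ} (hn : (n : A) ∉ v.asIdeal) :
    IsUnit (n : v.adicCompletionIntegers K) := by
  rw [← residue_ne_zero_iff_isUnit]
  have := (residue_algebraMap_eq_zero_iff (K := K) v n).not.2 hn
  rwa [map_natCast] at this

theorem mem_maximalIdeal_pow_iff {ϖ : v.adicCompletionIntegers K} (hϖ : Irreducible ϖ) (n : ℕ)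
    (x : v.adicCompletionIntegers K) : x ∈ maximalIdeal (v.adicCompletionIntegers K) ^ n ↔
      Valued.v (x : v.adicCompletion K) ≤ Valued.v ((ϖ : v.adicCompletion K) ^ n) := by
  have hϖ0 : (ϖ : v.adicCompletion K) ≠ 0 := fun h => hϖ.ne_zero (Subtype.ext h)
  rw [hϖ.maximalIdeal_eq, Ideal.span_singleton_pow, Ideal.mem_span_singleton]
  constructor
  · rintro ⟨y, rfl⟩
    push_cast
    rw [map_mul]
    exact mul_le_of_le_one_right' y.2
  · intro h
    refine ⟨⟨x / ϖ ^ n, ?_⟩, Subtype.ext ?_⟩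
    · rw [mem_adicCompletionIntegers, map_div₀]
      exact div_le_one_of_le₀ h zero_le
    · push_cast
      exact (mul_div_cancel₀ _ (pow_ne_zero n hϖ0)).symm

instance isTopologicalRing_adicCompletionIntegers :
    IsTopologicalRing (v.adicCompletionIntegers K) :=
  inferInstanceAs (IsTopologicalRing (v.adicCompletionIntegers K).toSubring)

instance isUniformAddGroup_adicCompletionIntegers :
    IsUniformAddGroup (v.adicCompletionIntegers K) :=
  inferInstanceAs (IsUniformAddGroup (v.adicCompletionIntegers K).toSubring.toAddSubgroup)

theorem isAdic_maximalIdeal_adicCompletionIntegers :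
    IsAdic (maximalIdeal (v.adicCompletionIntegers K)) := by
  obtain ⟨ϖ, hϖ⟩ := IsDiscreteValuationRing.exists_irreducible (v.adicCompletionIntegers K)
  have hϖ1 : Valued.v (ϖ : v.adicCompletion K) < 1 := by
    rw [← mem_maximalIdeal_adicCompletionIntegers, hϖ.maximalIdeal_eq]
    exact Ideal.mem_span_singleton_self ϖ
  have hϖ0 : (ϖ : v.adicCompletion K) ≠ 0 := fun h => hϖ.ne_zero (Subtype.ext h)
  rw [isAdic_iff]
  constructor
  · intro n
    have h1 := Valued.isOpen_closedBall (v.adicCompletion K)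
      (r := Valued.v.restrict ((ϖ : v.adicCompletion K) ^ n))
      (by rw [Ne, Valuation.restrict_eq_zero_iff]
          exact (Valuation.ne_zero_iff _).2 (pow_ne_zero n hϖ0))
    simp only [Valuation.restrict_le_iff] at h1
    convert h1.preimage continuous_subtype_val
    ext x
    exact mem_maximalIdeal_pow_iff v hϖ n x
  · intro s hs
    rw [nhds_subtype_eq_comap, mem_comap] at hs
    obtain ⟨t, ht, hts⟩ := hs
    obtain ⟨γ, hγ⟩ := (Valued.mem_nhds_zero (R := v.adicCompletion K)).1 ht
    have hball : {x : v.adicCompletion K | Valued.v.restrict x < γ.1} ∈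
        𝓝 (0 : v.adicCompletion K) := Valued.mem_nhds_zero.2 ⟨γ, subset_rfl⟩
    obtain ⟨n, hn⟩ := (((valued_lt_one_iff_tendsto v).1 hϖ1).eventually hball).exists
    refine ⟨n, fun x hx => hts (hγ ?_)⟩
    rw [SetLike.mem_coe, mem_maximalIdeal_pow_iff v hϖ, ← Valuation.restrict_le_iff] at hx
    exact hx.trans_lt hn

instance isAdicComplete_adicCompletionIntegers :
    IsAdicComplete (maximalIdeal (v.adicCompletionIntegers K)) (v.adicCompletionIntegers K) :=
  (isAdic_maximalIdeal_adicCompletionIntegers v).isAdicComplete_iff.2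
    ⟨(Valued.isClosed_valuationSubring (v.adicCompletion K)).completeSpace_coe, inferInstance⟩

end AdicCompletion

/-! ### The extension of completions -/

section LocalExtension

open IsLocalRing IsDedekindDomain.HeightOneSpectrum Filter Topology
open scoped WithZero Valued

variable {K L : Type*} [Field K] [NumberField K] [Field L] [NumberField L] [Algebra K L]
  {v : HeightOneSpectrum (𝓞 K)} (w : PrimesAbove v L)

local notation "Kv" => v.adicCompletion K
local notation "Lw" => HeightOneSpectrum.adicCompletion L (Subtype.val w)
local notation "Ov" => v.adicCompletionIntegers K
local notation "Ow" => HeightOneSpectrum.adicCompletionIntegers L (Subtype.val w)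

theorem continuous_completionMap : Continuous (completionMap w) := by
  refine (adicCompletion.continuous_ofCompletion L w.1).comp
    (UniformSpace.Completion.continuous_map.comp (adicCompletion.continuous_toCompletion K v))

instance continuousSMul_completion : ContinuousSMul Kv Lw := by
  refine ⟨?_⟩
  simp only [Algebra.smul_def]
  exact ((continuous_completionMap w).comp continuous_fst).mul continuous_snd

theorem completionMap_coe (x : K) :
    algebraMap Kv Lw (algebraMap K Kv x) = algebraMap L Lw (algebraMap K L x) := by
  rw [← IsScalarTower.algebraMap_apply K Kv Lw, ← IsScalarTower.algebraMap_apply K L Lw]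

theorem valued_completionMap_lt_one {x : Kv} (hx : Valued.v x < 1) :
    Valued.v (algebraMap Kv Lw x) < 1 := by
  rw [valued_lt_one_iff_tendsto] at hx ⊢
  simp only [← map_pow]
  have h := ((continuous_completionMap w).tendsto 0).comp hx
  rw [map_zero] at h
  exact h

theorem valued_completionMap_le_one {x : Kv} (hx : Valued.v x ≤ 1) :
    Valued.v (algebraMap Kv Lw x) ≤ 1 := by
  obtain ⟨a, ha⟩ := exists_sub_mem_maximalIdeal v (⟨x, hx⟩ : Ov)
  rw [mem_maximalIdeal_adicCompletionIntegers] at ha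
  have h1 := valued_completionMap_lt_one w ha
  have h2 : algebraMap Kv Lw x = algebraMap Kv Lw
      ((⟨x, hx⟩ - algebraMap (𝓞 K) Ov a : Ov) : Kv) +
        algebraMap L Lw (algebraMap (𝓞 L) L (algebraMap (𝓞 K) (𝓞 L) a)) := by
    have h3 : ((⟨x, hx⟩ - algebraMap (𝓞 K) Ov a : Ov) : Kv) =
      x - algebraMap K Kv (algebraMap (𝓞 K) K a) := rfl
    rw [h3, map_sub, completionMap_coe]
    have : algebraMap (𝓞 L) L (algebraMap (𝓞 K) (𝓞 L) a) =
        algebraMap K L (algebraMap (𝓞 K) K a) := rfl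
    rw [this, sub_add_cancel]
  rw [h2]
  refine (Valuation.map_add _ _ _).trans (max_le h1.le ?_)
  exact coe_algebraMap_mem (𝓞 L) L w.1 _

theorem valued_completionMap_lt_one_iff {x : Kv} :
    Valued.v (algebraMap Kv Lw x) < 1 ↔ Valued.v x < 1 := by
  refine ⟨fun h => ?_, valued_completionMap_lt_one w⟩
  by_contra! hx
  have h1 : Valued.v (x⁻¹) ≤ 1 := by rw [map_inv₀]; exact inv_le_one_of_one_le₀ hx
  have h2 := valued_completionMap_le_one w h1
  have hx0 : x ≠ 0 := by rintro rfl; simp at hx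
  have h3 : Valued.v (algebraMap Kv Lw x) * Valued.v (algebraMap Kv Lw x⁻¹) = 1 := by
    rw [← map_mul, ← map_mul, mul_inv_cancel₀ hx0, map_one, map_one]
  have := mul_lt_one_of_lt_of_le h h2
  exact absurd h3 this.ne

theorem valued_completionMap_le_one_iff {x : Kv} :
    Valued.v (algebraMap Kv Lw x) ≤ 1 ↔ Valued.v x ≤ 1 := by
  refine ⟨fun h => ?_, valued_completionMap_le_one w⟩
  by_contra! hx
  have h1 : Valued.v (x⁻¹) < 1 := by rw [map_inv₀]; exact inv_lt_one_of_one_lt₀ hx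
  have h2 := valued_completionMap_lt_one w h1
  have hx0 : x ≠ 0 := by rintro rfl; simp at hx
  have h3 : Valued.v (algebraMap Kv Lw x) * Valued.v (algebraMap Kv Lw x⁻¹) = 1 := by
    rw [← map_mul, ← map_mul, mul_inv_cancel₀ hx0, map_one, map_one]
  have := mul_lt_one_of_lt_of_le h2 h
  rw [mul_comm] at this
  exact absurd h3 this.ne

/-- The map of completed rings of integers. -/
noncomputable def integersMap : Ov →+* Ow :=
  ((algebraMap Kv Lw).comp (Ov).subtype).codRestrict (Ow).toSubring
    fun x => valued_completionMap_le_one w x.2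

/-- The ring of integers of `L_w` as an algebra over that of `K_v`. -/
noncomputable instance integersAlgebra : Algebra Ov Ow := (integersMap w).toAlgebra

theorem coe_algebraMap_integers (x : Ov) :
    ((algebraMap Ov Ow x : Ow) : Lw) = algebraMap Kv Lw (x : Kv) := rfl

/-- The field `L_w` as an algebra over the integers of `K_v`. -/
noncomputable instance integersAlgebra' : Algebra Ov Lw :=
  ((algebraMap Kv Lw).comp (algebraMap Ov Kv)).toAlgebra

instance : IsScalarTower Ov Ow Lw := .of_algebraMap_eq fun _ => rfl

instance : IsScalarTower Ov Kv Lw := .of_algebraMap_eq fun _ => rfl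

instance isLocalHom_algebraMap_integers : IsLocalHom (algebraMap Ov Ow) := by
  refine ⟨fun x hx => ?_⟩
  by_contra h
  have h1 : x ∈ maximalIdeal Ov := h
  rw [mem_maximalIdeal_adicCompletionIntegers, ← valued_completionMap_lt_one_iff w,
    ← coe_algebraMap_integers, ← mem_maximalIdeal_adicCompletionIntegers] at h1
  exact h1 hx

/-- The completion of `L` is generated over that of `K` by `L`. -/
theorem adjoin_range_algebraMap : Algebra.adjoin Kv (Set.range (algebraMap L Lw)) = ⊤ := by
  have hclosed : IsClosed ((Subalgebra.toSubmodule
      (Algebra.adjoin Kv (Set.range (algebraMap L Lw))) : Submodule Kv Lw) : Set Lw) :=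
    Submodule.closed_of_finiteDimensional (𝕜 := Kv) (E := Lw) _
  rw [eq_top_iff]
  intro x _
  have h1 : closure (Set.range (algebraMap L Lw)) ⊆ _ :=
    hclosed.closure_subset_iff.2 Algebra.subset_adjoin
  exact h1 ((denseRange_algebraMap L w.1) x)

variable [IsGalois K L]

/-- `L_w` is the splitting field over `K_v` of a polynomial with splitting field `L` over `K`. -/
instance isGalois_completion : IsGalois Kv Lw := by
  obtain ⟨f, -, hf⟩ := IsGalois.is_separable_splitting_field K L
  have hsf : (f.map (algebraMap K Kv)).IsSplittingField Kv Lw := by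
    constructor
    · rw [Polynomial.map_map, ← IsScalarTower.algebraMap_eq, IsScalarTower.algebraMap_eq K L Lw,
        ← Polynomial.map_map]
      exact hf.splits'.map _
    · rw [eq_top_iff, ← adjoin_range_algebraMap w, Algebra.adjoin_le_iff]
      rintro _ ⟨x, rfl⟩
      have hx : x ∈ Algebra.adjoin K (f.rootSet L) := by rw [hf.adjoin_rootSet']; trivial
      induction hx using Algebra.adjoin_induction with
      | mem y hy =>
        refine Algebra.subset_adjoin ?_
        obtain ⟨hf0, hy0⟩ := Polynomial.mem_rootSet.1 hy
        refine Polynomial.mem_rootSet.2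
          ⟨(Polynomial.map_ne_zero_iff (algebraMap K Kv).injective).2 hf0, ?_⟩
        rw [Polynomial.aeval_map_algebraMap, Polynomial.aeval_algebraMap_apply, hy0, map_zero]
      | algebraMap r =>
        rw [← completionMap_coe]
        exact Subalgebra.algebraMap_mem _ _
      | add y z _ _ hy hz => rw [map_add]; exact add_mem hy hz
      | mul y z _ _ hy hz => rw [map_mul]; exact mul_mem hy hz
  have : Normal Kv Lw := Normal.of_isSplittingField (f.map (algebraMap K Kv))
  have : CharZero Kv := charZero_of_injective_algebraMap (algebraMap K Kv).injective
  exact ⟨⟩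

/-- Restriction of automorphisms from the completion to the global field. -/
noncomputable def galoisRestrict : (Lw ≃ₐ[Kv] Lw) →* (L ≃ₐ[K] L) :=
  (AlgEquiv.restrictNormalHom L).comp (AlgEquiv.restrictScalarsHom K)

theorem galoisRestrict_commutes (σ : Lw ≃ₐ[Kv] Lw) (x : L) :
    algebraMap L Lw (galoisRestrict w σ x) = σ (algebraMap L Lw x) :=
  AlgEquiv.restrictNormal_commutes (σ.restrictScalars K) L x

theorem galoisRestrict_injective : Function.Injective (galoisRestrict w) := by
  rw [injective_iff_map_eq_one]
  intro σ hσ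
  have h1 : (σ : Lw →ₐ[Kv] Lw) = AlgHom.id Kv Lw := by
    refine AlgHom.ext_of_adjoin_eq_top (adjoin_range_algebraMap w) ?_
    rintro _ ⟨x, rfl⟩
    change σ (algebraMap L Lw x) = algebraMap L Lw x
    rw [← galoisRestrict_commutes, hσ]
    rfl
  exact AlgEquiv.ext fun x => DFunLike.congr_fun h1 x

end LocalExtension

/-! ### The Galois action on the completed ring of integers -/

section LocalGalois

open IsLocalRing IsDedekindDomain.HeightOneSpectrum Filter Topology
open scoped WithZero Valued

variable {K L : Type*} [Field K] [NumberField K] [Field L] [NumberField L] [Algebra K L]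
  {v : HeightOneSpectrum (𝓞 K)} (w : PrimesAbove v L)

local notation "Kv" => v.adicCompletion K
local notation "Lw" => HeightOneSpectrum.adicCompletion L (Subtype.val w)
local notation "Ov" => v.adicCompletionIntegers K
local notation "Ow" => HeightOneSpectrum.adicCompletionIntegers L (Subtype.val w)

theorem valued_algEquiv_lt_one (σ : Lw ≃ₐ[Kv] Lw) {x : Lw} (hx : Valued.v x < 1) :
    Valued.v (σ x) < 1 := by
  have hσ : Continuous σ := LinearMap.continuous_of_finiteDimensional (𝕜 := Kv) σ.toLinearMap
  rw [valued_lt_one_iff_tendsto] at hx ⊢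
  simp only [← map_pow]
  have h := (hσ.tendsto 0).comp hx
  rw [map_zero] at h
  exact h

theorem valued_algEquiv_le_one (σ : Lw ≃ₐ[Kv] Lw) {x : Lw} (hx : Valued.v x ≤ 1) :
    Valued.v (σ x) ≤ 1 := by
  by_contra! h
  have h1 : Valued.v ((σ x)⁻¹) < 1 := by rw [map_inv₀]; exact inv_lt_one_of_one_lt₀ h
  have h2 := valued_algEquiv_lt_one w σ.symm h1
  rw [map_inv₀, AlgEquiv.symm_apply_apply, map_inv₀] at h2
  have hx0 : x ≠ 0 := by rintro rfl; simp at h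
  exact absurd h2 (not_lt.2 ((one_le_inv₀ (by simpa [zero_lt_iff] using hx0)).2 hx))

/-- The Galois group of `L_w` over `K_v` acts on the integers of `L_w`: its elements are continuous,
as `L_w` is finite over the complete field `K_v`, so they preserve integrality. -/
noncomputable instance galoisIntegersAction : MulSemiringAction (Lw ≃ₐ[Kv] Lw) Ow where
  smul σ x := ⟨σ x, valued_algEquiv_le_one w σ x.2⟩
  one_smul _ := rfl
  mul_smul _ _ _ := rfl
  smul_zero σ := Subtype.ext (map_zero σ)
  smul_add σ _ _ := Subtype.ext (map_add σ _ _)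
  smul_one σ := Subtype.ext (map_one σ)
  smul_mul σ _ _ := Subtype.ext (map_mul σ _ _)

theorem coe_galois_smul (σ : Lw ≃ₐ[Kv] Lw) (x : Ow) : ((σ • x : Ow) : Lw) = σ (x : Lw) := rfl

instance : SMulCommClass (Lw ≃ₐ[Kv] Lw) Ov Ow := by
  refine ⟨fun σ a x => Subtype.ext ?_⟩
  rw [Algebra.smul_def, Algebra.smul_def, coe_galois_smul]
  push_cast
  rw [map_mul, coe_galois_smul, coe_algebraMap_integers, AlgEquiv.commutes]

instance isInvariant_integers [IsGalois K L] : Algebra.IsInvariant Ov Ow (Lw ≃ₐ[Kv] Lw) := by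
  refine ⟨fun x hx => ?_⟩
  have h : (x : Lw) ∈ Set.range (algebraMap Kv Lw) :=
    (IsGalois.mem_range_algebraMap_iff_fixed (F := Kv) _).2 fun σ => congrArg Subtype.val (hx σ)
  obtain ⟨y, hy⟩ := h
  refine ⟨⟨y, (valued_completionMap_le_one_iff w).1 (hy ▸ x.2)⟩, Subtype.ext hy⟩

theorem galois_smul_mem_maximalIdeal (σ : Lw ≃ₐ[Kv] Lw) {x : Ow} (hx : x ∈ maximalIdeal Ow) :
    σ • x ∈ maximalIdeal Ow := by
  rw [mem_maximalIdeal_adicCompletionIntegers] at hx ⊢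
  exact valued_algEquiv_lt_one w σ hx

instance finite_residueField (u : HeightOneSpectrum (𝓞 K)) :
    Finite (ResidueField (u.adicCompletionIntegers K)) := by
  have : Finite (𝓞 K ⧸ u.asIdeal) := u.asIdeal.finiteQuotientOfFreeOfNeBot u.ne_bot
  exact Finite.of_equiv _ (residueFieldEquiv K u).toEquiv

variable (v) in
theorem under_maximalIdeal_integers : (maximalIdeal Ow).under Ov = maximalIdeal Ov :=
  ((IsLocalRing.local_hom_TFAE (algebraMap Ov Ow)).out 0 4).1 (isLocalHom_algebraMap_integers w)

/-- There is a Frobenius element in the Galois group of the completions. -/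
theorem exists_frobenius [IsGalois K L] : ∃ σ : Lw ≃ₐ[Kv] Lw, ∀ x : Ow,
    residue Ow (σ • x) = residue Ow x ^ Nat.card (ResidueField Ov) := by
  have : Finite (Ow ⧸ maximalIdeal Ow) := finite_residueField w.1
  obtain ⟨σ, hσ⟩ := IsArithFrobAt.exists_of_isInvariant Ov (Lw ≃ₐ[Kv] Lw) (maximalIdeal Ow)
  refine ⟨σ, fun x => ?_⟩
  have h := hσ x
  rw [under_maximalIdeal_integers] at h
  rw [← map_pow, ← sub_eq_zero, ← map_sub, residue_eq_zero_iff]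
  exact h

end LocalGalois

/-! ### Residue degrees -/

section ResidueDegree

open IsLocalRing IsDedekindDomain.HeightOneSpectrum

variable {K L : Type*} [Field K] [NumberField K] [Field L] [NumberField L] [Algebra K L]
  {v : HeightOneSpectrum (𝓞 K)} (w : PrimesAbove v L)

local notation "Kv" => v.adicCompletion K
local notation "Lw" => HeightOneSpectrum.adicCompletion L (Subtype.val w)
local notation "Ov" => v.adicCompletionIntegers K
local notation "Ow" => HeightOneSpectrum.adicCompletionIntegers L (Subtype.val w)

theorem natCard_residueField (u : HeightOneSpectrum (𝓞 K)) :
    Nat.card (ResidueField (u.adicCompletionIntegers K)) = Ideal.absNorm u.asIdeal := by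
  rw [← Nat.card_congr (residueFieldEquiv K u).toEquiv]
  rfl

theorem finrank_ringOfIntegers_eq (K L : Type*) [Field K] [NumberField K] [Field L] [NumberField L]
    [Algebra K L] : Module.finrank (𝓞 K) (𝓞 L) = Module.finrank K L :=
  (IsFractionRing.finrank_eq (𝓞 K) K (𝓞 L) L).symm

/-- At a totally ramified prime the residue field does not grow. -/
theorem residueField_algebraMap_surjective
    (hw : w.1.asIdeal.ramificationIdx (𝓞 K) = Module.finrank K L) :
    Function.Surjective (algebraMap (ResidueField Ov) (ResidueField Ow)) := by
  classical
  have := w.2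
  have hvm : v.asIdeal.IsMaximal := v.isMaximal
  have hsum := Ideal.sum_ramification_inertia_eq_finrank (R := 𝓞 K) (S := 𝓞 L) v.asIdeal
  let w' : v.asIdeal.primesOver (𝓞 L) := ⟨w.1.asIdeal, w.1.isPrime, w.2⟩
  have hle := Finset.single_le_sum (f := fun q : v.asIdeal.primesOver (𝓞 L) =>
    q.1.ramificationIdx (𝓞 K) * q.1.inertiaDeg (𝓞 K)) (fun _ _ => Nat.zero_le _)
    (Finset.mem_univ w')
  rw [hsum, finrank_ringOfIntegers_eq K L] at hle
  change w.1.asIdeal.ramificationIdx (𝓞 K) * w.1.asIdeal.inertiaDeg (𝓞 K) ≤ _ at hle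
  rw [hw] at hle
  have hpos : 0 < Module.finrank K L := Module.finrank_pos
  have hwp := w.1.isPrime
  have hf : w.1.asIdeal.inertiaDeg (𝓞 K) = 1 :=
    le_antisymm (by nlinarith) (Ideal.inertiaDeg_pos _ _)
  have hcard : Nat.card (ResidueField Ov) = Nat.card (ResidueField Ow) := by
    rw [natCard_residueField, natCard_residueField]
    have := Ideal.absNorm_pow_inertiaDeg v.asIdeal w.1.asIdeal
    rw [hf, pow_one] at this
    exact this
  exact ((Nat.bijective_iff_injective_and_card _).2
    ⟨(algebraMap (ResidueField Ov) (ResidueField Ow)).injective, hcard⟩).2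

/-- At an inert prime the residue field grows as much as possible. -/
theorem exists_primesAbove_of_isInertIn (h : IsInertIn v L) : ∃ w : PrimesAbove v L,
    Nat.card (ResidueField (w.1.adicCompletionIntegers L)) =
      Nat.card (ResidueField Ov) ^ Module.finrank K L := by
  have hne : v.asIdeal.map (algebraMap (𝓞 K) (𝓞 L)) ≠ ⊥ := by
    rw [Ne, Ideal.map_eq_bot_iff_of_injective (FaithfulSMul.algebraMap_injective _ _)]
    exact v.ne_bot
  have hle : v.asIdeal ≤ (v.asIdeal.map (algebraMap (𝓞 K) (𝓞 L))).under (𝓞 K) :=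
    Ideal.le_comap_map
  have hover : (v.asIdeal.map (algebraMap (𝓞 K) (𝓞 L))).LiesOver v.asIdeal :=
    ⟨v.isMaximal.eq_of_le (Ideal.IsPrime.ne_top (h.comap _)) hle⟩
  refine ⟨⟨⟨_, h, hne⟩, hover⟩, ?_⟩
  rw [natCard_residueField, natCard_residueField]
  rw [← finrank_ringOfIntegers_eq]
  exact Ideal.absNorm_algebraMap (R := 𝓞 K) (S := 𝓞 L) v.asIdeal

theorem isUnit_natCast_integers {n : ℕ} (hn : (n : 𝓞 K) ∉ v.asIdeal) : IsUnit (n : Ow) := by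
  have := (isUnit_natCast_of_notMem (K := K) v hn).map (algebraMap Ov Ow)
  rwa [map_natCast] at this

variable [IsGalois K L]

theorem isCyclic_galois_completion [IsCyclic (L ≃ₐ[K] L)] : IsCyclic (Lw ≃ₐ[Kv] Lw) :=
  isCyclic_of_injective (galoisRestrict w) (galoisRestrict_injective w)

theorem card_galois_completion_dvd :
    Nat.card (Lw ≃ₐ[Kv] Lw) ∣ Nat.card (L ≃ₐ[K] L) :=
  Subgroup.card_dvd_of_injective (galoisRestrict w) (galoisRestrict_injective w)

end ResidueDegree

/-! ### Curves with good reduction over the completions -/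

section GoodReduction

open WeierstrassCurve WeierstrassCurve.Affine IsLocalRing

variable {K L : Type*} [Field K] [NumberField K] [Field L] [NumberField L] [Algebra K L]
  {v : HeightOneSpectrum (𝓞 K)} (w : PrimesAbove v L)

local notation "Kv" => v.adicCompletion K
local notation "Lw" => HeightOneSpectrum.adicCompletion L (Subtype.val w)
local notation "Ov" => v.adicCompletionIntegers K
local notation "Ow" => HeightOneSpectrum.adicCompletionIntegers L (Subtype.val w)
local notation "kv" => IsLocalRing.ResidueField Ov
local notation "kw" => IsLocalRing.ResidueField Ow

variable {W : WeierstrassCurve (v.adicCompletionIntegers K)}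

theorem algEquiv_mem_integers_iff (σ : Lw ≃ₐ[Kv] Lw) (x : Lw) : σ x ∈ Ow ↔ x ∈ Ow := by
  refine ⟨fun h => ?_, valued_algEquiv_le_one w σ⟩
  have := valued_algEquiv_le_one w σ.symm h
  rwa [AlgEquiv.symm_apply_apply] at this

open scoped Classical in
theorem galoisPointHom_mem_kernelOfReduction (σ : Lw ≃ₐ[Kv] Lw) {P : (W⁄Lw).toAffine.Point}
    (hP : P ∈ kernelOfReduction Ow W) : galoisPointHom W Kv Lw σ P ∈ kernelOfReduction Ow W := by
  cases P with
  | zero => exact zero_mem _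
  | some x y h =>
    rw [some_mem_kernelOfReduction] at hP
    exact some_mem_kernelOfReduction.2 fun hx => hP ((algEquiv_mem_integers_iff w σ x).1 hx)

variable [W.IsElliptic]

open scoped Classical in
/-- The Galois group acts on the reduction of a point through its action on the residue field. -/
theorem reductionHom_galois (σ : Lw ≃ₐ[Kv] Lw) (g : kw →ₐ[kv] kw)
    (hg : ∀ x : Ow, residue Ow (σ • x) = g (residue Ow x)) (P : (W⁄Lw).toAffine.Point) :
    reductionHom Ow W (galoisPointHom W Kv Lw σ P) =
      Point.map (W' := W) (S := kv) g (reductionHom Ow W P) :=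
  reductionHom_map (S := Kv) (S' := kv) σ.toAlgHom g (algEquiv_mem_integers_iff w σ) hg P

open scoped Classical in
theorem exists_nsmul_eq_of_mem_kernelOfReduction {n : ℕ} (hn : IsUnit (n : Ow))
    {P : (W⁄Lw).toAffine.Point} (hP : P ∈ kernelOfReduction Ow W) :
    ∃ Q ∈ kernelOfReduction Ow W, n • Q = P := by
  have : Fintype kw := Fintype.ofFinite _
  -- `n ^ (#k_w - 2)` inverts `n` modulo the maximal ideal.
  refine exists_nsmul_eq_of_mem_kernel (u := n ^ (Fintype.card kw - 2)) ?_ hP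
  have h0 : (residue Ow) (n : Ow) ≠ 0 := (hn.map (residue Ow)).ne_zero
  have h2 : 2 ≤ Fintype.card kw := Fintype.one_lt_card
  rw [← residue_eq_zero_iff, Nat.cast_pow, ← pow_succ', map_sub, map_one, map_pow,
    show Fintype.card kw - 2 + 1 = Fintype.card kw - 1 by omega,
    FiniteField.pow_card_sub_one_eq_one _ h0, sub_self]

open scoped Classical in
/-- A crossed homomorphism whose value at a generator lies in the kernel of reduction is a
coboundary. -/
theorem exists_coboundary_of_mem_kernelOfReduction {σ : Lw ≃ₐ[Kv] Lw}
    (hσ : ∀ s, s ∈ Subgroup.zpowers σ) (hn : IsUnit ((Nat.card (Lw ≃ₐ[Kv] Lw) : ℕ) : Ow))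
    {d : (Lw ≃ₐ[Kv] Lw) → (W⁄Lw).toAffine.Point} (hd : IsCrossedHom (galoisPointHom W Kv Lw) d)
    (hdσ : d σ ∈ kernelOfReduction Ow W) : ∃ b, ∀ s, d s = galoisPointHom W Kv Lw s b - b :=
  hd.exists_coboundary hσ (fun _ => galoisPointHom_mem_kernelOfReduction w σ)
    (fun _ => exists_nsmul_eq_of_mem_kernelOfReduction w hn)
    (fun _ => eq_zero_of_nsmul_eq_zero_of_mem_kernel hn) hdσ

open scoped Classical in
/-- If a crossed homomorphism becomes a coboundary in the reduction, at a generator, then it is a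
coboundary. -/
theorem exists_coboundary_of_reductionHom {σ : Lw ≃ₐ[Kv] Lw}
    (hσ : ∀ s, s ∈ Subgroup.zpowers σ) (hn : IsUnit ((Nat.card (Lw ≃ₐ[Kv] Lw) : ℕ) : Ow))
    {g : kw →ₐ[kv] kw} (hg : ∀ x : Ow, residue Ow (σ • x) = g (residue Ow x))
    {d : (Lw ≃ₐ[Kv] Lw) → (W⁄Lw).toAffine.Point} (hd : IsCrossedHom (galoisPointHom W Kv Lw) d)
    {Q : (W⁄kw).toAffine.Point}
    (hQ : Point.map (W' := W) (S := kv) g Q - Q = reductionHom Ow W (d σ)) :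
    ∃ b, ∀ s, d s = galoisPointHom W Kv Lw s b - b := by
  obtain ⟨P, rfl⟩ := reductionHom_surjective (A := Ow) (W := W) Q
  have hd' : IsCrossedHom (galoisPointHom W Kv Lw)
      fun s => d s - (galoisPointHom W Kv Lw s P - P) := by
    intro s t
    simp only [hd s t, map_mul, map_sub]
    change _ - (galoisPointHom W Kv Lw s (galoisPointHom W Kv Lw t P) - P) = _
    abel
  obtain ⟨b, hb⟩ := exists_coboundary_of_mem_kernelOfReduction w hσ hn hd' (by
    rw [mem_kernelOfReduction_iff_reductionHom, map_sub, map_sub, reductionHom_galois w σ g hg, hQ,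
      sub_self])
  refine ⟨b + P, fun s => ?_⟩
  rw [sub_eq_iff_eq_add.mp (hb s), map_add]
  abel

end GoodReduction

/-! ### Vanishing of the cohomology of the completions -/

section Vanishing

open WeierstrassCurve WeierstrassCurve.Affine IsLocalRing

theorem finite_point {F : Type*} [Field F] [Finite F] (V : WeierstrassCurve F) :
    Finite V.toAffine.Point := by
  let f : V.toAffine.Point → Option (F × F) := fun
    | .zero => none
    | .some x y _ => some (x, y)
  refine Finite.of_injective f ?_
  rintro (_ | ⟨x₁, y₁, h₁⟩) (_ | ⟨x₂, y₂, h₂⟩) h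
  · rfl
  · simp [f] at h
  · simp [f] at h
  · simpa [f] using h

/-- A `p`-power order automorphism of a finite group whose only fixed point of order dividing `p` is
the identity excludes `p`-torsion altogether. -/
theorem eq_zero_of_nsmul_eq_zero_of_iterate_eq {M : Type*} [AddCommGroup M] [Finite M] {p m : ℕ}
    [hp : Fact p.Prime] {f : M →+ M} (hf : ∀ x, f^[p ^ m] x = x)
    (hfix : ∀ x, p • x = 0 → f x = x → x = 0) {x : M} (hx : p • x = 0) : x = 0 := by
  classical
  let T := {y : M // p • y = 0}
  let g : Function.End T := fun y => ⟨f y, by rw [← map_nsmul, y.2, map_zero]⟩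
  have hgi : ∀ (n : ℕ) (y : T), ((g ^ n) y : M) = f^[n] y := by
    intro n
    induction n with
    | zero => exact fun y => rfl
    | succ n ih =>
      intro y
      rw [pow_succ, Function.iterate_succ_apply]
      exact ih (g y)
  have hg : g ^ p ^ m = 1 := funext fun y => Subtype.ext ((hgi _ y).trans (hf y))
  have : Fintype T := Fintype.ofFinite T
  have hmod := Equiv.Perm.card_fixedPoints_modEq hg
  have hone : Fintype.card g.fixedPoints = 1 := by
    refine Fintype.card_eq_one_iff.2 ⟨⟨⟨0, nsmul_zero p⟩, Subtype.ext (map_zero f)⟩, ?_⟩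
    rintro ⟨y, hy⟩
    exact Subtype.ext (Subtype.ext (hfix y y.2 (congrArg Subtype.val hy)))
  -- The `p`-torsion has `1` modulo `p` elements, whereas an element of order `p` makes that `0`.
  by_contra hx0
  have hpT : p ∣ Fintype.card T := by
    have hord : addOrderOf x = p := addOrderOf_eq_prime hx hx0
    let S := (nsmulAddMonoidHom (α := M) p).ker
    have h1 : addOrderOf (⟨x, hx⟩ : S) ∣ Nat.card S := addOrderOf_dvd_natCard _
    rw [← AddSubgroup.addOrderOf_coe] at h1
    rw [← hord, ← Nat.card_eq_fintype_card]
    exact h1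
  rw [hone] at hmod
  have := (Nat.modEq_zero_iff_dvd.2 hpT).symm.trans hmod
  exact hp.out.one_lt.ne' (Nat.dvd_one.1 ((Nat.modEq_zero_iff_dvd).1 this.symm))

variable {K L : Type*} [Field K] [NumberField K] [Field L] [NumberField L] [Algebra K L]
  {v : HeightOneSpectrum (𝓞 K)} (w : PrimesAbove v L)

local notation "Kv" => v.adicCompletion K
local notation "Lw" => HeightOneSpectrum.adicCompletion L (Subtype.val w)
local notation "Ov" => v.adicCompletionIntegers K
local notation "Ow" => HeightOneSpectrum.adicCompletionIntegers L (Subtype.val w)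
local notation "kv" => IsLocalRing.ResidueField Ov
local notation "kw" => IsLocalRing.ResidueField Ow

variable {W : WeierstrassCurve (v.adicCompletionIntegers K)} [W.IsElliptic]

theorem residue_pow_smul {σ : Lw ≃ₐ[Kv] Lw} {g : kw →ₐ[kv] kw}
    (hg : ∀ x : Ow, residue Ow (σ • x) = g (residue Ow x)) (i : ℕ) (x : Ow) :
    residue Ow (σ ^ i • x) = g^[i] (residue Ow x) := by
  induction i generalizing x with
  | zero => simp
  | succ i ih => rw [pow_succ, mul_smul, ih, hg, Function.iterate_succ_apply]

theorem exists_frobeniusAlgHom [IsGalois K L] [Fintype kv] : ∃ σ : Lw ≃ₐ[Kv] Lw,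
    ∀ x : Ow, residue Ow (σ • x) = FiniteField.frobeniusAlgHom kv kw (residue Ow x) := by
  obtain ⟨σ, hσ⟩ := exists_frobenius w
  refine ⟨σ, fun x => ?_⟩
  rw [hσ, Nat.card_eq_fintype_card, FiniteField.coe_frobeniusAlgHom]

/-- If the residue degree is `[L : K]`, the Frobenius element generates the Galois group. -/
theorem mem_zpowers_frobenius [IsGalois K L] [Fintype kv]
    (hw : Nat.card kw = Nat.card kv ^ Module.finrank K L) {σ : Lw ≃ₐ[Kv] Lw}
    (hσ : ∀ x : Ow, residue Ow (σ • x) = FiniteField.frobeniusAlgHom kv kw (residue Ow x)) :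
    Nat.card (Lw ≃ₐ[Kv] Lw) = Module.finrank K L ∧ ∀ s, s ∈ Subgroup.zpowers σ := by
  have hpos : 0 < Module.finrank K L := Module.finrank_pos
  have hle : Nat.card (Lw ≃ₐ[Kv] Lw) ≤ Module.finrank K L := by
    rw [← IsGalois.card_aut_eq_finrank K L]
    exact Nat.le_of_dvd Nat.card_pos (card_galois_completion_dvd w)
  have hord : Module.finrank K L ≤ orderOf σ := by
    have h1 : FiniteField.frobeniusAlgHom kv kw ^ orderOf σ = 1 := by
      refine AlgHom.ext fun y => ?_
      obtain ⟨x, rfl⟩ := residue_surjective y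
      rw [AlgHom.coe_pow, ← residue_pow_smul w hσ, pow_orderOf_eq_one, one_smul]
      rfl
    have h2 : Module.finrank kv kw = Module.finrank K L :=
      Nat.pow_right_injective (Finite.one_lt_card (α := kv))
        (Module.natCard_eq_pow_finrank.symm.trans hw)
    rw [← h2, ← FiniteField.orderOf_frobeniusAlgHom kv kw]
    exact Nat.le_of_dvd (orderOf_pos σ) (orderOf_dvd_of_pow_eq_one h1)
  have hcard : orderOf σ = Nat.card (Lw ≃ₐ[Kv] Lw) :=
    le_antisymm (Nat.le_of_dvd Nat.card_pos (orderOf_dvd_natCard σ)) (hle.trans hord)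
  refine ⟨le_antisymm hle (hord.trans hcard.le), fun s => ?_⟩
  rw [Subgroup.eq_top_of_card_eq (Subgroup.zpowers σ) (by rw [Nat.card_zpowers, hcard])]
  exact Subgroup.mem_top s

open scoped Classical in
/-- In the case of maximal residue degree, crossed homomorphisms are coboundaries. -/
theorem exists_coboundary_of_inert [IsGalois K L]
    (hw : Nat.card kw = Nat.card kv ^ Module.finrank K L)
    (hn : IsUnit ((Nat.card (Lw ≃ₐ[Kv] Lw) : ℕ) : Ow))
    {d : (Lw ≃ₐ[Kv] Lw) → (W⁄Lw).toAffine.Point} (hd : IsCrossedHom (galoisPointHom W Kv Lw) d) :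
    ∃ b, ∀ s, d s = galoisPointHom W Kv Lw s b - b := by
  have : Fintype kv := Fintype.ofFinite _
  have : Fintype kw := Fintype.ofFinite _
  obtain ⟨σ, hσ⟩ := exists_frobeniusAlgHom w
  obtain ⟨hcard, hgen⟩ := mem_zpowers_frobenius w hw hσ
  have htr := congrArg (reductionHom Ow W) (hd.sum_iterate_eq_zero (σ := σ)
    (pow_card_eq_one' (x := σ)))
  have hit : ∀ i P, reductionHom Ow W ((galoisPointHom W Kv Lw σ)^[i] P) =
      (Point.map (W' := W) (S := kv) (FiniteField.frobeniusAlgHom kv kw))^[i]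
        (reductionHom Ow W P) := fun i P =>
    (show Function.Semiconj (reductionHom Ow W) (galoisPointHom W Kv Lw σ)
      (Point.map (W' := W) (S := kv) (FiniteField.frobeniusAlgHom kv kw)) from
      reductionHom_galois w σ _ hσ).iterate_right i P
  rw [map_sum, map_zero] at htr
  simp only [hit] at htr
  rw [Nat.card_eq_fintype_card, Nat.card_eq_fintype_card (α := kv)] at hw
  obtain ⟨Q, hQ⟩ := exists_frobenius_sub_eq_of_trace_eq_zero_baseChange W (k' := kw)
    (by rw [hw, hcard]) htr
  exact exists_coboundary_of_reductionHom w hgen hn hσ hd hQ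

omit [W.IsElliptic] in
/-- Without `p`-torsion over `k_v` there is none over `k_w`: a group of `p`-power order acts on the
`p`-torsion over `k_w`, with a single fixed point. -/
theorem eq_zero_of_nsmul_eq_zero_residueField [IsGalois K L] {p m : ℕ} [hp : Fact p.Prime]
    [DecidableEq kv] [DecidableEq kw] (hG : Nat.card (Lw ≃ₐ[Kv] Lw) ∣ p ^ m)
    (htors : ∀ P : (W⁄kv).toAffine.Point, p • P = 0 → P = 0) (P : (W⁄kw).toAffine.Point)
    (hP : p • P = 0) : P = 0 := by
  have : Fintype kv := Fintype.ofFinite _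
  obtain ⟨σ, hσ⟩ := exists_frobeniusAlgHom w
  have hφ : (FiniteField.frobeniusAlgHom kv kw)^[p ^ m] = id := by
    funext y
    obtain ⟨x, rfl⟩ := residue_surjective y
    obtain ⟨t, ht⟩ := hG
    rw [← residue_pow_smul w hσ, ht, pow_mul, pow_card_eq_one', one_pow, one_smul]
    rfl
  have : Finite (W⁄kw).toAffine.Point := finite_point _
  refine eq_zero_of_nsmul_eq_zero_of_iterate_eq
    (f := Point.map (W' := W) (S := kv) (FiniteField.frobeniusAlgHom kv kw)) (m := m)
    (fun Q => ?_) (fun Q hQ hfix => ?_) hP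
  · cases Q with
    | zero => exact iterate_map_zero _ (p ^ m)
    | some x y h =>
      obtain ⟨h', e⟩ := point_map_iterate W (FiniteField.frobeniusAlgHom kv kw) (p ^ m) h
      rw [e, Point.some.injEq, hφ]
      exact ⟨rfl, rfl⟩
  · obtain ⟨Q', rfl⟩ := exists_of_map_frobenius_iterate_eq (k := kv) (k' := kv) W (n := 1)
      (pow_one _).symm hfix
    rw [← map_nsmul, map_eq_zero_iff _ (Point.map_injective _)] at hQ
    rw [htors Q' hQ, map_zero]

open scoped Classical in
/-- Without `p`-torsion over `k_v`, multiplication by the order of `Gal(L_w/K_v)` is bijective on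
the points over `k_w` and on the kernel of reduction, hence on the points over `L_w`. -/
theorem exists_coboundary_of_torsion_eq_zero [IsGalois K L] [IsCyclic (Lw ≃ₐ[Kv] Lw)] {p m : ℕ}
    [hp : Fact p.Prime] (hG : Nat.card (Lw ≃ₐ[Kv] Lw) ∣ p ^ m)
    (hn : IsUnit ((Nat.card (Lw ≃ₐ[Kv] Lw) : ℕ) : Ow))
    (htors : ∀ P : (W⁄kv).toAffine.Point, p • P = 0 → P = 0)
    {d : (Lw ≃ₐ[Kv] Lw) → (W⁄Lw).toAffine.Point} (hd : IsCrossedHom (galoisPointHom W Kv Lw) d) :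
    ∃ b, ∀ s, d s = galoisPointHom W Kv Lw s b - b := by
  obtain ⟨σ, hσ⟩ := IsCyclic.exists_generator (α := Lw ≃ₐ[Kv] Lw)
  have hfin : Finite (W⁄kw).toAffine.Point := finite_point _
  have htors' : ∀ (i : ℕ) (P : (W⁄kw).toAffine.Point), p ^ i • P = 0 → P = 0 := by
    intro i
    induction i with
    | zero => intro P hP; simpa using hP
    | succ i ih =>
      intro P hP
      rw [pow_succ', mul_smul] at hP
      exact ih P (eq_zero_of_nsmul_eq_zero_residueField w hG htors _ hP)
  set N := Nat.card (Lw ≃ₐ[Kv] Lw)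
  have hN : ∀ P : (W⁄kw).toAffine.Point, N • P = 0 → P = 0 := by
    intro P hP
    obtain ⟨t, ht⟩ := hG
    refine htors' m P ?_
    rw [ht, mul_comm, mul_smul, hP, nsmul_zero]
  have hsurj : Function.Surjective fun P : (W⁄kw).toAffine.Point => N • P :=
    Finite.surjective_of_injective
      ((injective_iff_map_eq_zero (nsmulAddMonoidHom (α := (W⁄kw).toAffine.Point) N)).2 hN)
  refine hd.exists_coboundary hσ (S := ⊤) (fun _ _ => trivial) (fun P _ => ?_) (fun P _ hP => ?_)
    trivial
  · obtain ⟨Q', hQ'⟩ := hsurj (reductionHom Ow W P)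
    obtain ⟨Q, rfl⟩ := reductionHom_surjective (A := Ow) (W := W) Q'
    obtain ⟨T, -, hT⟩ := exists_nsmul_eq_of_mem_kernelOfReduction w (P := P - N • Q) hn (by
      rw [mem_kernelOfReduction_iff_reductionHom, map_sub, map_nsmul, sub_eq_zero]
      exact hQ'.symm)
    refine ⟨Q + T, trivial, ?_⟩
    rw [smul_add, hT]
    abel
  · refine eq_zero_of_nsmul_eq_zero_of_mem_kernel (A := Ow) (W := W) hn ?_ hP
    rw [mem_kernelOfReduction_iff_reductionHom]
    refine hN _ ?_
    rw [← map_nsmul, hP, map_zero]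

end Vanishing

/-! ### From crossed homomorphisms to `γ_v` -/

section Assembly

open WeierstrassCurve WeierstrassCurve.Affine IsLocalRing

theorem IsCrossedHom.comp_symm {G M M' : Type*} [Group G] [AddCommGroup M] [AddCommGroup M']
    {ρ : G →* AddMonoid.End M} {ρ' : G →* AddMonoid.End M'} {e : M ≃+ M'}
    (he : ∀ s x, e (ρ s x) = ρ' s (e x)) {d : G → M'} (hd : IsCrossedHom ρ' d) :
    IsCrossedHom ρ fun s => e.symm (d s) := by
  intro s t
  apply e.injective
  simp only [map_add, he, AddEquiv.apply_symm_apply, hd s t]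

theorem exists_coboundary_of_comp_symm {G M M' : Type*} [Group G] [AddCommGroup M]
    [AddCommGroup M'] {ρ : G →* AddMonoid.End M} {ρ' : G →* AddMonoid.End M'} {e : M ≃+ M'}
    (he : ∀ s x, e (ρ s x) = ρ' s (e x)) {d : G → M'}
    (h : ∃ b, ∀ s, e.symm (d s) = ρ s b - b) : ∃ b, ∀ s, d s = ρ' s b - b := by
  obtain ⟨b, hb⟩ := h
  refine ⟨e b, fun s => ?_⟩
  rw [← he, ← map_sub, ← hb, AddEquiv.apply_symm_apply]

open scoped Classical in
/-- Restriction to a finite Galois extension is injective if all crossed homomorphisms of its Galois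
group are coboundaries. -/
theorem galH1Res_injective {F k k' : Type*} [Field F] [Field k] [Field k'] [Algebra k k']
    [Algebra F k] [Algebra F k'] [IsScalarTower F k k'] [CharZero k] [IsGalois k k']
    {E : WeierstrassCurve F} (j : AlgebraicClosure k →ₐ[k] AlgebraicClosure k')
    (H : ∀ d : (k' ≃ₐ[k] k') → (E⁄k').toAffine.Point, IsCrossedHom (galoisPointHom E k k') d →
      ∃ b, ∀ s, d s = galoisPointHom E k k' s b - b) : Function.Injective (galH1Res E j) := by
  refine (injective_iff_map_eq_zero _).2 fun ξ hξ => ?_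
  obtain ⟨ι, r, hι, hsurj, hr⟩ := exists_embedding_and_restriction j
  obtain ⟨d, hd⟩ := exists_mem_inflationGraph hsurj hι hr hξ
  exact eq_zero_of_mem_inflationGraph hr hd (H d hd.1)

/-- A relation that is functional and injective after applying `T` yields an injective
homomorphism. -/
theorem exists_injective_of_graph {A X D Y : Type*} [AddCommGroup A] [AddCommGroup X]
    [AddCommGroup D] [AddCommGroup Y] {i : A →+ X} (hi : Function.Injective i)
    (Γ : AddSubgroup (X × D)) (T : D →+ Y) (hex : ∀ a, ∃ d, (i a, d) ∈ Γ)
    (h0 : ∀ d, (0, d) ∈ Γ → T d = 0) (hinj : ∀ x d, (x, d) ∈ Γ → T d = 0 → x = 0) :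
    ∃ θ : A →+ Y, Function.Injective θ := by
  choose D hD using hex
  have h1 : ∀ a b, T (D (a + b)) = T (D a) + T (D b) := by
    intro a b
    have h2 := sub_mem (hD (a + b)) (add_mem (hD a) (hD b))
    have h3 := h0 (D (a + b) - (D a + D b)) (by
      convert h2 using 1
      refine Prod.ext ?_ rfl
      simp)
    rw [← sub_eq_zero, ← map_add, ← map_sub, h3]
  refine ⟨AddMonoidHom.mk' (fun a => T (D a)) h1, (injective_iff_map_eq_zero _).2 fun a ha => ?_⟩
  exact hi ((hinj _ _ (hD a) ha).trans (map_zero i).symm)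

/-- An injective homomorphism from an `𝔽_p`-vector space lands in the `p`-torsion. -/
theorem rank_le_rank_torsionBy.{u} {p : ℕ} {A Y : Type u} [AddCommGroup A] [Module (ZMod p) A]
    [AddCommGroup Y] (θ : A →+ Y) (hθ : Function.Injective θ) :
    Module.rank (ZMod p) A ≤ Module.rank (ZMod p) (AddSubgroup.torsionBy Y (p : ℤ)) := by
  have hp : ∀ a : A, p • a = 0 := fun a => by
    rw [← Nat.cast_smul_eq_nsmul (ZMod p), CharP.cast_eq_zero, zero_smul]
  let θ' : A →+ AddSubgroup.torsionBy Y (p : ℤ) :=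
    θ.codRestrict (AddSubgroup.torsionBy Y (p : ℤ)) fun a =>
      AddSubgroup.torsionBy.nsmul_iff.2 (by rw [← map_nsmul, hp, map_zero])
  refine LinearMap.rank_le_of_injective (AddMonoidHom.toZModLinearMap p θ') fun a b hab => ?_
  exact hθ (congrArg Subtype.val hab)

variable {K L : Type*} [Field K] [NumberField K] [Field L] [NumberField L] [Algebra K L]
  {v : HeightOneSpectrum (𝓞 K)}

/-- A curve with good reduction has a model with unit discriminant over the completed integers. -/
theorem exists_integral_model (E : WeierstrassCurve K) (hgood : HasGoodReductionAt E v) :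
    ∃ (W : WeierstrassCurve (v.adicCompletionIntegers K))
      (C : VariableChange (v.adicCompletion K)), W.IsElliptic ∧
      (W⁄(v.adicCompletion K)) = C • (E⁄(v.adicCompletion K)) ∧
      (W⁄(residueFieldAt v)) = reductionAt E v := by
  refine ⟨integralModel (v.adicCompletionIntegers K) (minimalAt E v), _, ?_,
    baseChange_integralModel_eq _ (minimalAt E v), rfl⟩
  have h := (hasGoodReduction_iff_isElliptic_reduction (v.adicCompletionIntegers K)).1 hgood
  rw [isElliptic_iff, reduction, map_Δ] at h
  exact (isElliptic_iff _).2 ((isUnit_map_iff (residue (v.adicCompletionIntegers K)) _).1 h)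

theorem gammaMap_apply_coe {E : WeierstrassCurve K} (j : ClosureEmbeddings v L) (p : ℕ)
    (w : PrimesAbove v L)
    (ξ : AddSubgroup.torsionBy (galH1 E (v.adicCompletion K)) (p : ℤ)) :
    (gammaMap E j p ξ w : galH1 E (w.1.adicCompletion L)) = galH1Res E (j w) ξ := rfl

/-- The map `γ_v` is injective as soon as one of its components is. -/
theorem gammaMap_injective {E : WeierstrassCurve K} (j : ClosureEmbeddings v L) (p : ℕ)
    (w : PrimesAbove v L) (h : Function.Injective (galH1Res E (j w))) :
    Function.Injective (gammaMap E j p) := by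
  intro ξ η hξ
  refine Subtype.ext (h ?_)
  rw [← gammaMap_apply_coe, ← gammaMap_apply_coe, hξ]

variable (w : PrimesAbove v L)

local notation "Kv" => v.adicCompletion K
local notation "Lw" => HeightOneSpectrum.adicCompletion L (Subtype.val w)
local notation "Ov" => v.adicCompletionIntegers K
local notation "Ow" => HeightOneSpectrum.adicCompletionIntegers L (Subtype.val w)
local notation "kv" => IsLocalRing.ResidueField Ov
local notation "kw" => IsLocalRing.ResidueField Ow

open scoped Classical in
/-- The points over `L_w` of `E` and of an integral model of `E` over `𝓞_v` agree, compatibly with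
the Galois action. -/
theorem exists_point_equiv {E : WeierstrassCurve K} [E.IsElliptic] {W : WeierstrassCurve Ov}
    {C : VariableChange Kv} (hC : (W⁄Kv) = C • (E⁄Kv)) :
    ∃ e : (W⁄Lw).toAffine.Point ≃+ (E⁄Lw).toAffine.Point,
      ∀ s x, e (galoisPointHom W Kv Lw s x) = galoisPointHom E Kv Lw s (e x) := by
  have : (E⁄Lw).IsElliptic := inferInstanceAs (E.map (algebraMap K Lw)).IsElliptic
  have h : (W⁄Lw) = C.map (algebraMap Kv Lw) • (E⁄Lw) := baseChange_eq_map_smul hC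
  exact ⟨variableChangeEquiv h, fun s x => variableChangeEquiv_map h _ x⟩

open scoped Classical in
theorem galH1Res_completion_injective [IsGalois K L] {E : WeierstrassCurve K} [E.IsElliptic]
    {W : WeierstrassCurve Ov} {C : VariableChange Kv} (hC : (W⁄Kv) = C • (E⁄Kv))
    (j : AlgebraicClosure Kv →ₐ[Kv] AlgebraicClosure Lw)
    (H : ∀ d : (Lw ≃ₐ[Kv] Lw) → (W⁄Lw).toAffine.Point, IsCrossedHom (galoisPointHom W Kv Lw) d →
      ∃ b, ∀ s, d s = galoisPointHom W Kv Lw s b - b) : Function.Injective (galH1Res E j) := by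
  have : CharZero Kv := charZero_of_injective_algebraMap (algebraMap K Kv).injective
  obtain ⟨e, he⟩ := exists_point_equiv w hC
  exact galH1Res_injective j fun d hd =>
    exists_coboundary_of_comp_symm he (H _ (hd.comp_symm he))

/-- If the residue field does not grow, the Galois group acts trivially on it. -/
theorem residue_smul_of_surjective (h : Function.Surjective (algebraMap kv kw)) (σ : Lw ≃ₐ[Kv] Lw)
    (x : Ow) : residue Ow (σ • x) = residue Ow x := by
  obtain ⟨a, ha⟩ := h (residue Ow x)
  obtain ⟨a, rfl⟩ := residue_surjective a
  have h1 : residue Ow (algebraMap Ov Ow a) = residue Ow x := ha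
  rw [← sub_eq_zero, ← map_sub, residue_eq_zero_iff] at h1
  have h2 := galois_smul_mem_maximalIdeal w σ h1
  rw [smul_sub, smul_algebraMap, ← residue_eq_zero_iff, map_sub, sub_eq_zero] at h2
  exact h2.symm.trans ha

open scoped Classical in
/-- In the totally ramified case the value of a crossed homomorphism at a generator, modulo the
maximal ideal, embeds the classes that die over `L_w` into the points of the reduction. -/
theorem exists_injective_of_totallyRamified [IsGalois K L] [IsCyclic (Lw ≃ₐ[Kv] Lw)]
    (hw : Function.Surjective (algebraMap kv kw))
    (hn : IsUnit ((Nat.card (Lw ≃ₐ[Kv] Lw) : ℕ) : Ow)) {E : WeierstrassCurve K} [E.IsElliptic]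
    {W : WeierstrassCurve Ov} [W.IsElliptic] {C : VariableChange Kv}
    (hC : (W⁄Kv) = C • (E⁄Kv)) (j : AlgebraicClosure Kv →ₐ[Kv] AlgebraicClosure Lw)
    {A : Type*} [AddCommGroup A] {i : A →+ galH1 E Kv} (hi : Function.Injective i)
    (hA : ∀ a, galH1Res E j (i a) = 0) :
    ∃ θ : A →+ (W⁄kv).toAffine.Point, Function.Injective θ := by
  have : CharZero Kv := charZero_of_injective_algebraMap (algebraMap K Kv).injective
  obtain ⟨e, he⟩ := exists_point_equiv w hC
  obtain ⟨σ, hσ⟩ := IsCyclic.exists_generator (α := Lw ≃ₐ[Kv] Lw)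
  obtain ⟨ι, r, hι, hsurj, hr⟩ := exists_embedding_and_restriction j
  let β := Point.map (W' := W) (S := kv) (IsScalarTower.toAlgHom kv kv kw)
  have hβ : Function.Bijective β := by
    refine ⟨Point.map_injective _, ?_⟩
    rintro (_ | ⟨x, y, h⟩)
    · exact ⟨0, rfl⟩
    · obtain ⟨x', rfl⟩ := hw x
      obtain ⟨y', rfl⟩ := hw y
      exact ⟨.some x' y' ((WeierstrassCurve.Affine.baseChange_nonsingular W
        (IsScalarTower.toAlgHom kv kv kw).injective x' y').mp h), rfl⟩
  let b := AddEquiv.ofBijective β hβ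
  let T : ((Lw ≃ₐ[Kv] Lw) → (E⁄Lw).toAffine.Point) →+ (W⁄kv).toAffine.Point :=
    b.symm.toAddMonoidHom.comp ((reductionHom Ow W).comp
      (e.symm.toAddMonoidHom.comp (Pi.evalAddMonoidHom _ σ)))
  have hT : ∀ d, T d = 0 ↔ reductionHom Ow W (e.symm (d σ)) = 0 := fun d =>
    map_eq_zero_iff b.symm b.symm.injective
  have hid : ∀ P : (W⁄kw).toAffine.Point,
      Point.map (W' := W) (S := kv) (AlgHom.id kv kw) P = P := by rintro (_ | _) <;> rfl
  refine exists_injective_of_graph hi (inflationGraph E ι r) T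
    (fun a => exists_mem_inflationGraph hsurj hι hr (hA a)) (fun d hd => ?_) (fun ξ d hd h0 => ?_)
  · obtain ⟨m, hm⟩ := exists_coboundary_of_zero_mem_inflationGraph hsurj hr hd
    obtain ⟨m, rfl⟩ := e.surjective m
    rw [hT, hm, ← he, ← map_sub, AddEquiv.symm_apply_apply, map_sub,
      reductionHom_galois w σ (AlgHom.id kv kw) (residue_smul_of_surjective w hw σ), hid, sub_self]
  · refine eq_zero_of_mem_inflationGraph hr hd (exists_coboundary_of_comp_symm he ?_)
    refine exists_coboundary_of_mem_kernelOfReduction w hσ hn (hd.1.comp_symm he) ?_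
    exact mem_kernelOfReduction_iff_reductionHom.2 ((hT d).1 h0)

end Assembly

/-- The inclusion of the kernel of `γ_v` in `H¹(K_v, E)`. -/
noncomputable def kerGammaMapHom {K L : Type*} [Field K] [NumberField K] [Field L] [NumberField L]
    [Algebra K L] {v : HeightOneSpectrum (𝓞 K)} (E : WeierstrassCurve K)
    (j : ClosureEmbeddings v L) (p : ℕ) :
    LinearMap.ker (gammaMap E j p) →+ galH1 E (v.adicCompletion K) where
  toFun ξ := ξ.1.1
  map_zero' := rfl
  map_add' _ _ := rfl

open WeierstrassCurve IsLocalRing in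
open scoped Classical in
/-- If the residue field does not grow at `w`, then the kernel of `γ_v` is no larger than the
`p`-torsion of the reduction. -/
theorem rank_ker_gammaMap_le {K L : Type*} [Field K] [NumberField K] [Field L] [NumberField L]
    [Algebra K L] [IsGalois K L] {v : HeightOneSpectrum (𝓞 K)} (w : PrimesAbove v L)
    [IsCyclic (w.1.adicCompletion L ≃ₐ[v.adicCompletion K] w.1.adicCompletion L)]
    (hw : Function.Surjective (algebraMap (residueFieldAt v) (residueFieldAt w.1)))
    (hn : IsUnit ((Nat.card (w.1.adicCompletion L ≃ₐ[v.adicCompletion K] w.1.adicCompletion L) : ℕ) :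
      w.1.adicCompletionIntegers L))
    {E : WeierstrassCurve K} [E.IsElliptic] {W : WeierstrassCurve (v.adicCompletionIntegers K)}
    [W.IsElliptic] {C : VariableChange (v.adicCompletion K)}
    (hC : (W⁄(v.adicCompletion K)) = C • (E⁄(v.adicCompletion K)))
    {V : WeierstrassCurve (residueFieldAt v)} (hV : (W⁄(residueFieldAt v)) = V)
    (j : ClosureEmbeddings v L) (p : ℕ) :
    Module.rank (ZMod p) (LinearMap.ker (gammaMap E j p)) ≤
      Module.rank (ZMod p) (AddSubgroup.torsionBy V.toAffine.Point (p : ℤ)) := by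
  subst hV
  obtain ⟨θ, hθ⟩ := exists_injective_of_totallyRamified w hw hn hC (j w)
    (i := kerGammaMapHom E j p) (Subtype.val_injective.comp Subtype.val_injective) fun ξ => by
      change (gammaMap E j p ξ.1 w : galH1 E (w.1.adicCompletion L)) = 0
      rw [LinearMap.mem_ker.1 ξ.2]
      rfl
  exact rank_le_rank_torsionBy (p := p) θ hθ

theorem natCast_notMem_of_dvd_pow {R : Type*} [CommRing R] {I : Ideal R} [I.IsPrime] {N p n : ℕ}
    (h : N ∣ p ^ n) (hp : (p : R) ∉ I) : (N : R) ∉ I := by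
  obtain ⟨t, ht⟩ := h
  intro hN
  have h1 : ((p ^ n : ℕ) : R) ∈ I := by
    rw [ht, Nat.cast_mul]
    exact I.mul_mem_right _ hN
  rw [Nat.cast_pow] at h1
  exact hp (Ideal.IsPrime.mem_of_pow_mem inferInstance n h1)

open WeierstrassCurve in
open scoped Classical in
theorem eq_zero_of_torsionBy_eq_bot {F : Type*} [Field F] {V V' : WeierstrassCurve F}
    (hV : V = V') {p : ℕ} (h : AddSubgroup.torsionBy V'.toAffine.Point (p : ℤ) = ⊥)
    (P : V.toAffine.Point) (hP : p • P = 0) : P = 0 := by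
  subst hV
  exact AddSubgroup.mem_bot.1 (h ▸ AddSubgroup.torsionBy.nsmul_iff.2 hP)

end SelmerLocal

open SelmerLocal

set_option maxHeartbeats 400000 in
theorem proposition2p5 {K L : Type*} [Field K] [NumberField K] [Field L] [NumberField L]
    [Algebra K L] [IsGalois K L] (p : ℕ) (hp : p.Prime) (hp2 : p ≠ 2) (n : ℕ) (hn : 1 ≤ n)
    (hG : Nonempty ((L ≃ₐ[K] L) ≃* Multiplicative (ZMod (p ^ n))))
    (E : WeierstrassCurve K) [E.IsElliptic]
    (v : HeightOneSpectrum (𝓞 K)) (hvp : (p : 𝓞 K) ∉ v.asIdeal) (hgood : HasGoodReductionAt E v)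
    (j : ClosureEmbeddings v L) :
    (IsTotallyRamifiedIn v L →
      Module.rank (ZMod p) (LinearMap.ker (gammaMap E j p)) ≤
        Module.rank (ZMod p) (reductionTorsion E v p)) ∧
    (IsInertIn v L → Function.Injective (gammaMap E j p)) ∧
    (IsRamifiedIn v L → reductionTorsion E v p = ⊥ → Function.Injective (gammaMap E j p)) := by
  classical
  have hpf : Fact p.Prime := ⟨hp⟩
  obtain ⟨eG⟩ := hG
  have hcyc : IsCyclic (L ≃ₐ[K] L) := isCyclic_of_surjective eG.symm eG.symm.surjective
  have hcard : Nat.card (L ≃ₐ[K] L) = p ^ n := by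
    rw [Nat.card_congr eG.toEquiv]
    exact Nat.card_zmod _
  have hvprime := v.isPrime
  obtain ⟨W, C, hW, hC, hred⟩ := exists_integral_model E hgood
  have hdvd : ∀ w : PrimesAbove v L, Nat.card
      (w.1.adicCompletion L ≃ₐ[v.adicCompletion K] w.1.adicCompletion L) ∣ p ^ n := fun w =>
    hcard ▸ card_galois_completion_dvd w
  have hunit : ∀ w : PrimesAbove v L, IsUnit ((Nat.card
      (w.1.adicCompletion L ≃ₐ[v.adicCompletion K] w.1.adicCompletion L) : ℕ) :
        w.1.adicCompletionIntegers L) := fun w =>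
    isUnit_natCast_integers w (natCast_notMem_of_dvd_pow (hdvd w) hvp)
  refine ⟨?_, fun hin => ?_, ?_⟩
  · rintro ⟨w, hw⟩
    have := isCyclic_galois_completion w
    exact rank_ker_gammaMap_le w (residueField_algebraMap_surjective w hw) (hunit w) hC hred j p
  · obtain ⟨w, hw⟩ := exists_primesAbove_of_isInertIn hin
    exact gammaMap_injective j p w (galH1Res_completion_injective w hC (j w) fun d hd =>
      exists_coboundary_of_inert w hw (hunit w) hd)
  · rintro ⟨w, -⟩ htors
    have := isCyclic_galois_completion w
    exact gammaMap_injective j p w (galH1Res_completion_injective w hC (j w) fun d hd =>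
      exists_coboundary_of_torsion_eq_zero w (hdvd w) (hunit w)
        (eq_zero_of_torsionBy_eq_bot hred htors) hd)
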